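/- **Setting.** For each $n$ let $\mu=(\mu_1,\dots,\mu_n)$ be a random vector and $Y_i=\mu_i+\varepsilon_i$, where $\varepsilon_1,\dots,\varepsilon_n$ are i.i.d. $N(0,1)$ and independent of $\mu$ (the dependence on $n$ is suppressed). Let $\tilde\mu=\tilde\mu(Y)$ and $\hat\mu=\hat\mu(Y)$ be measurable functions of the data with values in $\mathbb R^n$; put $Z_i=Y_i-\tilde\mu_i$ and $\nu_i=\mu_i-\tilde\mu_i$. Let $F_\nu^n$ be the (random) empirical distribution of $\nu_1,\dots,\nu_n$, $\varphi$ the standard normal density, $f_Z(z)=\frac1n\sum_{i}\varphi(z-\nu_i)$ and $\delta(z)=z+f_Z'(z)/f_Z(z)$; the oracle is $\mu^I_i=\tilde\mu_i+\delta(Z_i)$. Let $K(x)=2(e^x+e^{-x})^{-2}$ be the logistic kernel, $\sigma=\sigma_n=1/\log n$, $K_\sigma(x)=\sigma^{-1}K(x/\sigma)$, $\hat f_Z(z)=\frac1n\sum_jK_\sigma(z-Z_j)$ and $\hat f_Z'(z)=\frac1n\sum_jK_\sigma'(z-Z_j)$, and let $\hat\delta(z)=z+\hat f_Z'(z)/\hat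 f_Z(z)$; the empirical Bayes estimator is $\hat\mu^I_i=\tilde\mu_i+\hat\delta(Z_i)$. **Assumption 1.** $\tilde\mu_i$ is a function of $(Y_j)_{j\ne i}$, and for $j\neq i$ it is Lipschitz in $Y_j$ with constant $\rho_{|i-j|}$, where the sequence $(\rho_M)$ does not depend on $n$ and $\limsup_{M\to\infty}M^2\rho_M<1$. **Assumption 2.** There is $\alpha_n=\alpha_n(Y)<1$, a measurable function of the data, such that $\hat\mu_i=\alpha_n\tilde\mu_i+(1-\alpha_n)Y_i+\zeta_i$, where $E\zeta_i^2\to0$ as $n\to\infty$, uniformly over $\kappa n\le i\le(1-\kappa)n$, for every $\kappa>0$. **Assumption 3.** For all large $n$, $\frac1n\sum_{i=1}^nP(|Y_i-\tilde\mu_i|>\log n)\le(\log n)^{-8}$. **Theorem.** (i) Under Assumptions 1 and 3, $$E\|\hat\mu^I-\mu\|^2\le E\|\mu^I-\mu\|^2+o(n),$$ and if moreover $\hat\mu$ satisfies Assumption 2, then $$E\|\mu^I-\mu\|^2+o(n)\le E\|\hat\mu-\mu\|^2+o(n).$$ (ii) Under Assumptions 1–3, suppose that $\alpha_n\to\alpha$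 in probability for a constant $\alpha\in(0,1)$, and that $F_\nu^n$ converges weakly, in probability, to a (nonrandom) probability distribution different from $N(0,(1-\alpha)/\alpha)$. Then there is $c<1$ such that $E\|\hat\mu^I-\mu\|^2\le c\,E\|\hat\mu-\mu\|^2$ for all large $n$. -/

import Mathlib

open MeasureTheory ProbabilityTheory Filter Topology Asymptotics
open scoped NNReal ENNReal BoundedContinuousFunction

noncomputable section

namespace EBFilter

/-- The observation model: `ε` is a vector of i.i.d. standard normal variables, independent of the
random vector `μ`. -/
structure IsModel {n : ℕ} {Ω : Type*} [MeasurableSpace Ω] (P : Measure Ω)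
    (μ ε : Ω → Fin n → ℝ) : Prop where
  measurable_mu : Measurable μ
  measurable_eps : Measurable ε
  gaussian : ∀ i, P.map (fun ω => ε ω i) = gaussianReal 0 1
  indep : iIndepFun (fun i ω => ε ω i) P
  indep_mu : IndepFun μ ε P

/-- The observations `Y = μ + ε`. -/
def obs {n : ℕ} {Ω : Type*} (μ ε : Ω → Fin n → ℝ) (ω : Ω) : Fin n → ℝ :=
  fun i => μ ω i + ε ω i

/-- The residuals `Z_i = Y_i - μtilde_i`, where `μtilde = t Y` is a function of the data. -/
def resid {n : ℕ} {Ω : Type*} (μ ε : Ω → Fin n → ℝ) (t : (Fin n → ℝ) → Fin n → ℝ) (ω : Ω) :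
    Fin n → ℝ :=
  fun i => obs μ ε ω i - t (obs μ ε ω) i

/-- The centred means `ν_i = μ_i - μtilde_i`. -/
def nu {n : ℕ} {Ω : Type*} (μ ε : Ω → Fin n → ℝ) (t : (Fin n → ℝ) → Fin n → ℝ) (ω : Ω) :
    Fin n → ℝ :=
  fun i => μ ω i - t (obs μ ε ω) i

/-- `f_Z(z) = n⁻¹ ∑ φ(z - ν_i)`, with `φ` the standard normal density. -/
def fZ {n : ℕ} (ν : Fin n → ℝ) (z : ℝ) : ℝ :=
  (n : ℝ)⁻¹ * ∑ i, gaussianPDFReal 0 1 (z - ν i)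

/-- The oracle rule `δ(z) = z + f_Z'(z) / f_Z(z)`. -/
def oracleRule {n : ℕ} (ν : Fin n → ℝ) (z : ℝ) : ℝ :=
  z + deriv (fZ ν) z / fZ ν z

/-- The logistic kernel, the derivative of `x ↦ (1 + exp (-2 x))⁻¹`. -/
def logisticKernel (x : ℝ) : ℝ := 2 / (Real.exp x + Real.exp (-x)) ^ 2

/-- `K_σ(x) = σ⁻¹ K(x / σ)`. -/
def scaledKernel (σ x : ℝ) : ℝ := σ⁻¹ * logisticKernel (x / σ)

/-- The kernel estimate of the density of the residuals. -/
def fHat {n : ℕ} (σ : ℝ) (Z : Fin n → ℝ) (z : ℝ) : ℝ :=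
  (n : ℝ)⁻¹ * ∑ j, scaledKernel σ (z - Z j)

/-- The kernel estimate of the derivative of the density of the residuals. -/
def fHat' {n : ℕ} (σ : ℝ) (Z : Fin n → ℝ) (z : ℝ) : ℝ :=
  (n : ℝ)⁻¹ * ∑ j, deriv (scaledKernel σ) (z - Z j)

/-- The empirical Bayes rule `z + fHat'(z) / fHat(z)`. -/
def ebRule {n : ℕ} (σ : ℝ) (Z : Fin n → ℝ) (z : ℝ) : ℝ :=
  z + fHat' σ Z z / fHat σ Z z

/-- The oracle `μ^I_i = μtilde_i + δ(Z_i)`. -/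
def oracle {n : ℕ} {Ω : Type*} (μ ε : Ω → Fin n → ℝ) (t : (Fin n → ℝ) → Fin n → ℝ) (ω : Ω) :
    Fin n → ℝ :=
  fun i => t (obs μ ε ω) i + oracleRule (nu μ ε t ω) (resid μ ε t ω i)

/-- The empirical Bayes estimator, with bandwidth `1 / log n`. -/
def ebEstimator {n : ℕ} {Ω : Type*} (μ ε : Ω → Fin n → ℝ) (t : (Fin n → ℝ) → Fin n → ℝ)
    (ω : Ω) : Fin n → ℝ :=
  fun i => t (obs μ ε ω) i + ebRule (1 / Real.log n) (resid μ ε t ω) (resid μ ε t ω i)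

/-- The total squared error risk `E ‖X - μ‖²` (Euclidean norm), with values in `[0, ∞]`. -/
def risk {n : ℕ} {Ω : Type*} [MeasurableSpace Ω] (P : Measure Ω) (X μ : Ω → Fin n → ℝ) : ℝ≥0∞ :=
  ∫⁻ ω, ENNReal.ofReal (∑ i, (X ω i - μ ω i) ^ 2) ∂P

/-- The empirical distribution of `ν_1, …, ν_n`. -/
def empiricalMeasure {n : ℕ} (ν : Fin n → ℝ) : Measure ℝ :=
  (n : ℝ≥0∞)⁻¹ • ∑ i, Measure.dirac (ν i)

/-- Convergence in probability to a constant; the probability space may change with `n`. -/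
def TendstoInProb {Ω : ℕ → Type*} [∀ n, MeasurableSpace (Ω n)] (P : ∀ n, Measure (Ω n))
    (X : ∀ n, Ω n → ℝ) (a : ℝ) : Prop :=
  ∀ η > 0, Tendsto (fun n => P n {ω | η ≤ |X n ω - a|}) atTop (𝓝 0)

/-- Weak convergence, in probability, of random measures to a fixed measure. -/
def TendstoWeaklyInProb {Ω : ℕ → Type*} [∀ n, MeasurableSpace (Ω n)] (P : ∀ n, Measure (Ω n))
    (F : ∀ n, Ω n → Measure ℝ) (G : Measure ℝ) : Prop :=
  ∀ f : ℝ →ᵇ ℝ, TendstoInProb P (fun n ω => ∫ x, f x ∂(F n ω)) (∫ x, f x ∂G)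

/-- Each `μtilde_i` is a function of the `Y_j`, `j ≠ i`, and is Lipschitz in `Y_j` with a constant
`ρ_{|i-j|}` (the same for all `n`), where `limsup M² ρ_M < 1`. -/
def Assumption1 (t : ∀ n, (Fin n → ℝ) → Fin n → ℝ) : Prop :=
  (∀ n, Measurable (t n)) ∧
  (∀ n (i : Fin n) (y : Fin n → ℝ) (d : ℝ), t n (Function.update y i (y i + d)) i = t n y i) ∧
  ∃ ρ : ℕ → ℝ≥0,
    limsup (fun M : ℕ => (M : ℝ≥0∞) ^ 2 * (ρ M : ℝ≥0∞)) atTop < 1 ∧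
    ∀ n (i j : Fin n), j ≠ i → ∀ (y : Fin n → ℝ) (d : ℝ),
      |t n (Function.update y j (y j + d)) i - t n y i|
        ≤ ρ ((i : ℤ) - (j : ℤ)).natAbs * |d|

/-- `μhat_i = α_n μtilde_i + (1 - α_n) Y_i + ζ_i`, where `α_n < 1` is a function of the data and
`E ζ_i² → 0` as `n → ∞`, uniformly over `κ n ≤ i ≤ (1 - κ) n`, for each `κ > 0`. -/
def Assumption2 {Ω : ℕ → Type*} [∀ n, MeasurableSpace (Ω n)] (P : ∀ n, Measure (Ω n))
    (μ ε : ∀ n, Ω n → Fin n → ℝ) (t m : ∀ n, (Fin n → ℝ) → Fin n → ℝ)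
    (α : ∀ n, (Fin n → ℝ) → ℝ) : Prop :=
  (∀ n, Measurable (α n)) ∧ (∀ n y, α n y < 1) ∧
  ∀ κ > (0 : ℝ), ∀ η > (0 : ℝ≥0∞), ∀ᶠ n : ℕ in atTop, ∀ i : Fin n,
    κ * n ≤ ((i : ℕ) : ℝ) + 1 → ((i : ℕ) : ℝ) + 1 ≤ (1 - κ) * n →
    ∫⁻ ω, ENNReal.ofReal
      ((m n (obs (μ n) (ε n) ω) i
        - (α n (obs (μ n) (ε n) ω) * t n (obs (μ n) (ε n) ω) i
          + (1 - α n (obs (μ n) (ε n) ω)) * obs (μ n) (ε n) ω i)) ^ 2) ∂(P n) ≤ η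

/-- For large `n`, the average of `P(|Y_i - μtilde_i| > log n)` is at most `(log n)⁻⁸`. -/
def Assumption3 {Ω : ℕ → Type*} [∀ n, MeasurableSpace (Ω n)] (P : ∀ n, Measure (Ω n))
    (μ ε : ∀ n, Ω n → Fin n → ℝ) (t : ∀ n, (Fin n → ℝ) → Fin n → ℝ) : Prop :=
  ∀ᶠ n : ℕ in atTop,
    (n : ℝ)⁻¹ * ∑ i, (P n).real {ω | Real.log n < |resid (μ n) (ε n) (t n) ω i|}
      ≤ 1 / Real.log n ^ 8

end EBFilter

end

open EBFilter

-- All losses are read through the noise. With `Z_i = ν_i + ε_i`, a rule `z + s(z)` applied to the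
-- residuals has error `ε_i + s(Z_i)`, and an estimator as in Assumption 2 has error `ε_i - α Z_i +
-- ζ_i`. By Assumption 1, `ν_i` does not depend on `ε_i`, and `ν_j` moves by at most `ρ_{|i-j|}` per
-- unit of `ε_i`, with `∑ ρ` finite. So the noise acts almost as if it were independent of the `ν`:
-- replacing one `ε_i` by a fresh copy preserves the joint law (`IsModel.map_update`), which bounds
-- covariances by multiples of `ρ_{|i-j|}` and gives a sum of conditionally centred terms a second
-- moment of order `n` (`IsModel.integral_sq_sum_le`).
--
-- Empirical rule against oracle. Second moments on a grid and a bias bound for the logistic kernel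
-- make `fHat` and `fHat'` close to `f_Z` and `f_Z'` on `[-log n, log n]`, with an error small
-- relative to `f_Z + η`, where `η = (log n)⁻²⁴` (`eventually_kernelClose`). Where `f_Z ≥ η` the two
-- scores nearly agree. The other indices are few: large residuals by Assumption 3, points of low
-- density by counting (`card_low_density_le`). There the losses are still `O(ε_i² + log² n)`,
-- because `|K'| ≤ 2K` bounds the empirical score and Jensen's inequality bounds the true one.
-- Hence, up to `o(n)`, the empirical rule has at most the risk of the rule with score `f'/max(f,
-- η)`, and the oracle has exactly that risk (`eventually_risk_comparison`).
--
-- Oracle against linear rules. The regularised score is Lipschitz in `ν`, so making each noise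
-- variable fresh in its own term costs only a power of `log n` in total. Integrating by parts, the
-- risk is then at most `n (1 + E gain)` up to `o(n)`, with `gain = ∫ (-2 s f' + s² f)`
-- (`IsModel.regRisk_le`). On the other side, the loss `∑ (ε_i - α Z_i)²` is quadratic in `α` with
-- coefficients that concentrate once `z` is smoothly truncated, so it is bounded below by the gain
-- of the linear rule simultaneously for all `α < 1`, which permits an `α` chosen from the data
-- (`linear_loss_ge`, `eventually_exists_lossError`). The score minimises the gain, and completing
-- the square shows that it wins by the squared distance of `f'` from `-α z f` (`gain_add_gap_le`,
-- `linearGap`). The outcome is `exists_risk_ge`.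
--
-- Strict improvement. If the limiting mixture satisfied `f' + a z f = 0` everywhere, it would be
-- normal with variance `1/a`, and dividing characteristic functions would give `G = N(0, (1-a)/a)`
-- (`eq_gaussianReal_of_linear_score`). Otherwise the equation fails at some point, and weak
-- convergence with Lipschitz bounds keeps the expected margin away from zero
-- (`exists_linearGap_ge`). The regularised risk is at most about `n`, so a margin of order `n` is a
-- constant factor.

notation "φ" => gaussianPDFReal 0 1
notation "γ" => gaussianReal 0 1

namespace EBFilter

/-! ### The standard normal density -/

/-- The derivative of the standard normal density. -/
noncomputable def phiDeriv (x : ℝ) : ℝ := -x * φ x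

lemma phi_eq (x : ℝ) : φ x = (√(2 * Real.pi))⁻¹ * Real.exp (-x ^ 2 / 2) := by
  simp [gaussianPDFReal]

lemma phi_pos (x : ℝ) : 0 < φ x := gaussianPDFReal_pos 0 1 x one_ne_zero

lemma phi_nonneg (x : ℝ) : 0 ≤ φ x := (phi_pos x).le

lemma one_le_sqrt_two_pi : 2 ≤ √(2 * Real.pi) := by
  apply Real.le_sqrt_of_sq_le
  nlinarith [Real.pi_gt_three]

lemma phi_le_half_exp (x : ℝ) : φ x ≤ 1 / 2 * Real.exp (-x ^ 2 / 2) := by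
  rw [phi_eq]
  gcongr
  rw [one_div]
  exact inv_anti₀ (by norm_num) one_le_sqrt_two_pi

lemma phi_le_one (x : ℝ) : φ x ≤ 1 := by
  have h := phi_le_half_exp x
  have : Real.exp (-x ^ 2 / 2) ≤ 1 := by
    rw [Real.exp_le_one_iff]; nlinarith [sq_nonneg x]
  linarith

lemma sq_mul_phi_le (x : ℝ) : x ^ 2 * φ x ≤ 1 := by
  have h := phi_le_half_exp x
  have h1 : x ^ 2 / 2 + 1 ≤ Real.exp (x ^ 2 / 2) := Real.add_one_le_exp _
  have h2 : Real.exp (-x ^ 2 / 2) * Real.exp (x ^ 2 / 2) = 1 := by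
    rw [← Real.exp_add]; ring_nf; simp
  have h3 := Real.exp_pos (-x ^ 2 / 2)
  nlinarith [sq_nonneg x]

lemma one_add_sq_mul_phi_le (x : ℝ) : (1 + x ^ 2) * φ x ≤ 1 := by
  have h := phi_le_half_exp x
  have h1 : x ^ 2 / 2 + 1 ≤ Real.exp (x ^ 2 / 2) := Real.add_one_le_exp _
  have h2 : Real.exp (-x ^ 2 / 2) * Real.exp (x ^ 2 / 2) = 1 := by
    rw [← Real.exp_add]; ring_nf; simp
  have h3 := Real.exp_pos (-x ^ 2 / 2)
  nlinarith [sq_nonneg x]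

lemma hasDerivAt_phi (x : ℝ) : HasDerivAt φ (phiDeriv x) x := by
  have : (φ : ℝ → ℝ) = fun x => (√(2 * Real.pi))⁻¹ * Real.exp (-x ^ 2 / 2) := funext phi_eq
  rw [phiDeriv, phi_eq, this]
  have h : HasDerivAt (fun x : ℝ => -x ^ 2 / 2) (-(2 * x) / 2) x := by
    simpa using ((hasDerivAt_pow 2 x).neg.div_const 2)
  exact (h.exp.const_mul (√(2 * Real.pi))⁻¹).congr_deriv (by ring)

lemma hasDerivAt_phiDeriv (x : ℝ) : HasDerivAt phiDeriv ((x ^ 2 - 1) * φ x) x := by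
  exact ((hasDerivAt_id x).neg.mul (hasDerivAt_phi x)).congr_deriv (by
    simp [phiDeriv]; ring)

lemma abs_phiDeriv_le' (x : ℝ) : |phiDeriv x| ≤ (1 + x ^ 2) * φ x := by
  rw [phiDeriv, abs_mul, abs_neg, abs_of_nonneg (phi_nonneg x)]
  have : |x| ≤ 1 + x ^ 2 := by
    rw [← sq_abs]; nlinarith [sq_nonneg (|x| - 1), abs_nonneg x]
  exact mul_le_mul_of_nonneg_right this (phi_nonneg x)

lemma abs_phiDeriv_le (x : ℝ) : |phiDeriv x| ≤ 1 :=
  (abs_phiDeriv_le' x).trans (one_add_sq_mul_phi_le x)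

lemma abs_phiDeriv2_le' (x : ℝ) : |(x ^ 2 - 1) * φ x| ≤ (1 + x ^ 2) * φ x := by
  rw [abs_mul, abs_of_nonneg (phi_nonneg x)]
  refine mul_le_mul_of_nonneg_right ?_ (phi_nonneg x)
  rw [abs_le]; constructor <;> nlinarith [sq_nonneg x]

lemma abs_phiDeriv2_le (x : ℝ) : |(x ^ 2 - 1) * φ x| ≤ 1 :=
  (abs_phiDeriv2_le' x).trans (one_add_sq_mul_phi_le x)

lemma abs_sub_le_of_deriv_le {f f' : ℝ → ℝ} {C : ℝ} (hf : ∀ x, HasDerivAt f (f' x) x)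
    (hC : ∀ x, |f' x| ≤ C) (x y : ℝ) : |f x - f y| ≤ C * |x - y| := by
  have := Convex.norm_image_sub_le_of_norm_hasDerivWithin_le (f := f) (f' := f') (C := C)
    (s := Set.univ) (x := y) (y := x) (fun x _ => (hf x).hasDerivWithinAt)
    (fun x _ => by simpa using hC x) convex_univ (Set.mem_univ _) (Set.mem_univ _)
  simpa using this

lemma phi_lipschitz (x y : ℝ) : |φ x - φ y| ≤ |x - y| := by
  simpa using abs_sub_le_of_deriv_le hasDerivAt_phi abs_phiDeriv_le x y

lemma phiDeriv_lipschitz (x y : ℝ) : |phiDeriv x - phiDeriv y| ≤ |x - y| := by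
  simpa using abs_sub_le_of_deriv_le hasDerivAt_phiDeriv abs_phiDeriv2_le x y

lemma continuous_phi : Continuous (φ : ℝ → ℝ) :=
  continuous_iff_continuousAt.2 fun x => (hasDerivAt_phi x).continuousAt

@[fun_prop]
lemma measurable_phi : Measurable (φ : ℝ → ℝ) := measurable_gaussianPDFReal 0 1

lemma continuous_phiDeriv : Continuous phiDeriv :=
  continuous_iff_continuousAt.2 fun x => (hasDerivAt_phiDeriv x).continuousAt

@[fun_prop]
lemma measurable_phiDeriv : Measurable phiDeriv := continuous_phiDeriv.measurable

lemma integral_gauss (F : ℝ → ℝ) : ∫ e, F e ∂γ = ∫ z, F z * φ z := by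
  rw [integral_gaussianReal_eq_integral_smul one_ne_zero]
  simp [mul_comm]

lemma integral_gauss_add (F : ℝ → ℝ) (v : ℝ) :
    ∫ e, F (v + e) ∂γ = ∫ z, F z * φ (z - v) := by
  rw [integral_gauss, ← integral_sub_right_eq_self (fun z => F (v + z) * φ z) v]
  simp

lemma integrable_gauss_iff (F : ℝ → ℝ) : Integrable F γ ↔ Integrable (fun z => F z * φ z) := by
  rw [gaussianReal_of_var_ne_zero 0 one_ne_zero,
    integrable_withDensity_iff_integrable_smul₀' (by fun_prop) (ae_of_all _ fun _ => gaussianPDF_lt_top)]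
  simp [gaussianPDF, ENNReal.toReal_ofReal, gaussianPDFReal_nonneg, mul_comm]

lemma integrable_pow_gauss (k : ℕ) : Integrable (fun x : ℝ => x ^ k) γ := by
  rcases Nat.eq_zero_or_pos k with rfl | hk
  · simp
  have h := (memLp_id_gaussianReal (μ := 0) (v := 1) (k : ℝ≥0)).integrable_norm_rpow
    (by exact_mod_cast hk.ne') (by simp)
  simp only [id, ENNReal.coe_toReal, NNReal.coe_natCast, Real.rpow_natCast] at h
  refine h.mono' (by fun_prop) (ae_of_all _ fun x => ?_)
  simp

lemma integral_sq_gauss : ∫ x, x ^ 2 ∂γ = 1 := by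
  have h := variance_fun_id_gaussianReal (μ := 0) (v := 1)
  rw [variance_eq_integral (by fun_prop)] at h
  simpa [integral_id_gaussianReal] using h

/-- The fourth moment of the standard normal distribution. -/
noncomputable def fourthMoment : ℝ := ∫ x, x ^ 4 ∂γ

lemma fourthMoment_nonneg : 0 ≤ fourthMoment := integral_nonneg fun x => by positivity

lemma integrable_pow_mul_phi_sub (k : ℕ) (v : ℝ) :
    Integrable (fun z => (z - v) ^ k * φ (z - v)) := by
  have := (integrable_gauss_iff _).1 (integrable_pow_gauss k)
  exact this.comp_sub_right v

lemma integrable_phi_sub (v : ℝ) : Integrable (fun z => φ (z - v)) := by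
  simpa using integrable_pow_mul_phi_sub 0 v

lemma integrable_phiDeriv_sub (v : ℝ) : Integrable (fun z => phiDeriv (z - v)) := by
  refine (integrable_pow_mul_phi_sub 1 v).neg.congr (ae_of_all _ fun z => ?_)
  simp [phiDeriv]
  ring

lemma integral_phi_sub (v : ℝ) : ∫ z, φ (z - v) = 1 := by
  rw [integral_sub_right_eq_self (fun z => φ z) v]
  exact integral_gaussianPDFReal_eq_one 0 one_ne_zero

lemma integral_sq_phi_sub (v : ℝ) : ∫ z, (z - v) ^ 2 * φ (z - v) = 1 := by
  rw [integral_sub_right_eq_self (fun z => z ^ 2 * φ z) v, ← integral_gauss, integral_sq_gauss]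

lemma integral_four_phi_sub (v : ℝ) : ∫ z, (z - v) ^ 4 * φ (z - v) = fourthMoment := by
  rw [integral_sub_right_eq_self (fun z => z ^ 4 * φ z) v, ← integral_gauss, fourthMoment]

lemma integral_abs_phiDeriv_sub_le (v : ℝ) : ∫ z, |phiDeriv (z - v)| ≤ 1 := by
  have h : ∀ z, |phiDeriv (z - v)| ≤ 1 / 2 * φ (z - v) + 1 / 2 * ((z - v) ^ 2 * φ (z - v)) := by
    intro z
    rw [phiDeriv, abs_mul, abs_neg, abs_of_nonneg (phi_nonneg _)]
    have : |z - v| ≤ 1 / 2 + 1 / 2 * (z - v) ^ 2 := by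
      rw [← sq_abs]; nlinarith [sq_nonneg (|z - v| - 1)]
    nlinarith [phi_nonneg (z - v)]
  calc ∫ z, |phiDeriv (z - v)|
      ≤ ∫ z, (1 / 2 * φ (z - v) + 1 / 2 * ((z - v) ^ 2 * φ (z - v))) :=
        integral_mono (integrable_phiDeriv_sub v).abs
          (((integrable_phi_sub v).const_mul _).add
            ((integrable_pow_mul_phi_sub 2 v).const_mul _)) h
    _ = 1 := by
        rw [integral_add ((integrable_phi_sub v).const_mul _)
            ((integrable_pow_mul_phi_sub 2 v).const_mul _), integral_const_mul,
          integral_const_mul, integral_phi_sub, integral_sq_phi_sub]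
        norm_num

/-! ### The logistic kernel -/

/-- The hyperbolic tangent, an antiderivative of twice the logistic kernel. -/
noncomputable def hypTan (x : ℝ) : ℝ :=
  (Real.exp x - Real.exp (-x)) / (Real.exp x + Real.exp (-x))

lemma exp_add_exp_neg_pos (x : ℝ) : 0 < Real.exp x + Real.exp (-x) := by positivity

lemma logisticKernel_pos (x : ℝ) : 0 < logisticKernel x := by
  unfold logisticKernel; positivity

/-- Since the derivative of `hypTan` is twice the kernel, this makes every derivative of the kernel
a polynomial in `hypTan` and the kernel itself. -/
lemma logisticKernel_eq (x : ℝ) : logisticKernel x = (1 - hypTan x ^ 2) / 2 := by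
  have h := exp_add_exp_neg_pos x
  have h1 : Real.exp x * Real.exp (-x) = 1 := by rw [← Real.exp_add]; simp
  unfold logisticKernel hypTan
  field_simp
  nlinarith

lemma logisticKernel_le_half (x : ℝ) : logisticKernel x ≤ 1 / 2 := by
  rw [logisticKernel_eq]; nlinarith [sq_nonneg (hypTan x)]

lemma hypTan_sq (x : ℝ) : hypTan x ^ 2 = 1 - 2 * logisticKernel x := by
  rw [logisticKernel_eq]; ring

lemma abs_hypTan_le_one (x : ℝ) : |hypTan x| ≤ 1 := by
  rw [← sq_le_one_iff_abs_le_one, hypTan_sq]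
  linarith [logisticKernel_pos x]

lemma hasDerivAt_hypTan (x : ℝ) : HasDerivAt hypTan (2 * logisticKernel x) x := by
  have h := exp_add_exp_neg_pos x
  have h1 : Real.exp x * Real.exp (-x) = 1 := by rw [← Real.exp_add]; simp
  have e1 := Real.hasDerivAt_exp x
  have e2 : HasDerivAt (fun x : ℝ => Real.exp (-x)) (-Real.exp (-x)) x := by
    simpa using (hasDerivAt_neg x).exp
  refine ((e1.sub e2).div (e1.add e2) h.ne').congr_deriv ?_
  simp only [logisticKernel, Pi.sub_apply, Pi.add_apply]
  field_simp
  nlinarith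

/-- The derivative of the logistic kernel. -/
noncomputable def logisticDeriv (x : ℝ) : ℝ := -2 * hypTan x * logisticKernel x

lemma hasDerivAt_logisticKernel (x : ℝ) : HasDerivAt logisticKernel (logisticDeriv x) x := by
  have : logisticKernel = fun x => (1 - hypTan x ^ 2) / 2 := funext logisticKernel_eq
  rw [this]
  refine ((((hasDerivAt_hypTan x).pow 2).const_sub 1).div_const 2).congr_deriv ?_
  simp [logisticDeriv]
  ring

lemma hasDerivAt_logisticDeriv (x : ℝ) :
    HasDerivAt logisticDeriv (4 * logisticKernel x - 12 * logisticKernel x ^ 2) x := by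
  refine (((hasDerivAt_hypTan x).const_mul (-2)).mul (hasDerivAt_logisticKernel x)).congr_deriv ?_
  have := hypTan_sq x
  simp only [logisticDeriv]
  linear_combination 4 * logisticKernel x * this

/-- This is the virtue of the logistic kernel: control of the derivative by the kernel itself bounds
the empirical score with no lower bound on the density. -/
lemma abs_logisticDeriv_le (x : ℝ) : |logisticDeriv x| ≤ 2 * logisticKernel x := by
  unfold logisticDeriv
  rw [abs_mul, abs_mul, abs_of_pos (logisticKernel_pos x)]
  have := abs_hypTan_le_one x
  norm_num
  nlinarith [logisticKernel_pos x]

lemma abs_logisticDeriv2_le (x : ℝ) :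
    |4 * logisticKernel x - 12 * logisticKernel x ^ 2| ≤ 2 := by
  have h1 := logisticKernel_pos x
  have h2 := logisticKernel_le_half x
  rw [abs_le]; constructor <;> nlinarith

lemma continuous_logisticKernel : Continuous logisticKernel :=
  continuous_iff_continuousAt.2 fun x => (hasDerivAt_logisticKernel x).continuousAt

lemma two_add_le_exp_add_exp (x : ℝ) : 2 + x ^ 2 / 2 ≤ Real.exp x + Real.exp (-x) := by
  wlog hx : 0 ≤ x generalizing x
  · have := this (-x) (by linarith)
    simpa [add_comm] using this
  have h1 := Real.quadratic_le_exp_of_nonneg hx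
  have h2 := Real.add_one_le_exp (-x)
  linarith

lemma logisticKernel_le_inv (x : ℝ) : logisticKernel x ≤ (1 + x ^ 2)⁻¹ := by
  have h := two_add_le_exp_add_exp x
  unfold logisticKernel
  rw [inv_eq_one_div, div_le_div_iff₀ (by positivity) (by positivity)]
  have : (2 + x ^ 2 / 2) ^ 2 ≤ (Real.exp x + Real.exp (-x)) ^ 2 := by gcongr
  nlinarith [sq_nonneg (x ^ 2)]

lemma integrable_logisticKernel : Integrable logisticKernel :=
  integrable_inv_one_add_sq.mono' continuous_logisticKernel.aestronglyMeasurable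
    (ae_of_all _ fun x => by
      rw [Real.norm_of_nonneg (logisticKernel_pos x).le]; exact logisticKernel_le_inv x)

lemma tendsto_hypTan_atTop : Tendsto hypTan atTop (𝓝 1) := by
  have h : ∀ x : ℝ, 0 ≤ x → |hypTan x - 1| ≤ 2 * Real.exp (-x) := by
    intro x hx
    have hp := exp_add_exp_neg_pos x
    have h1 : 1 ≤ Real.exp x := Real.one_le_exp hx
    have : hypTan x - 1 = -(2 * Real.exp (-x) / (Real.exp x + Real.exp (-x))) := by
      unfold hypTan; field_simp; ring
    rw [this, abs_neg, abs_of_pos (by positivity), div_le_iff₀ hp]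
    nlinarith [Real.exp_pos (-x)]
  rw [tendsto_iff_norm_sub_tendsto_zero]
  refine squeeze_zero' (Eventually.of_forall fun _ => norm_nonneg _)
    ((eventually_ge_atTop 0).mono fun x hx => h x hx) ?_
  simpa using (Real.tendsto_exp_neg_atTop_nhds_zero.const_mul 2)

lemma hypTan_neg (x : ℝ) : hypTan (-x) = -hypTan x := by
  unfold hypTan; rw [neg_neg, add_comm, ← neg_div]; ring

lemma tendsto_hypTan_atBot : Tendsto hypTan atBot (𝓝 (-1)) := by
  have : hypTan = fun x => -hypTan (-x) := by ext x; simp [hypTan_neg]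
  rw [this]
  exact (tendsto_hypTan_atTop.comp tendsto_neg_atBot_atTop).neg

lemma integral_logisticKernel : ∫ x, logisticKernel x = 1 := by
  have := integral_of_hasDerivAt_of_tendsto hasDerivAt_hypTan
    (integrable_logisticKernel.const_mul 2) tendsto_hypTan_atBot tendsto_hypTan_atTop
  rw [integral_const_mul] at this
  linarith

/-- The kernel decays like `exp (-2|x|)`. One factor `exp (-|x|)` supplies the small constant, and
the other is absorbed by the kernel at half the argument, which remains integrable. -/
lemma logisticKernel_tail {a x : ℝ} (hx : a < |x|) :
    logisticKernel x ≤ 4 * Real.exp (-a) * logisticKernel (x / 2) := by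
  have key : ∀ y : ℝ, a < y → 0 ≤ y →
      logisticKernel y ≤ 4 * Real.exp (-a) * logisticKernel (y / 2) := by
    intro y hy h0
    have h1 : Real.exp (-y) ≤ Real.exp (-a) := Real.exp_le_exp.2 (by linarith)
    have h2 : Real.exp (y / 2) * Real.exp (y / 2) = Real.exp y := by rw [← Real.exp_add]; ring_nf
    have h3 : Real.exp y * Real.exp (-y) = 1 := by rw [← Real.exp_add]; simp
    have h4 : Real.exp (-(y / 2)) ≤ Real.exp (y / 2) := Real.exp_le_exp.2 (by linarith)
    have p1 := Real.exp_pos y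
    have p2 := Real.exp_pos (-y)
    have p3 := Real.exp_pos (y / 2)
    have p4 := Real.exp_pos (-(y / 2))
    have b1 : logisticKernel y ≤ 2 * (Real.exp (-y) * Real.exp (-y)) := by
      unfold logisticKernel
      rw [div_le_iff₀ (by positivity)]
      have : Real.exp (-y) * Real.exp (-y) * (Real.exp y * Real.exp y) = 1 := by
        calc _ = (Real.exp y * Real.exp (-y)) * (Real.exp y * Real.exp (-y)) := by ring
          _ = 1 := by rw [h3]; ring
      nlinarith [mul_pos (mul_pos p2 p2) (mul_pos p1 p2), mul_pos (mul_pos p2 p2) (mul_pos p2 p2)]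
    have b2 : Real.exp (-y) / 2 ≤ logisticKernel (y / 2) := by
      unfold logisticKernel
      rw [le_div_iff₀ (by positivity)]
      have : (Real.exp (y / 2) + Real.exp (-(y / 2))) ^ 2 ≤ 4 * Real.exp y := by nlinarith
      nlinarith
    calc logisticKernel y ≤ 2 * (Real.exp (-y) * Real.exp (-y)) := b1
      _ ≤ 2 * (Real.exp (-a) * Real.exp (-y)) := by gcongr
      _ = 4 * Real.exp (-a) * (Real.exp (-y) / 2) := by ring
      _ ≤ _ := by gcongr
  have even : ∀ y, logisticKernel (-y) = logisticKernel y := by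
    intro y; unfold logisticKernel; rw [neg_neg, add_comm]
  rcases le_total 0 x with h | h
  · rw [abs_of_nonneg h] at hx; exact key x hx h
  · rw [abs_of_nonpos h] at hx
    have := key (-x) hx (by linarith)
    rwa [neg_div, even, even] at this

lemma logisticKernel_lower {x : ℝ} (hx : |x| ≤ 1) : 1 / 20 ≤ logisticKernel x := by
  unfold logisticKernel
  have h1 : ∀ y : ℝ, y ≤ 1 → Real.exp y ≤ 3 := fun y hy =>
    (Real.exp_le_exp.2 hy).trans (by linarith [Real.exp_one_lt_d9])
  have hx' := abs_le.1 hx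
  have e : Real.exp x * Real.exp (-x) = 1 := by rw [← Real.exp_add]; simp
  have a1 := h1 x hx'.2
  have a2 := h1 (-x) (by linarith)
  rw [div_le_div_iff₀ (by norm_num) (by positivity)]
  nlinarith [Real.exp_pos x, Real.exp_pos (-x)]

/-! ### The scaled kernel -/

/-- The derivative of the scaled logistic kernel. -/
noncomputable def scaledDeriv (σ x : ℝ) : ℝ := σ⁻¹ * (σ⁻¹ * logisticDeriv (x / σ))

lemma hasDerivAt_scaledKernel (σ x : ℝ) : HasDerivAt (scaledKernel σ) (scaledDeriv σ x) x := by
  have h : HasDerivAt (fun x : ℝ => x / σ) σ⁻¹ x := by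
    simpa [div_eq_mul_inv] using (hasDerivAt_id x).div_const σ
  refine (((hasDerivAt_logisticKernel (x / σ)).comp x h).const_mul σ⁻¹).congr_deriv ?_
  simp only [scaledDeriv]; ring

lemma hasDerivAt_scaledDeriv (σ x : ℝ) : HasDerivAt (scaledDeriv σ)
    (σ⁻¹ * (σ⁻¹ * ((4 * logisticKernel (x / σ) - 12 * logisticKernel (x / σ) ^ 2) * σ⁻¹))) x := by
  have h : HasDerivAt (fun x : ℝ => x / σ) σ⁻¹ x := by
    simpa [div_eq_mul_inv] using (hasDerivAt_id x).div_const σ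
  exact ((((hasDerivAt_logisticDeriv (x / σ)).comp x h).const_mul σ⁻¹).const_mul σ⁻¹)

lemma deriv_scaledKernel (σ : ℝ) : deriv (scaledKernel σ) = scaledDeriv σ :=
  funext fun x => (hasDerivAt_scaledKernel σ x).deriv

lemma continuous_scaledDeriv (σ : ℝ) : Continuous (scaledDeriv σ) :=
  continuous_iff_continuousAt.2 fun x => (hasDerivAt_scaledDeriv σ x).continuousAt

lemma scaledKernel_pos {σ : ℝ} (hσ : 0 < σ) (x : ℝ) : 0 < scaledKernel σ x :=
  mul_pos (inv_pos.2 hσ) (logisticKernel_pos _)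

lemma scaledKernel_le {σ : ℝ} (hσ : 0 < σ) (x : ℝ) : scaledKernel σ x ≤ σ⁻¹ := by
  have := logisticKernel_le_half (x / σ)
  have h := inv_pos.2 hσ
  unfold scaledKernel; nlinarith

lemma abs_scaledDeriv_le {σ : ℝ} (hσ : 0 < σ) (x : ℝ) : |scaledDeriv σ x| ≤ 2 * σ⁻¹ * scaledKernel σ x := by
  unfold scaledDeriv scaledKernel
  have h := inv_pos.2 hσ
  rw [abs_mul, abs_mul, abs_of_pos h]
  have := mul_le_mul_of_nonneg_left (abs_logisticDeriv_le (x / σ)) (mul_pos h h).le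
  linarith

lemma abs_scaledDeriv_le' {σ : ℝ} (hσ : 0 < σ) (x : ℝ) : |scaledDeriv σ x| ≤ σ⁻¹ ^ 2 := by
  have h := inv_pos.2 hσ
  refine (abs_scaledDeriv_le hσ x).trans ?_
  have := logisticKernel_le_half (x / σ)
  unfold scaledKernel; nlinarith [mul_pos h h]

lemma scaledKernel_lipschitz {σ : ℝ} (hσ : 0 < σ) (x y : ℝ) :
    |scaledKernel σ x - scaledKernel σ y| ≤ σ⁻¹ ^ 2 * |x - y| :=
  abs_sub_le_of_deriv_le (hasDerivAt_scaledKernel σ) (abs_scaledDeriv_le' hσ) x y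

lemma scaledDeriv_lipschitz {σ : ℝ} (hσ : 0 < σ) (x y : ℝ) :
    |scaledDeriv σ x - scaledDeriv σ y| ≤ 2 * σ⁻¹ ^ 3 * |x - y| := by
  refine abs_sub_le_of_deriv_le (hasDerivAt_scaledDeriv σ) (fun z => ?_) x y
  have h := inv_pos.2 hσ
  rw [abs_mul, abs_mul, abs_mul, abs_of_pos h]
  have := abs_logisticDeriv2_le (z / σ)
  calc σ⁻¹ * (σ⁻¹ * (|4 * logisticKernel (z / σ) - 12 * logisticKernel (z / σ) ^ 2| * σ⁻¹))
      ≤ σ⁻¹ * (σ⁻¹ * (2 * σ⁻¹)) := by gcongr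
    _ = _ := by ring

lemma integrable_scaledKernel {σ : ℝ} (hσ : 0 < σ) : Integrable (scaledKernel σ) :=
  (integrable_logisticKernel.comp_div hσ.ne').const_mul _

lemma integral_scaledKernel {σ : ℝ} (hσ : 0 < σ) : ∫ x, scaledKernel σ x = 1 := by
  unfold scaledKernel
  rw [integral_const_mul, Measure.integral_comp_div, integral_logisticKernel, abs_of_pos hσ]
  field_simp
  simp

/-- The dominating kernel lives at scale `2σ` but keeps the prefactor `σ⁻¹`, so its mass is `2` and
the constant `4` of `logisticKernel_tail` doubles. -/
lemma integral_scaledKernel_tail {σ : ℝ} (hσ : 0 < σ) (a : ℝ) :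
    ∫ x, {x : ℝ | a < |x|}.indicator (scaledKernel σ) x ≤ 8 * Real.exp (-(a / σ)) := by
  have hint : Integrable fun x => 4 * Real.exp (-(a / σ)) * (σ⁻¹ * logisticKernel (x / (2 * σ))) :=
    ((integrable_logisticKernel.comp_div (by positivity)).const_mul _).const_mul _
  calc ∫ x, {x : ℝ | a < |x|}.indicator (scaledKernel σ) x
      ≤ ∫ x, 4 * Real.exp (-(a / σ)) * (σ⁻¹ * logisticKernel (x / (2 * σ))) := by
        refine integral_mono ((integrable_scaledKernel hσ).indicator
          (measurableSet_lt measurable_const measurable_norm)) hint fun x => ?_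
        by_cases hx : a < |x|
        · rw [Set.indicator_of_mem (by exact hx)]
          have h1 : a / σ < |x / σ| := by
            rw [abs_div, abs_of_pos hσ]; gcongr
          have h2 := logisticKernel_tail h1
          have h3 : x / σ / 2 = x / (2 * σ) := by field_simp
          rw [h3] at h2
          unfold scaledKernel
          have := mul_le_mul_of_nonneg_left h2 (inv_pos.2 hσ).le
          linarith
        · rw [Set.indicator_of_notMem (by exact hx)]
          have := logisticKernel_pos (x / (2 * σ))
          positivity
    _ = 8 * Real.exp (-(a / σ)) := by
        rw [integral_const_mul, integral_const_mul, Measure.integral_comp_div,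
          integral_logisticKernel, abs_of_pos (by positivity)]
        field_simp
        ring

/-! ### Bias of the kernel estimate -/

/-- The convolution of the scaled logistic kernel with `ψ`. -/
noncomputable def smooth (σ : ℝ) (ψ : ℝ → ℝ) (x : ℝ) : ℝ := ∫ u, scaledKernel σ u * ψ (x - u)

lemma abs_phi_mul_le {R y : ℝ} (hR : 1 ≤ R) (hy : R - 1 ≤ |y|) :
    (1 + y ^ 2) * φ y ≤ 2 * Real.exp (-(R - 1) ^ 2 / 4) := by
  have h1 : y ^ 2 / 4 + 1 ≤ Real.exp (y ^ 2 / 4) := Real.add_one_le_exp _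
  have h2 := phi_le_half_exp y
  have h3 : Real.exp (-y ^ 2 / 2) * Real.exp (y ^ 2 / 4) = Real.exp (-y ^ 2 / 4) := by
    rw [← Real.exp_add]; ring_nf
  have h4 : Real.exp (-y ^ 2 / 4) ≤ Real.exp (-(R - 1) ^ 2 / 4) := by
    apply Real.exp_le_exp.2
    have : (R - 1) ^ 2 ≤ y ^ 2 := by rw [← sq_abs y]; gcongr
    linarith
  calc (1 + y ^ 2) * φ y ≤ (4 * Real.exp (y ^ 2 / 4)) * (1 / 2 * Real.exp (-y ^ 2 / 2)) := by
        refine mul_le_mul ?_ h2 (phi_nonneg y) (by positivity)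
        nlinarith [sq_nonneg y]
    _ = 2 * (Real.exp (-y ^ 2 / 2) * Real.exp (y ^ 2 / 4)) := by ring
    _ ≤ _ := by rw [h3]; linarith

/-- The main error is proportional to `φ x`, so that after averaging over the `ν_i` it becomes an
error relative to `f_Z`. For `|x| ≤ R` the mean value inequality gives this, as `φ` changes by a
bounded factor over the window; for `|x| > R` everything is absolutely tiny; shifts longer than `u₀`
are left to the tail of the kernel. -/
lemma abs_translate_sub_le {ψ ψ' : ℝ → ℝ} (hψ : ∀ x, HasDerivAt ψ (ψ' x) x)
    (hψ' : ∀ x, |ψ' x| ≤ (1 + x ^ 2) * φ x) (hb : ∀ x, |ψ x| ≤ 1) {u₀ R : ℝ} (hu₀ : 0 < u₀)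
    (hR : 1 ≤ R) (huR : u₀ * (R + 1) ≤ 1) (x u : ℝ) :
    |ψ (x - u) - ψ x| ≤ 3 * u₀ * (1 + (R + 1) ^ 2) * φ x + 2 * Real.exp (-(R - 1) ^ 2 / 4)
      + 2 * {u : ℝ | u₀ < |u|}.indicator 1 u := by
  by_cases hu : u₀ < |u|
  · rw [Set.indicator_of_mem (by exact hu)]
    have h1 := abs_sub (ψ (x - u)) (ψ x)
    have := hb x
    have := hb (x - u)
    have h2 : 0 ≤ 3 * u₀ * (1 + (R + 1) ^ 2) * φ x := by
      have := phi_nonneg x; positivity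
    have h3 := Real.exp_pos (-(R - 1) ^ 2 / 4)
    simp only [Pi.one_apply]
    linarith
  rw [Set.indicator_of_notMem (by exact hu)]
  push Not at hu
  have hu1 : u₀ ≤ 1 := by nlinarith
  obtain ⟨M, hM0, hM, hMle⟩ : ∃ M, 0 ≤ M ∧ (∀ y, |y - x| ≤ u₀ → |ψ' y| ≤ M) ∧ u₀ * M ≤
      3 * u₀ * (1 + (R + 1) ^ 2) * φ x + 2 * Real.exp (-(R - 1) ^ 2 / 4) := by
    have hp := phi_nonneg x
    have he := Real.exp_pos (-(R - 1) ^ 2 / 4)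
    by_cases hx : |x| ≤ R
    · refine ⟨3 * (1 + (R + 1) ^ 2) * φ x, by positivity, fun y hy => ?_, by nlinarith⟩
      refine (hψ' y).trans ?_
      have hy1 : |y| ≤ R + 1 := by
        have := abs_sub_abs_le_abs_sub y x
        linarith
      have hy2 : y ^ 2 ≤ (R + 1) ^ 2 := by rw [← sq_abs]; gcongr
      -- The condition `u₀ (R + 1) ≤ 1` enters here: over the window `φ` varies by a factor at most
      -- `e ≤ 3`.
      have hxy : (x ^ 2 - y ^ 2) / 2 ≤ 1 := by
        have : x ^ 2 - y ^ 2 ≤ |y - x| * |y + x| := by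
          rw [← abs_mul]
          have := neg_abs_le ((y - x) * (y + x))
          nlinarith
        have h5 : |y + x| ≤ 2 * (R + 1) := by
          have := abs_add_le y x
          linarith
        have : |y - x| * |y + x| ≤ u₀ * (2 * (R + 1)) := by gcongr
        linarith
      have hφ : φ y ≤ 3 * φ x := by
        rw [phi_eq, phi_eq]
        have : Real.exp (-y ^ 2 / 2) ≤ 3 * Real.exp (-x ^ 2 / 2) := by
          have h6 : Real.exp (-y ^ 2 / 2) = Real.exp ((x ^ 2 - y ^ 2) / 2) *
              Real.exp (-x ^ 2 / 2) := by rw [← Real.exp_add]; ring_nf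
          rw [h6]
          gcongr
          exact (Real.exp_le_exp.2 hxy).trans (by linarith [Real.exp_one_lt_d9])
        have h7 : 0 < (√(2 * Real.pi))⁻¹ := by positivity
        nlinarith
      calc (1 + y ^ 2) * φ y ≤ (1 + (R + 1) ^ 2) * (3 * φ x) := by
            gcongr
            exact phi_nonneg y
        _ = _ := by ring
    · push Not at hx
      refine ⟨2 * Real.exp (-(R - 1) ^ 2 / 4), by positivity, fun y hy => ?_, ?_⟩
      · refine (hψ' y).trans (abs_phi_mul_le hR ?_)
        have := abs_sub_abs_le_abs_sub x y
        rw [abs_sub_comm] at this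
        linarith
      · have : 0 ≤ 3 * u₀ * (1 + (R + 1) ^ 2) * φ x := by positivity
        nlinarith
  have key := Convex.norm_image_sub_le_of_norm_hasDerivWithin_le (f := ψ) (f' := ψ') (C := M)
    (s := Metric.closedBall x u₀) (x := x) (y := x - u)
    (fun y _ => (hψ y).hasDerivWithinAt)
    (fun y hy => hM y (by simpa [Real.dist_eq] using hy)) (convex_closedBall x u₀)
    (by simp [hu₀.le]) (by simpa [Real.dist_eq] using hu)
  rw [Real.norm_eq_abs, Real.norm_eq_abs] at key
  have : |x - u - x| ≤ u₀ := by simpa using hu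
  have : M * |x - u - x| ≤ M * u₀ := by gcongr
  linarith

lemma integrable_scaledKernel_mul {σ : ℝ} (hσ : 0 < σ) {ψ : ℝ → ℝ} (hc : Continuous ψ)
    {C : ℝ} (hb : ∀ x, |ψ x| ≤ C) (x : ℝ) :
    Integrable fun u => scaledKernel σ u * ψ (x - u) :=
  (integrable_scaledKernel hσ).mul_bdd (c := C)
    (hc.comp (continuous_const.sub continuous_id)).aestronglyMeasurable
    (ae_of_all _ fun _ => hb _)

lemma abs_smooth_sub_le {σ : ℝ} (hσ : 0 < σ) {ψ ψ' : ℝ → ℝ} (hψ : ∀ x, HasDerivAt ψ (ψ' x) x)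
    (hψ' : ∀ x, |ψ' x| ≤ (1 + x ^ 2) * φ x) (hb : ∀ x, |ψ x| ≤ 1) {u₀ R : ℝ} (hu₀ : 0 < u₀)
    (hR : 1 ≤ R) (huR : u₀ * (R + 1) ≤ 1) (x : ℝ) :
    |smooth σ ψ x - ψ x| ≤ 3 * u₀ * (1 + (R + 1) ^ 2) * φ x
      + (2 * Real.exp (-(R - 1) ^ 2 / 4) + 16 * Real.exp (-(u₀ / σ))) := by
  have hc : Continuous ψ := continuous_iff_continuousAt.2 fun x => (hψ x).continuousAt
  have i1 := integrable_scaledKernel_mul hσ hc hb x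
  have i0 := integrable_scaledKernel hσ
  set A := 3 * u₀ * (1 + (R + 1) ^ 2) * φ x + 2 * Real.exp (-(R - 1) ^ 2 / 4) with hA
  have i2 : Integrable fun u => {u : ℝ | u₀ < |u|}.indicator (scaledKernel σ) u :=
    i0.indicator (measurableSet_lt measurable_const measurable_norm)
  have e1 : smooth σ ψ x - ψ x = ∫ u, scaledKernel σ u * (ψ (x - u) - ψ x) := by
    have : ∫ u, scaledKernel σ u * ψ x = ψ x := by
      rw [integral_mul_const (ψ x) (scaledKernel σ), integral_scaledKernel hσ, one_mul]
    simp_rw [mul_sub]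
    rw [integral_sub i1 (i0.mul_const _), this, smooth]
  rw [e1]
  calc |∫ u, scaledKernel σ u * (ψ (x - u) - ψ x)|
      ≤ ∫ u, (scaledKernel σ u * A + 2 * {u : ℝ | u₀ < |u|}.indicator (scaledKernel σ) u) := by
        rw [← Real.norm_eq_abs]
        refine norm_integral_le_of_norm_le ((i0.mul_const A).add (i2.const_mul 2))
          (ae_of_all _ fun u => ?_)
        have := abs_translate_sub_le hψ hψ' hb hu₀ hR huR x u
        have hp := scaledKernel_pos hσ u
        rw [Real.norm_eq_abs, abs_mul, abs_of_pos hp]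
        calc _ ≤ scaledKernel σ u * (A + 2 * {u : ℝ | u₀ < |u|}.indicator 1 u) :=
              mul_le_mul_of_nonneg_left this hp.le
          _ = _ := by
            by_cases hu : u₀ < |u|
            · rw [Set.indicator_of_mem (by exact hu), Set.indicator_of_mem (by exact hu)]
              simp; ring
            · rw [Set.indicator_of_notMem (by exact hu), Set.indicator_of_notMem (by exact hu)]
              simp
    _ = A + 2 * ∫ u, {u : ℝ | u₀ < |u|}.indicator (scaledKernel σ) u := by
        rw [integral_add (i0.mul_const _) (i2.const_mul 2), integral_mul_const,
          integral_scaledKernel hσ, integral_const_mul, one_mul]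
    _ ≤ _ := by
        have := integral_scaledKernel_tail hσ u₀
        rw [hA]; linarith

lemma integral_scaledKernel_gauss (σ x : ℝ) :
    ∫ e, scaledKernel σ (x - e) ∂γ = smooth σ φ x := by
  rw [integral_gauss, ← integral_sub_left_eq_self _ _ x, smooth]
  simp

/-- Integration by parts moves the derivative from the kernel to `φ`, so the derivative estimate is
also a smoothing and the same bias bound applies with `ψ = phiDeriv`. -/
lemma integral_scaledDeriv_gauss {σ : ℝ} (hσ : 0 < σ) (x : ℝ) :
    ∫ e, scaledDeriv σ (x - e) ∂γ = smooth σ phiDeriv x := by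
  rw [integral_gauss, ← integral_sub_left_eq_self _ _ x, smooth]
  simp only [sub_sub_cancel]
  have hv : ∀ u, HasDerivAt (fun u => φ (x - u)) (-phiDeriv (x - u)) u := fun u =>
    ((hasDerivAt_phi (x - u)).comp u ((hasDerivAt_id u).const_sub x)).congr_deriv (by simp)
  have i1 := integrable_scaledKernel_mul hσ continuous_phiDeriv abs_phiDeriv_le x
  have i2 := integrable_scaledKernel_mul hσ continuous_phi
    (fun x => by rw [abs_of_nonneg (phi_nonneg x)]; exact phi_le_one x) x
  have i3 : Integrable (fun u => scaledDeriv σ u * φ (x - u)) := by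
    refine (i2.const_mul (2 * σ⁻¹)).mono' ?_ (ae_of_all _ fun u => ?_)
    · exact ((continuous_scaledDeriv σ).mul (continuous_phi.comp
        (continuous_const.sub continuous_id))).aestronglyMeasurable
    · rw [Real.norm_eq_abs, abs_mul, abs_of_nonneg (phi_nonneg _)]
      have := mul_le_mul_of_nonneg_right (abs_scaledDeriv_le hσ u) (phi_nonneg (x - u))
      linarith
  have := integral_mul_deriv_eq_deriv_mul_of_integrable (u := scaledKernel σ)
    (v := fun u => φ (x - u)) (u' := scaledDeriv σ) (v' := fun u => -phiDeriv (x - u))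
    (fun u _ => hasDerivAt_scaledKernel σ u) (fun u _ => hv u)
    (by simpa [Pi.mul_def] using i1.neg) i3 i2
  simp only [mul_neg, integral_neg] at this
  linarith

lemma tendsto_log_pow_mul_rpow (k : ℕ) {r : ℝ} (hr : 0 < r) :
    Tendsto (fun L : ℝ => Real.log L ^ k * L ^ (-r)) atTop (𝓝 0) := by
  have h := (isLittleO_log_rpow_rpow_atTop (k : ℝ) hr).tendsto_div_nhds_zero
  refine h.congr' ?_
  filter_upwards [eventually_gt_atTop 0] with x hx
  rw [Real.rpow_neg hx.le, Real.rpow_natCast, div_eq_mul_inv]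

/-- Take `u₀ = L^(-1/2)` and `R = log L` at bandwidth `1/L`. The relative error is of order
`L^(-1/2) log² L`, while the kernel tail `exp (-√L)` and the Gaussian tail `exp (-(log L - 1)²/4)`
are smaller than any power of `L`. -/
lemma eventually_abs_smooth_sub_le {ψ ψ' : ℝ → ℝ} (hψ : ∀ x, HasDerivAt ψ (ψ' x) x)
    (hψ' : ∀ x, |ψ' x| ≤ (1 + x ^ 2) * φ x) (hb : ∀ x, |ψ x| ≤ 1) (k : ℕ) :
    ∀ᶠ L : ℝ in atTop, ∀ x,
      |smooth (1 / L) ψ x - ψ x| ≤ L ^ (-(1 / 4) : ℝ) * φ x + (L ^ k)⁻¹ := by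
  have t2 := tendsto_log_pow_mul_rpow 2 (r := 1 / 4) (by norm_num)
  have t1 := tendsto_log_pow_mul_rpow 1 (r := 1 / 4) (by norm_num)
  have t0 := tendsto_log_pow_mul_rpow 0 (r := 1 / 4) (by norm_num)
  have tq := (t2.const_mul 3).add ((t1.const_mul 6).add (t0.const_mul 6))
  have te : Tendsto (fun L : ℝ => L ^ k * Real.exp (-√L)) atTop (𝓝 0) := by
    have := (Real.tendsto_pow_mul_exp_neg_atTop_nhds_zero (2 * k)).comp Real.tendsto_sqrt_atTop
    refine this.congr' ?_
    filter_upwards [eventually_ge_atTop 0] with x hx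
    simp [pow_mul, Real.sq_sqrt hx]
  filter_upwards [eventually_gt_atTop 1, (tendsto_order.1 tq).2 1 (by norm_num),
    (tendsto_order.1 te).2 (1 / 32) (by norm_num),
    -- With `log L ≥ 4k + 10` one has `(log L - 1)²/4 ≥ k log L + 2`; the spare `exp (-2) ≤ 1/4`
    -- absorbs the constants.
    Real.tendsto_log_atTop.eventually_ge_atTop (4 * k + 10)] with L hL hq he hlog x
  have hL0 : 0 < L := by linarith
  set y := Real.log L with hy
  have hk0 : (0 : ℝ) ≤ k := Nat.cast_nonneg k
  have hs : √L = L ^ (1 / 2 : ℝ) := Real.sqrt_eq_rpow L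
  have hu : (√L)⁻¹ = L ^ (-(1 / 4) : ℝ) * L ^ (-(1 / 4) : ℝ) := by
    rw [hs, ← Real.rpow_neg hL0.le, ← Real.rpow_add hL0]; norm_num
  have hr0 : 0 < L ^ (-(1 / 4) : ℝ) := by positivity
  set r := L ^ (-(1 / 4) : ℝ) with hr
  simp only [pow_zero, pow_one, one_mul] at hq
  have hr1 : r ≤ 1 := by
    apply Real.rpow_le_one_of_one_le_of_nonpos hL.le (by norm_num)
  have hmain : 3 * (√L)⁻¹ * (1 + (y + 1) ^ 2) ≤ r := by
    rw [hu]
    nlinarith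
  have huR : (√L)⁻¹ * (y + 1) ≤ 1 := by
    have h1 : 0 < (√L)⁻¹ := by positivity
    nlinarith
  refine (abs_smooth_sub_le (by positivity) hψ hψ' hb (u₀ := (√L)⁻¹) (R := y)
    (by positivity) (by linarith) huR x).trans ?_
  have hφ := phi_nonneg x
  have e1 : (√L)⁻¹ / (1 / L) = √L := by
    have := Real.mul_self_sqrt hL0.le
    have h2 : 0 < √L := by positivity
    field_simp
    nlinarith
  rw [e1]
  have hLk : 0 < L ^ k := by positivity
  have e2 : 16 * Real.exp (-√L) ≤ (L ^ k)⁻¹ / 2 := by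
    rw [← mul_le_mul_iff_right₀ hLk]
    field_simp
    linarith
  have e3 : 2 * Real.exp (-(y - 1) ^ 2 / 4) ≤ (L ^ k)⁻¹ / 2 := by
    have h1 : (L ^ k)⁻¹ = Real.exp (-(k * y)) := by
      rw [Real.exp_neg, hy, Real.exp_nat_mul, Real.exp_log hL0]
    have h2 : Real.exp (-(y - 1) ^ 2 / 4) ≤ Real.exp (-(k * y) + (-2)) := by
      apply Real.exp_le_exp.2; nlinarith
    have h3 : Real.exp (-2) ≤ 1 / 4 := by
      rw [Real.exp_neg, inv_eq_one_div]
      apply one_div_le_one_div_of_le (by norm_num)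
      have h5 : (2 : ℝ) ≤ Real.exp 1 := by linarith [Real.exp_one_gt_d9]
      have h4 : Real.exp 2 = Real.exp 1 * Real.exp 1 := by rw [← Real.exp_add]; norm_num
      nlinarith
    rw [h1]
    rw [Real.exp_add] at h2
    nlinarith [Real.exp_pos (-(k * y))]
  have := mul_le_mul_of_nonneg_right hmain hφ
  linarith

lemma eventually_abs_smooth_phi_sub_le (k : ℕ) : ∀ᶠ L : ℝ in atTop, ∀ x,
    |smooth (1 / L) φ x - φ x| ≤ L ^ (-(1 / 4) : ℝ) * φ x + (L ^ k)⁻¹ :=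
  eventually_abs_smooth_sub_le hasDerivAt_phi abs_phiDeriv_le'
    (fun x => by rw [abs_of_nonneg (phi_nonneg x)]; exact phi_le_one x) k

lemma eventually_abs_smooth_phiDeriv_sub_le (k : ℕ) : ∀ᶠ L : ℝ in atTop, ∀ x,
    |smooth (1 / L) phiDeriv x - phiDeriv x| ≤ L ^ (-(1 / 4) : ℝ) * φ x + (L ^ k)⁻¹ :=
  eventually_abs_smooth_sub_le hasDerivAt_phiDeriv abs_phiDeriv2_le' abs_phiDeriv_le k

/-! ### Weak dependence of the centred means -/

/-- The centred means as a function of the means and of the noise. -/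
def nuFun {n : ℕ} (t : (Fin n → ℝ) → Fin n → ℝ) (m x : Fin n → ℝ) : Fin n → ℝ :=
  fun i => m i - t (fun j => m j + x j) i

/-- The `i`-th estimate does not depend on the `i`-th observation and is Lipschitz in the `j`-th one
with a constant `ρ |i - j|`; the sums of these constants over `j` are at most `R`. -/
structure IsFilter {n : ℕ} (t : (Fin n → ℝ) → Fin n → ℝ) (ρ : ℕ → ℝ≥0) (R : ℝ) : Prop where
  measurable : Measurable t
  self : ∀ (i : Fin n) (y : Fin n → ℝ) (d : ℝ), t (Function.update y i (y i + d)) i = t y i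
  lipschitz : ∀ i j : Fin n, j ≠ i → ∀ (y : Fin n → ℝ) (d : ℝ),
    |t (Function.update y j (y j + d)) i - t y i| ≤ ρ ((i : ℤ) - (j : ℤ)).natAbs * |d|
  sum_le : ∀ i : Fin n, ∑ j : Fin n, (ρ ((i : ℤ) - (j : ℤ)).natAbs : ℝ) ≤ R

section

variable {n : ℕ} {t : (Fin n → ℝ) → Fin n → ℝ} {ρ : ℕ → ℝ≥0} {R : ℝ}

lemma add_update (m x : Fin n → ℝ) (i : Fin n) (e : ℝ) :
    (fun j => m j + Function.update x i e j) =
      Function.update (fun j => m j + x j) i ((fun j => m j + x j) i + (e - x i)) := by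
  ext j
  by_cases h : j = i
  · subst h; simp
  · simp [h]

lemma IsFilter.nuFun_update_self (h : IsFilter t ρ R) (m x : Fin n → ℝ) (i : Fin n) (e : ℝ) :
    nuFun t m (Function.update x i e) i = nuFun t m x i := by
  unfold nuFun
  rw [add_update, h.self]

lemma IsFilter.abs_nuFun_update_sub_le (h : IsFilter t ρ R) (m x : Fin n → ℝ) {i j : Fin n}
    (hij : i ≠ j) (e : ℝ) :
    |nuFun t m (Function.update x i e) j - nuFun t m x j|
      ≤ ρ ((j : ℤ) - (i : ℤ)).natAbs * |e - x i| := by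
  unfold nuFun
  rw [add_update]
  have := h.lipschitz j i hij (fun j => m j + x j) (e - x i)
  rw [sub_sub_sub_cancel_left, abs_sub_comm]
  exact this

/-- The Lipschitz constants sum to at most `R` also over the row index, since they depend on `|i -
j|` only. Averages over all indices thus move by `O(1/n)` when one noise variable changes. -/
lemma IsFilter.sum_abs_le (h : IsFilter t ρ R) (m x : Fin n → ℝ) (i : Fin n) (e : ℝ) :
    ∑ j, |nuFun t m (Function.update x i e) j - nuFun t m x j| ≤ R * |e - x i| := by
  calc _ ≤ ∑ j : Fin n, (ρ ((i : ℤ) - (j : ℤ)).natAbs : ℝ) * |e - x i| := by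
        refine Finset.sum_le_sum fun j _ => ?_
        by_cases hij : i = j
        · subst hij
          rw [h.nuFun_update_self]
          simp only [sub_self, abs_zero]
          positivity
        · have := h.abs_nuFun_update_sub_le m x hij e
          rwa [← Int.natAbs_neg, neg_sub] at this
    _ ≤ _ := by
        rw [← Finset.sum_mul]
        exact mul_le_mul_of_nonneg_right (h.sum_le i) (abs_nonneg _)

lemma IsFilter.nonneg (h : IsFilter t ρ R) (i : Fin n) : 0 ≤ R :=
  (Finset.sum_nonneg fun _ _ => NNReal.coe_nonneg _).trans (h.sum_le i)

lemma measurable_nuFun (ht : Measurable t) :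
    Measurable fun p : (Fin n → ℝ) × (Fin n → ℝ) => nuFun t p.1 p.2 := by
  unfold nuFun
  refine measurable_pi_lambda _ fun i => ?_
  have : Measurable fun p : (Fin n → ℝ) × (Fin n → ℝ) => t (fun j => p.1 j + p.2 j) :=
    ht.comp (by fun_prop)
  fun_prop

/-- Checked on rectangles: the preimage of a rectangle is the rectangle with its `i`-th side freed,
times that side for the fresh coordinate. -/
lemma map_update_pi (i : Fin n) :
    ((Measure.pi fun _ : Fin n => γ).prod γ).map (fun p => Function.update p.1 i p.2)
      = Measure.pi fun _ => γ := by
  symm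
  refine Measure.pi_eq fun s hs => ?_
  have hm : Measurable fun p : (Fin n → ℝ) × ℝ => Function.update p.1 i p.2 := by
    refine measurable_pi_lambda _ fun j => ?_
    by_cases h : j = i
    · subst h; simpa using measurable_snd
    · simp only [Function.update_of_ne h]; fun_prop
  rw [Measure.map_apply hm (MeasurableSet.univ_pi hs)]
  have : (fun p : (Fin n → ℝ) × ℝ => Function.update p.1 i p.2) ⁻¹' (Set.pi Set.univ s)
      = (Set.pi Set.univ (Function.update s i Set.univ)) ×ˢ s i := by
    ext p
    simp only [Set.mem_preimage, Set.mem_pi, Set.mem_univ, true_implies, Set.mem_prod]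
    constructor
    · refine fun h => ⟨fun j => ?_, by simpa using h i⟩
      by_cases hj : j = i
      · subst hj; simp
      · simpa [hj] using h j
    · rintro ⟨h, h'⟩ j
      by_cases hj : j = i
      · subst hj; simpa using h'
      · simpa [hj] using h j
  rw [this, Measure.prod_prod, Measure.pi_pi,
    ← Finset.mul_prod_erase Finset.univ (fun j => γ (s j)) (Finset.mem_univ i),
    ← Finset.mul_prod_erase Finset.univ _ (Finset.mem_univ i)]
  simp only [Function.update_self, measure_univ, one_mul]
  rw [mul_comm]
  congr 1
  refine Finset.prod_congr rfl fun j hj => ?_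
  rw [Function.update_of_ne (Finset.ne_of_mem_erase hj)]

end

/-! ### Replacing one noise variable by an independent copy. -/

section

variable {n : ℕ} {Ω : Type*} [MeasurableSpace Ω] {P : Measure Ω} [IsProbabilityMeasure P]
  {μ ε : Ω → Fin n → ℝ}

set_option linter.unusedSectionVars false

@[fun_prop]
lemma measurable_update_prod (i : Fin n) :
    Measurable fun p : (Fin n → ℝ) × ℝ => Function.update p.1 i p.2 := by
  refine measurable_pi_lambda _ fun j => ?_
  by_cases h : j = i
  · subst h; simpa using measurable_snd
  · simp only [Function.update_of_ne h]; fun_prop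

lemma IsModel.map_eq (h : IsModel P μ ε) :
    P.map (fun ω => (μ ω, ε ω)) = (P.map μ).prod (Measure.pi fun _ => γ) := by
  rw [(indepFun_iff_map_prod_eq_prod_map_map h.measurable_mu.aemeasurable
    h.measurable_eps.aemeasurable).1 h.indep_mu]
  congr 1
  have := (iIndepFun_iff_map_fun_eq_pi_map
    (fun i => ((measurable_pi_apply i).comp h.measurable_eps).aemeasurable)).1 h.indep
  refine (show P.map ε = _ from this).trans ?_
  congr 1
  ext1 i
  exact h.gaussian i

/-- The basic device of the proof: `ε_i` may be exchanged for a variable independent of everything,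
after which `ν` (still computed from the old noise) is independent of it. -/
lemma IsModel.map_update (h : IsModel P μ ε) (i : Fin n) :
    (P.prod γ).map (fun p => (μ p.1, Function.update (ε p.1) i p.2))
      = P.map (fun ω => (μ ω, ε ω)) := by
  have hμ := h.measurable_mu
  have hε := h.measurable_eps
  have : IsProbabilityMeasure (P.map μ) := Measure.isProbabilityMeasure_map hμ.aemeasurable
  have e1 : (P.prod γ).map (Prod.map (fun ω => (μ ω, ε ω)) id)
      = ((P.map μ).prod (Measure.pi fun _ => γ)).prod γ := by
    rw [← Measure.map_prod_map _ _ (by fun_prop) measurable_id, h.map_eq, Measure.map_id]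
  have mp := (MeasurePreserving.id (P.map μ)).prod
    (⟨measurable_update_prod i, map_update_pi i⟩ :
      MeasurePreserving (fun p : (Fin n → ℝ) × ℝ => Function.update p.1 i p.2)
        ((Measure.pi fun _ => γ).prod γ) (Measure.pi fun _ => γ))
  have e2 := (mp.comp (measurePreserving_prodAssoc (P.map μ) (Measure.pi fun _ => γ) γ)).map_eq
  rw [← e1, Measure.map_map (mp.measurable.comp (MeasurableEquiv.measurable _)) (by fun_prop)] at e2
  rw [h.map_eq, ← e2]
  rfl

lemma IsModel.integrable_resample_iff (h : IsModel P μ ε) (i : Fin n)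
    {F : (Fin n → ℝ) × (Fin n → ℝ) → ℝ} (hF : Measurable F) :
    Integrable (fun p : Ω × ℝ => F (μ p.1, Function.update (ε p.1) i p.2)) (P.prod γ)
      ↔ Integrable (fun ω => F (μ ω, ε ω)) P := by
  have hμ := h.measurable_mu
  have hε := h.measurable_eps
  have h1 : Measurable fun p : Ω × ℝ => (μ p.1, Function.update (ε p.1) i p.2) :=
    (hμ.comp measurable_fst).prodMk
      ((measurable_update_prod i).comp ((hε.comp measurable_fst).prodMk measurable_snd))
  rw [← Function.comp_def F, ← Function.comp_def F,
    ← integrable_map_measure hF.aestronglyMeasurable h1.aemeasurable, h.map_update,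
    integrable_map_measure hF.aestronglyMeasurable (hμ.prodMk hε).aemeasurable]

lemma IsModel.integral_resample (h : IsModel P μ ε) (i : Fin n)
    {F : (Fin n → ℝ) × (Fin n → ℝ) → ℝ} (hF : Measurable F) :
    ∫ ω, F (μ ω, ε ω) ∂P
      = ∫ p : Ω × ℝ, F (μ p.1, Function.update (ε p.1) i p.2) ∂(P.prod γ) := by
  have hμ := h.measurable_mu
  have hε := h.measurable_eps
  have h1 : Measurable fun p : Ω × ℝ => (μ p.1, Function.update (ε p.1) i p.2) :=
    (hμ.comp measurable_fst).prodMk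
      ((measurable_update_prod i).comp ((hε.comp measurable_fst).prodMk measurable_snd))
  rw [← integral_map (hμ.prodMk hε).aemeasurable
    hF.aestronglyMeasurable, ← h.map_update i, integral_map h1.aemeasurable
    hF.aestronglyMeasurable]

lemma IsModel.measurable_eps_apply (h : IsModel P μ ε) (i : Fin n) : Measurable fun ω => ε ω i :=
  (measurable_pi_apply i).comp h.measurable_eps

lemma IsModel.integral_eps (h : IsModel P μ ε) (i : Fin n) {F : ℝ → ℝ} (hF : Measurable F) :
    ∫ ω, F (ε ω i) ∂P = ∫ e, F e ∂γ := by
  rw [← h.gaussian i, integral_map (h.measurable_eps_apply i).aemeasurable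
    hF.aestronglyMeasurable]

lemma IsModel.integrable_eps_pow (h : IsModel P μ ε) (i : Fin n) (k : ℕ) :
    Integrable (fun ω => ε ω i ^ k) P := by
  have := integrable_pow_gauss k
  rw [← h.gaussian i] at this
  exact this.comp_measurable (h.measurable_eps_apply i)

lemma IsModel.integral_eps_sq (h : IsModel P μ ε) (i : Fin n) : ∫ ω, ε ω i ^ 2 ∂P = 1 := by
  rw [h.integral_eps i (F := fun x => x ^ 2) (by fun_prop), integral_sq_gauss]

lemma IsModel.integral_eps_four (h : IsModel P μ ε) (i : Fin n) :
    ∫ ω, ε ω i ^ 4 ∂P = fourthMoment := by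
  rw [h.integral_eps i (F := fun x => x ^ 4) (by fun_prop), fourthMoment]

lemma IsModel.integrable_dominant (h : IsModel P μ ε) (i j : Fin n) :
    Integrable (fun p : Ω × ℝ => 1 + ε p.1 i ^ 4 + ε p.1 j ^ 4 + p.2 ^ 4) (P.prod γ) :=
  (((integrable_const 1).add ((h.integrable_eps_pow i 4).comp_fst γ)).add
    ((h.integrable_eps_pow j 4).comp_fst γ)).add ((integrable_pow_gauss 4).comp_snd P)

lemma IsModel.integral_dominant (h : IsModel P μ ε) (i j : Fin n) :
    ∫ p : Ω × ℝ, (1 + ε p.1 i ^ 4 + ε p.1 j ^ 4 + p.2 ^ 4) ∂(P.prod γ)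
      = 1 + 3 * fourthMoment := by
  have i1 := (h.integrable_eps_pow i 4).comp_fst γ
  have i2 := (h.integrable_eps_pow j 4).comp_fst γ
  have i3 := (integrable_pow_gauss 4).comp_snd P
  have i4 : Integrable (fun p : Ω × ℝ => 1 + ε p.1 i ^ 4) (P.prod γ) :=
    (integrable_const 1).add i1
  have i5 : Integrable (fun p : Ω × ℝ => 1 + ε p.1 i ^ 4 + ε p.1 j ^ 4) (P.prod γ) := i4.add i2
  rw [integral_add i5 i3, integral_add i4 i2, integral_add (integrable_const 1) i1,
    integral_fun_fst (fun ω => ε ω i ^ 4), integral_fun_fst (fun ω => ε ω j ^ 4),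
    integral_fun_snd (fun x : ℝ => x ^ 4), h.integral_eps_four, h.integral_eps_four]
  simp [fourthMoment]
  ring

lemma pow_three_le (a : ℝ) : (1 + a) ^ 3 ≤ 4 * (2 + a ^ 4) := by
  nlinarith [sq_nonneg (a ^ 2 - a), sq_nonneg (a - 1), sq_nonneg (a ^ 2 - 1)]

/-- Resampling produces products of three linear factors in the noise; reducing them to separate
fourth powers avoids any joint moments. -/
lemma triple_le (a b c : ℝ) (ha : 0 ≤ a) (hb : 0 ≤ b) (hc : 0 ≤ c) :
    (1 + a) * (1 + b) * (a + c) ≤ 48 * (1 + c ^ 4 + b ^ 4 + a ^ 4) := by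
  have amgm : ∀ x y z : ℝ, 0 ≤ x → 0 ≤ y → 0 ≤ z → x * y * z ≤ x ^ 3 + y ^ 3 + z ^ 3 := by
    intro x y z hx hy hz
    nlinarith [mul_nonneg (add_nonneg (add_nonneg hx hy) hz)
      (add_nonneg (add_nonneg (sq_nonneg (x - y)) (sq_nonneg (y - z))) (sq_nonneg (x - z))),
      mul_nonneg (mul_nonneg hx hy) hz]
  have h1 : (1 + a) * (1 + b) * (a + c) ≤ (1 + a) * (1 + b) * (1 + a) + (1 + a) * (1 + b) * (1 + c) := by
    have : 0 ≤ (1 + a) * (1 + b) := by positivity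
    nlinarith
  have h2 := amgm (1 + a) (1 + b) (1 + a) (by positivity) (by positivity) (by positivity)
  have h3 := amgm (1 + a) (1 + b) (1 + c) (by positivity) (by positivity) (by positivity)
  have ka := pow_three_le a
  have kb := pow_three_le b
  have kc := pow_three_le c
  have : 0 ≤ a ^ 4 := by positivity
  have : 0 ≤ b ^ 4 := by positivity
  have : 0 ≤ c ^ 4 := by positivity
  linarith

end

/-! ### The variance of sums of functions of the noise and of the centred means -/

section

variable {n : ℕ} {Ω : Type*} [MeasurableSpace Ω] {P : Measure Ω} [IsProbabilityMeasure P]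
  {μ ε : Ω → Fin n → ℝ} {t : (Fin n → ℝ) → Fin n → ℝ} {ρ : ℕ → ℝ≥0} {R : ℝ}

/-- The constant in the bound for the covariances. -/
noncomputable def covConst : ℝ := 48 * (1 + 3 * fourthMoment)

lemma covConst_nonneg : 0 ≤ covConst := by
  have := fourthMoment_nonneg
  unfold covConst; positivity

lemma measurable_nuFun_apply (ht : Measurable t) (i : Fin n) :
    Measurable fun p : (Fin n → ℝ) × (Fin n → ℝ) => nuFun t p.1 p.2 i :=
  (measurable_pi_apply i).comp (measurable_nuFun ht)

lemma one_add_abs_mul_le (a b : ℝ) : (1 + |a|) * (1 + |b|) ≤ 2 + a ^ 2 + b ^ 2 := by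
  rw [← sq_abs a, ← sq_abs b]
  nlinarith [sq_nonneg (|a| - |b|), sq_nonneg (|a| - 1), sq_nonneg (|b| - 1)]

/-- Resample `ε_i`. If `ν_j` did not react, the fresh variable would occur only in the first factor
and the integral would vanish by centring. The reaction of `ν_j` is at most its Lipschitz constant
times the change of `ε_i`. -/
lemma IsModel.abs_integral_mul_le (h : IsModel P μ ε) (ht : IsFilter t ρ R) {G : ℝ → ℝ → ℝ}
    (hG : Measurable (Function.uncurry G)) {B Λ : ℝ} (hB : 0 ≤ B) (hΛ : 0 ≤ Λ)
    (hGB : ∀ e v, |G e v| ≤ B * (1 + |e|))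
    (hGΛ : ∀ e v v', |G e v - G e v'| ≤ Λ * (1 + |e|) * |v - v'|)
    (h0 : ∀ v, ∫ e, G e v ∂γ = 0) {i j : Fin n} (hij : i ≠ j) :
    |∫ ω, G (ε ω i) (nuFun t (μ ω) (ε ω) i) * G (ε ω j) (nuFun t (μ ω) (ε ω) j) ∂P|
      ≤ B * Λ * covConst * ρ ((j : ℤ) - (i : ℤ)).natAbs := by
  have hμ := h.measurable_mu
  have hε := h.measurable_eps
  have hi := measurable_nuFun_apply ht.measurable i
  have hj := measurable_nuFun_apply ht.measurable j
  set H : (Fin n → ℝ) × (Fin n → ℝ) → ℝ := fun p =>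
    G (p.2 i) (nuFun t p.1 p.2 i) * G (p.2 j) (nuFun t p.1 p.2 j) with hH
  have hHm : Measurable H := by
    refine (hG.comp (f := fun p : (Fin n → ℝ) × (Fin n → ℝ) => (p.2 i, nuFun t p.1 p.2 i))
      (by fun_prop)).mul (hG.comp
      (f := fun p : (Fin n → ℝ) × (Fin n → ℝ) => (p.2 j, nuFun t p.1 p.2 j)) (by fun_prop))
  rw [show (∫ ω, G (ε ω i) (nuFun t (μ ω) (ε ω) i) * G (ε ω j) (nuFun t (μ ω) (ε ω) j) ∂P)
    = ∫ ω, H (μ ω, ε ω) ∂P from rfl, h.integral_resample i hHm]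
  set X : Ω × ℝ → (Fin n → ℝ) × (Fin n → ℝ) :=
    fun p => (μ p.1, Function.update (ε p.1) i p.2)
  have hX : Measurable X := (hμ.comp measurable_fst).prodMk
      ((measurable_update_prod i).comp ((hε.comp measurable_fst).prodMk measurable_snd))
  -- the main term, which vanishes
  set M : Ω × ℝ → ℝ := fun p => G p.2 (nuFun t (μ p.1) (ε p.1) i)
    * G (ε p.1 j) (nuFun t (μ p.1) (ε p.1) j)
  have hMm : Measurable M := by
    have h1 : Measurable fun p : Ω × ℝ => nuFun t (μ p.1) (ε p.1) i :=
      hi.comp (by fun_prop : Measurable fun p : Ω × ℝ => (μ p.1, ε p.1))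
    have h2 : Measurable fun p : Ω × ℝ => nuFun t (μ p.1) (ε p.1) j :=
      hj.comp (by fun_prop : Measurable fun p : Ω × ℝ => (μ p.1, ε p.1))
    exact (hG.comp (measurable_snd.prodMk h1)).mul (hG.comp (Measurable.prodMk (by fun_prop) h2))
  have hMi : Integrable M (P.prod γ) := by
    refine (((integrable_const (2 : ℝ)).add ((h.integrable_eps_pow j 2).comp_fst γ)).add
      ((integrable_pow_gauss 2).comp_snd P)).const_mul (B * B) |>.mono'
      hMm.aestronglyMeasurable (ae_of_all _ fun p => ?_)
    rw [Real.norm_eq_abs, abs_mul]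
    calc _ ≤ (B * (1 + |p.2|)) * (B * (1 + |ε p.1 j|)) :=
          mul_le_mul (hGB _ _) (hGB _ _) (abs_nonneg _) (by positivity)
      _ = B * B * ((1 + |p.2|) * (1 + |ε p.1 j|)) := by ring
      _ ≤ B * B * (2 + p.2 ^ 2 + ε p.1 j ^ 2) := by gcongr; exact one_add_abs_mul_le _ _
      _ = _ := by simp only [Pi.add_apply]; ring
  have hM0 : ∫ p, M p ∂(P.prod γ) = 0 := by
    rw [integral_prod _ hMi]
    have : ∀ ω, ∫ e, M (ω, e) ∂γ = 0 := fun ω => by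
      simp only [M]
      rw [integral_mul_const, h0, zero_mul]
    simp [this]
  set c : ℝ := (ρ ((j : ℤ) - (i : ℤ)).natAbs : ℝ) with hc
  have hc0 : 0 ≤ c := NNReal.coe_nonneg _
  -- Resampling leaves `ν_i` alone, so the two products differ only through `ν_j` in the second
  -- factor.
  have hdiff : ∀ p, |H (X p) - M p|
      ≤ B * Λ * c * (48 * (1 + ε p.1 i ^ 4 + ε p.1 j ^ 4 + p.2 ^ 4)) := by
    intro p
    have e1 : H (X p) - M p = G p.2 (nuFun t (μ p.1) (ε p.1) i) *
        (G (ε p.1 j) (nuFun t (μ p.1) (Function.update (ε p.1) i p.2) j)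
          - G (ε p.1 j) (nuFun t (μ p.1) (ε p.1) j)) := by
      simp only [H, X, M]
      rw [ht.nuFun_update_self, Function.update_self, Function.update_of_ne hij.symm]
      ring
    rw [e1, abs_mul]
    have h2 : |p.2 - ε p.1 i| ≤ |p.2| + |ε p.1 i| := abs_sub _ _
    calc _ ≤ (B * (1 + |p.2|)) * (Λ * (1 + |ε p.1 j|) * (c * |p.2 - ε p.1 i|)) := by
          refine mul_le_mul (hGB _ _) ((hGΛ _ _ _).trans ?_) (abs_nonneg _) (by positivity)
          gcongr
          exact ht.abs_nuFun_update_sub_le _ _ hij _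
      _ ≤ (B * (1 + |p.2|)) * (Λ * (1 + |ε p.1 j|) * (c * (|p.2| + |ε p.1 i|))) := by gcongr
      _ = B * Λ * c * ((1 + |p.2|) * (1 + |ε p.1 j|) * (|p.2| + |ε p.1 i|)) := by ring
      _ ≤ B * Λ * c * (48 * (1 + |ε p.1 i| ^ 4 + |ε p.1 j| ^ 4 + |p.2| ^ 4)) := by
          exact mul_le_mul_of_nonneg_left
            (triple_le _ _ _ (abs_nonneg _) (abs_nonneg _) (abs_nonneg _)) (by positivity)
      _ = _ := by simp only [Even.pow_abs (by decide : Even 4)]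
  have hdom := ((h.integrable_dominant i j).const_mul 48).const_mul (B * Λ * c)
  have hDi : Integrable (fun p => H (X p) - M p) (P.prod γ) :=
    hdom.mono' ((hHm.comp hX).sub hMm).aestronglyMeasurable (ae_of_all _ hdiff)
  have e2 : ∫ p, H (X p) ∂(P.prod γ) = ∫ p, (H (X p) - M p) ∂(P.prod γ) := by
    have h1 := integral_add hDi hMi
    simp only [sub_add_cancel] at h1
    rw [h1, hM0, add_zero]
  rw [e2, ← Real.norm_eq_abs]
  refine (norm_integral_le_of_norm_le hdom (ae_of_all _ hdiff)).trans_eq ?_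
  rw [integral_const_mul, integral_const_mul, h.integral_dominant, covConst]
  ring

lemma IsModel.integrable_mul_apply (h : IsModel P μ ε) (ht : IsFilter t ρ R) {G : ℝ → ℝ → ℝ}
    (hG : Measurable (Function.uncurry G)) {B : ℝ} (hB : 0 ≤ B)
    (hGB : ∀ e v, |G e v| ≤ B * (1 + |e|)) (i j : Fin n) :
    Integrable (fun ω => G (ε ω i) (nuFun t (μ ω) (ε ω) i) * G (ε ω j) (nuFun t (μ ω) (ε ω) j)) P
      := by
  have hμ := h.measurable_mu
  have hε := h.measurable_eps
  have hi := (measurable_nuFun_apply ht.measurable i).comp (hμ.prodMk hε)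
  have hj := (measurable_nuFun_apply ht.measurable j).comp (hμ.prodMk hε)
  refine ((((integrable_const (2 : ℝ)).add (h.integrable_eps_pow i 2)).add
    (h.integrable_eps_pow j 2)).const_mul (B * B)).mono' ?_ (ae_of_all _ fun ω => ?_)
  · exact ((hG.comp ((h.measurable_eps_apply i).prodMk hi)).mul
      (hG.comp ((h.measurable_eps_apply j).prodMk hj))).aestronglyMeasurable
  · rw [Real.norm_eq_abs, abs_mul]
    calc _ ≤ (B * (1 + |ε ω i|)) * (B * (1 + |ε ω j|)) :=
          mul_le_mul (hGB _ _) (hGB _ _) (abs_nonneg _) (by positivity)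
      _ = B * B * ((1 + |ε ω i|) * (1 + |ε ω j|)) := by ring
      _ ≤ B * B * (2 + ε ω i ^ 2 + ε ω j ^ 2) := by gcongr; exact one_add_abs_mul_le _ _

lemma IsModel.integrable_sq_sum (h : IsModel P μ ε) (ht : IsFilter t ρ R) {G : ℝ → ℝ → ℝ}
    (hG : Measurable (Function.uncurry G)) {B : ℝ} (hB : 0 ≤ B)
    (hGB : ∀ e v, |G e v| ≤ B * (1 + |e|)) (I : Finset (Fin n)) :
    Integrable (fun ω => (∑ i ∈ I, G (ε ω i) (nuFun t (μ ω) (ε ω) i)) ^ 2) P := by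
  simp_rw [sq, Finset.sum_mul_sum]
  exact integrable_finsetSum _ fun i _ => integrable_finsetSum _ fun j _ =>
    h.integrable_mul_apply ht hG hB hGB i j

/-- Each diagonal term is at most `4 B²`, and the covariances in one row sum to at most a multiple
of `R`. So the second moment is linear in `n`, as for independent terms. -/
theorem IsModel.integral_sq_sum_le (h : IsModel P μ ε) (ht : IsFilter t ρ R) {G : ℝ → ℝ → ℝ}
    (hG : Measurable (Function.uncurry G)) {B Λ : ℝ} (hB : 0 ≤ B) (hΛ : 0 ≤ Λ)
    (hGB : ∀ e v, |G e v| ≤ B * (1 + |e|))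
    (hGΛ : ∀ e v v', |G e v - G e v'| ≤ Λ * (1 + |e|) * |v - v'|)
    (h0 : ∀ v, ∫ e, G e v ∂γ = 0) (I : Finset (Fin n)) :
    ∫ ω, (∑ i ∈ I, G (ε ω i) (nuFun t (μ ω) (ε ω) i)) ^ 2 ∂P
      ≤ n * (4 * B ^ 2 + B * Λ * covConst * R) := by
  have hint := h.integrable_mul_apply ht hG hB hGB
  have hC := covConst_nonneg
  have key : ∀ i j, ∫ ω, G (ε ω i) (nuFun t (μ ω) (ε ω) i) * G (ε ω j) (nuFun t (μ ω) (ε ω) j) ∂P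
      ≤ (if i = j then 4 * B ^ 2 else 0)
        + B * Λ * covConst * ρ ((i : ℤ) - (j : ℤ)).natAbs := by
    intro i j
    have hr : (0 : ℝ) ≤ ρ ((i : ℤ) - (j : ℤ)).natAbs := NNReal.coe_nonneg _
    by_cases hij : i = j
    · subst hij
      rw [if_pos rfl]
      have h1 : ∫ ω, G (ε ω i) (nuFun t (μ ω) (ε ω) i) * G (ε ω i) (nuFun t (μ ω) (ε ω) i) ∂P
          ≤ ∫ ω, B ^ 2 * (2 + 2 * ε ω i ^ 2) ∂P := by
        refine integral_mono (hint i i) (((integrable_const (2 : ℝ)).add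
          ((h.integrable_eps_pow i 2).const_mul 2)).const_mul _) fun ω => ?_
        have h2 := hGB (ε ω i) (nuFun t (μ ω) (ε ω) i)
        have h3 := one_add_abs_mul_le (ε ω i) (ε ω i)
        show G (ε ω i) (nuFun t (μ ω) (ε ω) i) * G (ε ω i) (nuFun t (μ ω) (ε ω) i)
          ≤ B ^ 2 * (2 + 2 * ε ω i ^ 2)
        rw [← abs_mul_abs_self]
        calc _ ≤ (B * (1 + |ε ω i|)) * (B * (1 + |ε ω i|)) := by gcongr
          _ = B ^ 2 * ((1 + |ε ω i|) * (1 + |ε ω i|)) := by ring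
          _ ≤ _ := by gcongr; linarith
      rw [integral_const_mul, integral_add (integrable_const _)
        ((h.integrable_eps_pow i 2).const_mul 2), integral_const_mul, h.integral_eps_sq] at h1
      simp only [integral_const, probReal_univ, one_smul] at h1
      have : 0 ≤ B * Λ * covConst * ρ ((i : ℤ) - (i : ℤ)).natAbs := by positivity
      linarith
    · rw [if_neg hij, zero_add]
      have h1 := h.abs_integral_mul_le ht hG hB hΛ hGB hGΛ h0 hij
      rw [← Int.natAbs_neg, neg_sub] at h1
      exact (le_abs_self _).trans h1
  simp_rw [sq (∑ i ∈ I, _), Finset.sum_mul_sum]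
  rw [integral_finsetSum _ fun i _ => integrable_finsetSum _ fun j _ => hint i j]
  calc _ ≤ ∑ i ∈ I, (4 * B ^ 2 + B * Λ * covConst * R) := by
        refine Finset.sum_le_sum fun i hi => ?_
        rw [integral_finsetSum _ fun j _ => hint i j]
        calc _ ≤ ∑ j ∈ I, ((if i = j then 4 * B ^ 2 else 0)
              + B * Λ * covConst * ρ ((i : ℤ) - (j : ℤ)).natAbs) :=
              Finset.sum_le_sum fun j _ => key i j
          _ = 4 * B ^ 2 + B * Λ * covConst * ∑ j ∈ I, (ρ ((i : ℤ) - (j : ℤ)).natAbs : ℝ) := by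
              rw [Finset.sum_add_distrib, Finset.sum_ite_eq, if_pos hi, Finset.mul_sum]
          _ ≤ _ := by
              gcongr
              refine le_trans ?_ (ht.sum_le i)
              exact Finset.sum_le_sum_of_subset_of_nonneg (Finset.subset_univ _)
                fun _ _ _ => NNReal.coe_nonneg _
    _ = (I.card : ℝ) * (4 * B ^ 2 + B * Λ * covConst * R) := by
        rw [Finset.sum_const, nsmul_eq_mul]
    _ ≤ _ := by
        rcases I.eq_empty_or_nonempty with rfl | ⟨i, hi⟩
        · rcases Nat.eq_zero_or_pos n with rfl | hn
          · simp
          · have := ht.nonneg ⟨0, hn⟩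
            simp only [Finset.card_empty, Nat.cast_zero, zero_mul]
            positivity
        · have := ht.nonneg i
          gcongr
          simpa using Finset.card_le_univ I

end

/-! ### The mixture density and its derivative -/

/-- The derivative of the mixture density. -/
noncomputable def fZderiv {n : ℕ} (ν : Fin n → ℝ) (z : ℝ) : ℝ :=
  (n : ℝ)⁻¹ * ∑ i, phiDeriv (z - ν i)

section

variable {n : ℕ}

lemma hasDerivAt_fZ (ν : Fin n → ℝ) (z : ℝ) : HasDerivAt (fZ ν) (fZderiv ν z) z := by
  unfold fZ fZderiv
  refine HasDerivAt.const_mul _ ?_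
  refine HasDerivAt.fun_sum (A' := fun i => phiDeriv (z - ν i)) fun i _ => ?_
  exact (hasDerivAt_phi (z - ν i)).comp_sub_const z (ν i)

lemma deriv_fZ (ν : Fin n → ℝ) : deriv (fZ ν) = fZderiv ν :=
  funext fun z => (hasDerivAt_fZ ν z).deriv

lemma fZ_nonneg (ν : Fin n → ℝ) (z : ℝ) : 0 ≤ fZ ν z :=
  mul_nonneg (by positivity) (Finset.sum_nonneg fun _ _ => phi_nonneg _)

lemma fZ_pos (hn : 0 < n) (ν : Fin n → ℝ) (z : ℝ) : 0 < fZ ν z := by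
  have : Nonempty (Fin n) := ⟨⟨0, hn⟩⟩
  exact mul_pos (by positivity) (Finset.sum_pos (fun _ _ => phi_pos _) Finset.univ_nonempty)

lemma abs_average_le {g : Fin n → ℝ} {C : ℝ} (hC : 0 ≤ C) (hg : ∀ i, |g i| ≤ C) :
    |(n : ℝ)⁻¹ * ∑ i, g i| ≤ C := by
  rcases Nat.eq_zero_or_pos n with rfl | hn
  · simpa using hC
  have hn' : (0 : ℝ) < n := by exact_mod_cast hn
  rw [abs_mul, abs_of_pos (inv_pos.2 hn'), inv_mul_le_iff₀ hn']
  calc |∑ i, g i| ≤ ∑ i, |g i| := Finset.abs_sum_le_sum_abs _ _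
    _ ≤ ∑ _i : Fin n, C := Finset.sum_le_sum fun i _ => hg i
    _ = n * C := by simp

lemma fZ_le_one (ν : Fin n → ℝ) (z : ℝ) : fZ ν z ≤ 1 :=
  (le_abs_self _).trans (abs_average_le zero_le_one fun i => by
    rw [abs_of_nonneg (phi_nonneg _)]; exact phi_le_one _)

lemma abs_fZderiv_le_one (ν : Fin n → ℝ) (z : ℝ) : |fZderiv ν z| ≤ 1 :=
  abs_average_le zero_le_one fun _ => abs_phiDeriv_le _

lemma abs_fZ_sub_le (ν ν' : Fin n → ℝ) (z : ℝ) :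
    |fZ ν z - fZ ν' z| ≤ (n : ℝ)⁻¹ * ∑ i, |ν i - ν' i| := by
  unfold fZ
  rw [← mul_sub, ← Finset.sum_sub_distrib, abs_mul, abs_of_nonneg (by positivity : 0 ≤ (n : ℝ)⁻¹)]
  gcongr
  refine (Finset.abs_sum_le_sum_abs _ _).trans (Finset.sum_le_sum fun i _ => ?_)
  refine (phi_lipschitz _ _).trans_eq ?_
  rw [sub_sub_sub_cancel_left, abs_sub_comm]

lemma abs_fZderiv_sub_le (ν ν' : Fin n → ℝ) (z : ℝ) :
    |fZderiv ν z - fZderiv ν' z| ≤ (n : ℝ)⁻¹ * ∑ i, |ν i - ν' i| := by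
  unfold fZderiv
  rw [← mul_sub, ← Finset.sum_sub_distrib, abs_mul, abs_of_nonneg (by positivity : 0 ≤ (n : ℝ)⁻¹)]
  gcongr
  refine (Finset.abs_sum_le_sum_abs _ _).trans (Finset.sum_le_sum fun i _ => ?_)
  refine (phiDeriv_lipschitz _ _).trans_eq ?_
  rw [sub_sub_sub_cancel_left, abs_sub_comm]

lemma abs_fZ_sub_le' (ν : Fin n → ℝ) (z z' : ℝ) : |fZ ν z - fZ ν z'| ≤ |z - z'| := by
  unfold fZ
  rw [← mul_sub, ← Finset.sum_sub_distrib]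
  refine abs_average_le (abs_nonneg _) fun i => (phi_lipschitz _ _).trans_eq ?_
  rw [sub_sub_sub_cancel_right]

lemma abs_fZderiv_sub_le' (ν : Fin n → ℝ) (z z' : ℝ) :
    |fZderiv ν z - fZderiv ν z'| ≤ |z - z'| := by
  unfold fZderiv
  rw [← mul_sub, ← Finset.sum_sub_distrib]
  refine abs_average_le (abs_nonneg _) fun i => (phiDeriv_lipschitz _ _).trans_eq ?_
  rw [sub_sub_sub_cancel_right]

lemma measurable_fZ : Measurable fun p : (Fin n → ℝ) × ℝ => fZ p.1 p.2 := by
  unfold fZ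
  refine Measurable.const_mul ?_ _
  refine Finset.measurable_fun_sum _ fun i _ => measurable_phi.comp ?_
  fun_prop

lemma measurable_fZderiv : Measurable fun p : (Fin n → ℝ) × ℝ => fZderiv p.1 p.2 := by
  unfold fZderiv
  refine Measurable.const_mul ?_ _
  refine Finset.measurable_fun_sum _ fun i _ => measurable_phiDeriv.comp ?_
  fun_prop

/-- The score is the average of `-(z - ν_i)` under the posterior weights `φ (z - ν_i) / (n f_Z z)`.
Jensen for the square and then for `exp` applies, and the product `exp (x²/2) φ x` is constant. -/
lemma exp_half_sq_score_mul_le (hn : 0 < n) (ν : Fin n → ℝ) (z : ℝ) :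
    Real.exp ((fZderiv ν z / fZ ν z) ^ 2 / 2) * fZ ν z ≤ (√(2 * Real.pi))⁻¹ := by
  have hf := fZ_pos hn ν z
  have hn' : (0 : ℝ) < n := by exact_mod_cast hn
  set w : Fin n → ℝ := fun i => (n : ℝ)⁻¹ * φ (z - ν i) / fZ ν z with hw
  have hw0 : ∀ i ∈ Finset.univ, 0 ≤ w i := fun i _ => by
    have := phi_nonneg (z - ν i); positivity
  have hw1 : ∑ i, w i = 1 := by
    simp only [w]
    rw [← Finset.sum_div, ← Finset.mul_sum]
    exact div_self hf.ne'
  have hs : fZderiv ν z / fZ ν z = ∑ i, w i • (-(z - ν i)) := by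
    simp only [w, fZderiv, phiDeriv, smul_eq_mul]
    rw [Finset.mul_sum, Finset.sum_div]
    refine Finset.sum_congr rfl fun i _ => by ring
  have h1 := (Even.convexOn_pow (𝕜 := ℝ) (n := 2) (by decide)).map_sum_le hw0 hw1
    (p := fun i => -(z - ν i)) (fun _ _ => Set.mem_univ _)
  rw [← hs] at h1
  have h2 := convexOn_exp.map_sum_le hw0 hw1 (p := fun i => (-(z - ν i)) ^ 2 / 2)
    (fun _ _ => Set.mem_univ _)
  have h3 : (fZderiv ν z / fZ ν z) ^ 2 / 2 ≤ ∑ i, w i • ((-(z - ν i)) ^ 2 / 2) := by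
    simp only [smul_eq_mul] at h1 ⊢
    calc _ ≤ (∑ i, w i * (-(z - ν i)) ^ 2) / 2 := by gcongr
      _ = _ := by rw [Finset.sum_div]; exact Finset.sum_congr rfl fun i _ => by ring
  have h4 := (Real.exp_le_exp.2 h3).trans h2
  calc _ ≤ (∑ i, w i • Real.exp ((-(z - ν i)) ^ 2 / 2)) * fZ ν z := by gcongr
    _ = ∑ i : Fin n, (n : ℝ)⁻¹ * (√(2 * Real.pi))⁻¹ := by
        rw [Finset.sum_mul]
        refine Finset.sum_congr rfl fun i _ => ?_
        simp only [w, smul_eq_mul]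
        have : Real.exp (-(z - ν i) ^ 2 / 2) * Real.exp ((-(z - ν i)) ^ 2 / 2) = 1 := by
          rw [← Real.exp_add]; ring_nf; simp
        rw [phi_eq, div_mul_eq_mul_div, div_mul_cancel₀ _ hf.ne', mul_assoc, mul_assoc, this,
          mul_one]
    _ = _ := by
        simp only [Finset.sum_const, Finset.card_univ, Fintype.card_fin, nsmul_eq_mul]
        field_simp

lemma sq_score_le_of_le {η : ℝ} (hn : 0 < n) (hη : 0 < η) {ν : Fin n → ℝ} {z : ℝ}
    (h : η ≤ fZ ν z) : (fZderiv ν z / fZ ν z) ^ 2 ≤ 2 * Real.log (1 / η) := by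
  have h1 := exp_half_sq_score_mul_le hn ν z
  have h2 : (√(2 * Real.pi))⁻¹ ≤ 1 := inv_le_one_of_one_le₀ (by linarith [one_le_sqrt_two_pi])
  have h3 : Real.exp ((fZderiv ν z / fZ ν z) ^ 2 / 2) ≤ 1 / η := by
    rw [le_div_iff₀ hη]
    exact (mul_le_mul_of_nonneg_left h (Real.exp_pos _).le).trans (h1.trans h2)
  have := (Real.le_log_iff_exp_le (by positivity)).2 h3
  linarith

lemma phi_le_mul_fZ (hn : 0 < n) (ν : Fin n → ℝ) (i : Fin n) (x : ℝ) :
    (n : ℝ)⁻¹ * φ x ≤ fZ ν (ν i + x) := by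
  unfold fZ
  gcongr
  have := Finset.single_le_sum (f := fun j => φ (ν i + x - ν j)) (fun j _ => phi_nonneg _)
    (Finset.mem_univ i)
  simpa using this

/-- The `i`-th component alone keeps the density at `Z_i` above `φ (ε_i) / n`. Hence the oracle's
loss is under control even at the few indices where nothing else is known. -/
lemma sq_score_le (hn : 0 < n) (ν : Fin n → ℝ) (i : Fin n) (x : ℝ) :
    (fZderiv ν (ν i + x) / fZ ν (ν i + x)) ^ 2 ≤ 2 * Real.log n + x ^ 2 := by
  have hn' : (0 : ℝ) < n := by exact_mod_cast hn
  have h1 := exp_half_sq_score_mul_le hn ν (ν i + x)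
  set s := fZderiv ν (ν i + x) / fZ ν (ν i + x)
  have h2 := mul_le_mul_of_nonneg_left (phi_le_mul_fZ hn ν i x) (Real.exp_pos (s ^ 2 / 2)).le
  have h3 := h2.trans h1
  rw [phi_eq] at h3
  have h5 : Real.exp (-x ^ 2 / 2) * Real.exp (x ^ 2 / 2) = 1 := by
    rw [← Real.exp_add]; ring_nf; simp
  have hq : 0 < (√(2 * Real.pi))⁻¹ := by positivity
  have h4 : Real.exp (s ^ 2 / 2) ≤ Real.exp (Real.log n + x ^ 2 / 2) := by
    rw [Real.exp_add, Real.exp_log hn']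
    have h6 : Real.exp (s ^ 2 / 2) * Real.exp (-x ^ 2 / 2) ≤ n := by
      have : (n : ℝ)⁻¹ * (Real.exp (s ^ 2 / 2) * Real.exp (-x ^ 2 / 2)) ≤ 1 := by
        refine le_of_mul_le_mul_left ?_ hq
        linarith
      rwa [inv_mul_le_iff₀ hn', mul_one] at this
    calc _ = (Real.exp (s ^ 2 / 2) * Real.exp (-x ^ 2 / 2)) * Real.exp (x ^ 2 / 2) := by
          rw [mul_assoc, h5, mul_one]
      _ ≤ _ := by gcongr
  have := Real.exp_le_exp.1 h4
  linarith

/-- Cauchy-Schwarz for the mixture density of a set of indices. -/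
lemma sq_sum_phiDeriv_le (ν : Fin n → ℝ) (I : Finset (Fin n)) (z : ℝ) :
    ((n : ℝ)⁻¹ * ∑ i ∈ I, phiDeriv (z - ν i)) ^ 2
      ≤ ((n : ℝ)⁻¹ * ∑ i ∈ I, φ (z - ν i)) *
        ((n : ℝ)⁻¹ * ∑ i ∈ I, (z - ν i) ^ 2 * φ (z - ν i)) := by
  have h := Finset.sum_sq_le_sum_mul_sum_of_sq_le_mul I (r := fun i => phiDeriv (z - ν i))
    (f := fun i => φ (z - ν i)) (g := fun i => (z - ν i) ^ 2 * φ (z - ν i))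
    (fun i _ => phi_nonneg _) (fun i _ => mul_nonneg (sq_nonneg _) (phi_nonneg _))
    (fun i _ => by simp only [phiDeriv]; exact le_of_eq (by ring))
  have h0 : 0 ≤ (n : ℝ)⁻¹ ^ 2 := by positivity
  nlinarith

/-- Cauchy-Schwarz and `x² φ x ≤ 1`. It makes the derivative small wherever the density is small,
which is how the regularised region is discarded later. -/
lemma sq_fZderiv_le (ν : Fin n → ℝ) (z : ℝ) : fZderiv ν z ^ 2 ≤ fZ ν z := by
  have h1 := sq_sum_phiDeriv_le ν Finset.univ z
  have h2 : (n : ℝ)⁻¹ * ∑ i, (z - ν i) ^ 2 * φ (z - ν i) ≤ 1 :=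
    (le_abs_self _).trans (abs_average_le zero_le_one fun i => by
      rw [abs_of_nonneg (mul_nonneg (sq_nonneg _) (phi_nonneg _))]; exact sq_mul_phi_le _)
  have h3 := fZ_nonneg ν z
  unfold fZ at h3
  unfold fZderiv fZ
  nlinarith

/-- The oracle score with the density in the denominator bounded below by `η`. -/
noncomputable def regScore (η : ℝ) (ν : Fin n → ℝ) (z : ℝ) : ℝ :=
  fZderiv ν z / max (fZ ν z) η

lemma regScore_eq {η : ℝ} {ν : Fin n → ℝ} {z : ℝ} (h : η ≤ fZ ν z) :
    regScore η ν z = fZderiv ν z / fZ ν z := by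
  rw [regScore, max_eq_left h]

lemma abs_regScore_le {η : ℝ} (hη : 0 < η) (ν : Fin n → ℝ) (z : ℝ) :
    |regScore η ν z| ≤ η⁻¹ := by
  have hm : 0 < max (fZ ν z) η := lt_max_of_lt_right hη
  rw [regScore, abs_div, abs_of_pos hm, div_eq_mul_inv]
  calc _ ≤ 1 * η⁻¹ := by
        gcongr
        · exact abs_fZderiv_le_one ν z
        · exact le_max_right _ _
    _ = _ := one_mul _

lemma sq_regScore_le (hn : 0 < n) (η : ℝ) (ν : Fin n → ℝ) (z : ℝ) :
    regScore η ν z ^ 2 ≤ (fZderiv ν z / fZ ν z) ^ 2 := by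
  have hf := fZ_pos hn ν z
  rw [regScore, div_pow, div_pow]
  gcongr
  exact le_max_left _ _

/-- This stability is the purpose of the regularisation: with the denominator kept above `η`,
perturbing one noise variable changes the score by `O(η⁻² / n)`. -/
lemma abs_regScore_sub_le {η : ℝ} (hη : 0 < η) (hη1 : η ≤ 1) (ν ν' : Fin n → ℝ) (z : ℝ) :
    |regScore η ν z - regScore η ν' z| ≤ 2 * η⁻¹ ^ 2 * ((n : ℝ)⁻¹ * ∑ i, |ν i - ν' i|) := by
  set d := (n : ℝ)⁻¹ * ∑ i, |ν i - ν' i|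
  have h1 := abs_fZ_sub_le ν ν' z
  have h2 := abs_fZderiv_sub_le ν ν' z
  have hd : 0 ≤ d := (abs_nonneg _).trans h1
  unfold regScore
  set a := fZderiv ν z
  set a' := fZderiv ν' z
  have ha' : |a'| ≤ 1 := abs_fZderiv_le_one ν' z
  set m := max (fZ ν z) η
  set m' := max (fZ ν' z) η
  have hm : η ≤ m := le_max_right _ _
  have hm' : η ≤ m' := le_max_right _ _
  have hmm : |m - m'| ≤ d := (abs_max_sub_max_le_abs _ _ _).trans h1
  have hm0 : 0 < m := hη.trans_le hm
  have hm0' : 0 < m' := hη.trans_le hm'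
  have e : a / m - a' / m' = (a - a') * m⁻¹ + a' * (m' - m) * (m⁻¹ * m'⁻¹) := by
    field_simp; ring
  have i1 : m⁻¹ ≤ η⁻¹ := inv_anti₀ hη hm
  have i2 : m'⁻¹ ≤ η⁻¹ := inv_anti₀ hη hm'
  have i3 : 1 ≤ η⁻¹ := (one_le_inv₀ hη).2 hη1
  rw [e]
  refine (abs_add_le _ _).trans ?_
  rw [abs_mul, abs_mul, abs_mul, abs_of_pos (inv_pos.2 hm0),
    abs_of_pos (mul_pos (inv_pos.2 hm0) (inv_pos.2 hm0')), abs_sub_comm m' m]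
  have j1 : |a - a'| * m⁻¹ ≤ d * η⁻¹ := by gcongr
  have j2 : |a'| * |m - m'| * (m⁻¹ * m'⁻¹) ≤ 1 * d * (η⁻¹ * η⁻¹) := by gcongr
  have j3 : d * η⁻¹ ≤ d * (η⁻¹ * η⁻¹) := by
    gcongr
    exact le_mul_of_one_le_right (by positivity) i3
  linarith

lemma measurable_regScore (η : ℝ) :
    Measurable fun p : (Fin n → ℝ) × ℝ => regScore η p.1 p.2 :=
  measurable_fZderiv.div (measurable_fZ.max measurable_const)

end

/-! ### Uniform deviations of kernel sums -/

/-- The deviation of a kernel sum from its mean given the centred means. -/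
noncomputable def deviation {n : ℕ} (ψ : ℝ → ℝ) (ν x : Fin n → ℝ) (z : ℝ) : ℝ :=
  (n : ℝ)⁻¹ * ∑ i, (ψ (z - ν i - x i) - ∫ e, ψ (z - ν i - e) ∂γ)

section

set_option linter.unusedSectionVars false

variable {ψ : ℝ → ℝ} {B Λ : ℝ}

lemma continuous_of_abs_sub_le (hΛ : ∀ x y, |ψ x - ψ y| ≤ Λ * |x - y|) : Continuous ψ := by
  refine (LipschitzWith.of_dist_le_mul (K := Real.toNNReal Λ) fun x y => ?_).continuous
  rw [Real.dist_eq, Real.dist_eq]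
  exact (hΛ x y).trans (mul_le_mul_of_nonneg_right (Real.le_coe_toNNReal Λ) (abs_nonneg _))

lemma integrable_comp_sub_gauss (hB : ∀ x, |ψ x| ≤ B) (hΛ : ∀ x y, |ψ x - ψ y| ≤ Λ * |x - y|)
    (x : ℝ) : Integrable (fun e => ψ (x - e)) γ :=
  (integrable_const B).mono'
    ((continuous_of_abs_sub_le hΛ).comp (continuous_const.sub continuous_id)).aestronglyMeasurable
    (ae_of_all _ fun _ => hB _)

lemma abs_integral_comp_sub_le (hB : ∀ x, |ψ x| ≤ B) (x : ℝ) : |∫ e, ψ (x - e) ∂γ| ≤ B := by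
  have := norm_integral_le_of_norm_le_const (μ := γ) (f := fun e => ψ (x - e)) (C := B)
    (ae_of_all _ fun e => hB _)
  simpa using this

lemma abs_integral_comp_sub_sub_le (hB : ∀ x, |ψ x| ≤ B)
    (hΛ : ∀ x y, |ψ x - ψ y| ≤ Λ * |x - y|) (x y : ℝ) :
    |∫ e, ψ (x - e) ∂γ - ∫ e, ψ (y - e) ∂γ| ≤ Λ * |x - y| := by
  rw [← integral_sub (integrable_comp_sub_gauss hB hΛ x) (integrable_comp_sub_gauss hB hΛ y)]
  have := norm_integral_le_of_norm_le_const (μ := γ) (f := fun e => ψ (x - e) - ψ (y - e))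
    (C := Λ * |x - y|) (ae_of_all _ fun e => by
      refine (hΛ _ _).trans_eq ?_
      rw [sub_sub_sub_cancel_right])
  simpa using this

lemma abs_deviation_sub_le {n : ℕ} (hB : ∀ x, |ψ x| ≤ B)
    (hΛ : ∀ x y, |ψ x - ψ y| ≤ Λ * |x - y|) (hΛ0 : 0 ≤ Λ) (ν x : Fin n → ℝ) (z z' : ℝ) :
    |deviation ψ ν x z - deviation ψ ν x z'| ≤ 2 * Λ * |z - z'| := by
  unfold deviation
  rw [← mul_sub, ← Finset.sum_sub_distrib]
  refine abs_average_le (by positivity) fun i => ?_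
  have h1 := hΛ (z - ν i - x i) (z' - ν i - x i)
  have h2 := abs_integral_comp_sub_sub_le hB hΛ (z - ν i) (z' - ν i)
  have e1 : z - ν i - x i - (z' - ν i - x i) = z - z' := by ring
  have e2 : z - ν i - (z' - ν i) = z - z' := by ring
  rw [e1] at h1
  rw [e2] at h2
  rw [sub_sub_sub_comm]
  refine (abs_sub _ _).trans ?_
  linarith

section

variable {n : ℕ} {Ω : Type*} [MeasurableSpace Ω] {P : Measure Ω} [IsProbabilityMeasure P]
  {μ ε : Ω → Fin n → ℝ} {t : (Fin n → ℝ) → Fin n → ℝ} {ρ : ℕ → ℝ≥0} {R : ℝ}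

lemma measurable_integral_comp_sub (hB : ∀ x, |ψ x| ≤ B)
    (hΛ : ∀ x y, |ψ x - ψ y| ≤ Λ * |x - y|) :
    Measurable fun v => ∫ e, ψ (v - e) ∂γ :=
  (continuous_of_abs_sub_le (abs_integral_comp_sub_sub_le hB hΛ)).measurable

lemma measurable_deviation (hB : ∀ x, |ψ x| ≤ B) (hΛ : ∀ x y, |ψ x - ψ y| ≤ Λ * |x - y|) (z : ℝ) :
    Measurable fun p : (Fin n → ℝ) × (Fin n → ℝ) => deviation ψ p.1 p.2 z := by
  have h1 := (continuous_of_abs_sub_le hΛ).measurable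
  have h2 := measurable_integral_comp_sub hB hΛ
  unfold deviation
  refine Measurable.const_mul (Finset.measurable_fun_sum _ fun i _ => ?_) _
  exact (h1.comp (by fun_prop)).sub
    (h2.comp (by fun_prop : Measurable fun p : (Fin n → ℝ) × (Fin n → ℝ) => z - p.1 i))

lemma IsModel.measurable_nu (h : IsModel P μ ε) (ht : IsFilter t ρ R) :
    Measurable fun ω => nuFun t (μ ω) (ε ω) :=
  (measurable_nuFun ht.measurable).comp (h.measurable_mu.prodMk h.measurable_eps)

lemma IsModel.integral_sq_deviation (h : IsModel P μ ε) (ht : IsFilter t ρ R) (hn : 0 < n)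
    (hB0 : 0 ≤ B) (hΛ0 : 0 ≤ Λ) (hB : ∀ x, |ψ x| ≤ B)
    (hΛ : ∀ x y, |ψ x - ψ y| ≤ Λ * |x - y|) (z : ℝ) :
    Integrable (fun ω => deviation ψ (nuFun t (μ ω) (ε ω)) (ε ω) z ^ 2) P ∧
    ∫ ω, deviation ψ (nuFun t (μ ω) (ε ω)) (ε ω) z ^ 2 ∂P
      ≤ (16 * B ^ 2 + 4 * B * Λ * covConst * R) / n := by
  have hψ := (continuous_of_abs_sub_le hΛ).measurable
  have hψ2 := measurable_integral_comp_sub hB hΛ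
  have hn' : (0 : ℝ) < n := by exact_mod_cast hn
  set G : ℝ → ℝ → ℝ := fun e v => ψ (z - v - e) - ∫ e, ψ (z - v - e) ∂γ with hG
  have hGm : Measurable (Function.uncurry G) :=
    (hψ.comp (by fun_prop : Measurable fun p : ℝ × ℝ => z - p.2 - p.1)).sub
      (hψ2.comp (by fun_prop : Measurable fun p : ℝ × ℝ => z - p.2))
  have hGB : ∀ e v, |G e v| ≤ 2 * B * (1 + |e|) := fun e v => by
    have h1 := hB (z - v - e)
    have h2 := abs_integral_comp_sub_le hB (z - v)
    have h3 : |G e v| ≤ _ := abs_sub _ _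
    have h4 := abs_nonneg e
    nlinarith
  have hGΛ : ∀ e v v', |G e v - G e v'| ≤ 2 * Λ * (1 + |e|) * |v - v'| := fun e v v' => by
    have h1 := hΛ (z - v - e) (z - v' - e)
    have h2 := abs_integral_comp_sub_sub_le hB hΛ (z - v) (z - v')
    have e1 : |z - v - e - (z - v' - e)| = |v - v'| := by
      rw [abs_sub_comm v]; congr 1; ring
    have e2 : |z - v - (z - v')| = |v - v'| := by rw [abs_sub_comm v]; congr 1; ring
    rw [e1] at h1
    rw [e2] at h2
    have h3 : |G e v - G e v'| ≤ 2 * Λ * |v - v'| := by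
      simp only [G]
      rw [sub_sub_sub_comm]
      refine (abs_sub _ _).trans ?_
      linarith
    have h4 : 0 ≤ Λ * |e| * |v - v'| := by positivity
    linarith
  have h0 : ∀ v, ∫ e, G e v ∂γ = 0 := fun v => by
    simp only [G]
    rw [integral_sub (integrable_comp_sub_gauss hB hΛ (z - v)) (integrable_const _)]
    simp
  have i1 := h.integrable_sq_sum ht hGm (by positivity) hGB Finset.univ
  have i2 := h.integral_sq_sum_le ht hGm (by positivity) (by positivity) hGB hGΛ h0 Finset.univ
  have e1 : ∀ ω, deviation ψ (nuFun t (μ ω) (ε ω)) (ε ω) z ^ 2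
      = (n : ℝ)⁻¹ ^ 2 * (∑ i, G (ε ω i) (nuFun t (μ ω) (ε ω) i)) ^ 2 := fun ω => by
    rw [← mul_pow]; rfl
  simp_rw [e1]
  refine ⟨i1.const_mul _, ?_⟩
  rw [integral_const_mul]
  calc _ ≤ (n : ℝ)⁻¹ ^ 2 * (n * (4 * (2 * B) ^ 2 + 2 * B * (2 * Λ) * covConst * R)) := by gcongr
    _ = _ := by field_simp; ring

lemma IsModel.measurable_deviation (h : IsModel P μ ε) (ht : IsFilter t ρ R)
    (hB : ∀ x, |ψ x| ≤ B) (hΛ : ∀ x y, |ψ x - ψ y| ≤ Λ * |x - y|) (z : ℝ) :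
    Measurable fun ω => deviation ψ (nuFun t (μ ω) (ε ω)) (ε ω) z := by
  have h1 : Measurable fun ω => (nuFun t (μ ω) (ε ω), ε ω) :=
    (h.measurable_nu ht).prodMk h.measurable_eps
  have h2 := (EBFilter.measurable_deviation (n := n) hB hΛ z).comp h1
  simpa only [Function.comp_def] using h2

lemma measureReal_sq_le_div {W : Ω → ℝ} {V a : ℝ} (hW : Integrable (fun ω => W ω ^ 2) P)
    (hV : ∫ ω, W ω ^ 2 ∂P ≤ V) (ha : 0 < a) : P.real {ω | a ^ 2 ≤ W ω ^ 2} ≤ V / a ^ 2 := by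
  have h0 : 0 ≤ᵐ[P] fun ω => W ω ^ 2 := ae_of_all _ fun ω => sq_nonneg (W ω)
  have := mul_meas_ge_le_integral_of_nonneg h0 hW (a ^ 2)
  rw [le_div_iff₀ (by positivity), mul_comm]
  exact this.trans hV

/-- Chebyshev's inequality and a union bound over a grid of spacing `d` in `[-L, L]`; the Lipschitz
bound in `z` covers the gaps. -/
lemma IsModel.exists_uniform_deviation (h : IsModel P μ ε) (ht : IsFilter t ρ R) (hn : 0 < n)
    (hB0 : 0 ≤ B) (hΛ0 : 0 ≤ Λ) (hB : ∀ x, |ψ x| ≤ B)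
    (hΛ : ∀ x y, |ψ x - ψ y| ≤ Λ * |x - y|) {L d a : ℝ} (hL : 0 < L) (hd : 0 < d) (ha : 0 < a) :
    ∃ S : Set Ω, MeasurableSet S ∧
      P.real S ≤ (2 * L / d + 1) * ((16 * B ^ 2 + 4 * B * Λ * covConst * R) / n / a ^ 2) ∧
      ∀ ω ∉ S, ∀ z, |z| ≤ L → |deviation ψ (nuFun t (μ ω) (ε ω)) (ε ω) z| ≤ a + 2 * Λ * d := by
  obtain ⟨W, hW⟩ : ∃ W : ℝ → Ω → ℝ, ∀ z ω, W z ω = deviation ψ (nuFun t (μ ω) (ε ω)) (ε ω) z :=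
    ⟨_, fun _ _ => rfl⟩
  have hWm : ∀ z, Measurable (W z) := fun z => by
    rw [funext (hW z)]
    exact h.measurable_deviation ht hB hΛ z
  set N := ⌊2 * L / d⌋₊ with hN
  set V := (16 * B ^ 2 + 4 * B * Λ * covConst * R) / n with hV
  have hcheb : ∀ z, P.real {ω | a ^ 2 ≤ W z ω ^ 2} ≤ V / a ^ 2 := fun z => by
    obtain ⟨i1, i2⟩ : Integrable (fun ω => W z ω ^ 2) P ∧ ∫ ω, W z ω ^ 2 ∂P ≤ V :=
      by simpa only [hW] using h.integral_sq_deviation ht hn hB0 hΛ0 hB hΛ z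
    exact measureReal_sq_le_div i1 i2 ha
  refine ⟨⋃ k ∈ Finset.range (N + 1), {ω | a ^ 2 ≤ W (-L + k * d) ω ^ 2},
    Finset.measurableSet_biUnion _ fun k _ => measurableSet_le measurable_const
      ((hWm _).pow_const 2), ?_, ?_⟩
  · have hV0 : 0 ≤ V / a ^ 2 := measureReal_nonneg.trans (hcheb 0)
    calc _ ≤ ∑ k ∈ Finset.range (N + 1), P.real {ω | a ^ 2 ≤ W (-L + k * d) ω ^ 2} :=
          measureReal_biUnion_finset_le _ _
      _ ≤ ∑ k ∈ Finset.range (N + 1), V / a ^ 2 := Finset.sum_le_sum fun k _ => hcheb _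
      _ = ((N : ℝ) + 1) * (V / a ^ 2) := by simp
      _ ≤ _ := by
        gcongr
        exact Nat.floor_le (by positivity)
  · intro ω hω z hz
    simp only [Set.mem_iUnion, not_exists, Set.mem_ofPred_eq, not_le] at hω
    have hz' := abs_le.1 hz
    -- The grid point just to the left of `z`.
    set k := ⌊(z + L) / d⌋₊ with hk
    have h0 : 0 ≤ (z + L) / d := div_nonneg (by linarith) hd.le
    have hkN : k ≤ N := Nat.floor_le_floor (by gcongr; linarith)
    have h1 := Nat.floor_le h0
    have h2 := Nat.lt_floor_add_one ((z + L) / d)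
    rw [← hk] at h1 h2
    rw [le_div_iff₀ hd] at h1
    rw [div_lt_iff₀ hd] at h2
    have h3 : |z - (-L + k * d)| ≤ d := by rw [abs_le]; constructor <;> linarith
    have h4 := abs_deviation_sub_le hB hΛ hΛ0 (nuFun t (μ ω) (ε ω)) (ε ω) z (-L + k * d)
    have h5 := hω k (Finset.mem_range.2 (by omega))
    have h6 : |W (-L + k * d) ω| < a := abs_lt_of_sq_lt_sq h5 ha.le
    have h7 : 2 * Λ * |z - (-L + k * d)| ≤ 2 * Λ * d := by gcongr
    have h8 := abs_sub_abs_le_abs_sub (deviation ψ (nuFun t (μ ω) (ε ω)) (ε ω) z)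
      (deviation ψ (nuFun t (μ ω) (ε ω)) (ε ω) (-L + k * d))
    rw [hW] at h6
    linarith

end

end

lemma tendsto_log_pow_div (k : ℕ) :
    Tendsto (fun n : ℕ => Real.log n ^ k / n) atTop (𝓝 0) := by
  have := (Real.isLittleO_pow_log_id_atTop (n := k)).tendsto_div_nhds_zero
  exact this.comp tendsto_natCast_atTop_atTop

lemma tendsto_log_natCast : Tendsto (fun n : ℕ => Real.log n) atTop atTop :=
  Real.tendsto_log_atTop.comp tendsto_natCast_atTop_atTop

section

variable {Ω : ℕ → Type*} [∀ n, MeasurableSpace (Ω n)] {P : ∀ n, Measure (Ω n)}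
  [∀ n, IsProbabilityMeasure (P n)] {μ ε : ∀ n, Ω n → Fin n → ℝ}
  {t : ∀ n, (Fin n → ℝ) → Fin n → ℝ} {ρ : ℕ → ℝ≥0} {R : ℝ}

/-- Every cost (height, Lipschitz constant, size of the grid) is a power of `log n`, while the
second moment carries `1/n`, so any power of `log n` can be gained. The spacing is such that the
threshold and the grid error each take half of the bound. -/
lemma eventually_exists_deviation (h : ∀ n, IsModel (P n) (μ n) (ε n))
    (ht : ∀ n, IsFilter (t n) ρ R) {ψ : ℝ → ℝ → ℝ}
    (hB : ∀ L, 1 ≤ L → ∀ x, |ψ L x| ≤ L ^ 2)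
    (hΛ : ∀ L, 1 ≤ L → ∀ x y, |ψ L x - ψ L y| ≤ 2 * L ^ 3 * |x - y|) (k : ℕ) :
    ∀ᶠ n : ℕ in atTop, ∃ S : Set (Ω n), MeasurableSet S ∧ (P n).real S ≤ (Real.log n ^ k)⁻¹ ∧
      ∀ ω ∉ S, ∀ z, |z| ≤ Real.log n →
        |deviation (ψ (Real.log n)) (nuFun (t n) (μ n ω) (ε n ω)) (ε n ω) z|
          ≤ (Real.log n ^ k)⁻¹ := by
  have hR : 0 ≤ R := (ht 1).nonneg 0
  have hC := covConst_nonneg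
  -- `68 = 17 * 4`: the grid has at most `17 L^(k+4)` points, and the threshold is half of `L^(-k)`.
  set A := 68 * (16 + 8 * covConst * R) with hA
  have hA0 : 0 ≤ A := by positivity
  have htend := (tendsto_log_pow_div (4 * k + 9)).const_mul A
  rw [mul_zero] at htend
  filter_upwards [eventually_gt_atTop 0, tendsto_log_natCast.eventually_ge_atTop 1,
    (tendsto_order.1 htend).2 1 one_pos] with n hn hL hsmall
  set L := Real.log n with hLdef
  have hL0 : 0 < L := by linarith
  have hn' : (0 : ℝ) < n := by exact_mod_cast hn
  obtain ⟨S, hS, hS1, hS2⟩ := (h n).exists_uniform_deviation (ht n) hn (B := L ^ 2)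
    (Λ := 2 * L ^ 3) (by positivity) (by positivity) (hB L hL) (hΛ L hL) (L := L)
    (d := (L ^ k)⁻¹ / (8 * L ^ 3)) (a := (L ^ k)⁻¹ / 2) hL0 (by positivity) (by positivity)
  refine ⟨S, hS, hS1.trans ?_, fun ω hω z hz => (hS2 ω hω z hz).trans_eq ?_⟩
  · have hk1 : 1 ≤ L ^ (k + 4) := one_le_pow₀ hL
    have e1 : 2 * L / ((L ^ k)⁻¹ / (8 * L ^ 3)) + 1 ≤ 17 * L ^ (k + 4) := by
      have : 2 * L / ((L ^ k)⁻¹ / (8 * L ^ 3)) = 16 * L ^ (k + 4) := by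
        field_simp; ring
      rw [this]; linarith
    have e2 : 16 * (L ^ 2) ^ 2 + 4 * L ^ 2 * (2 * L ^ 3) * covConst * R
        ≤ (16 + 8 * covConst * R) * L ^ 5 := by
      have : L ^ 4 ≤ L ^ 5 := pow_le_pow_right₀ hL (by norm_num)
      nlinarith
    calc _ ≤ 17 * L ^ (k + 4) * (((16 + 8 * covConst * R) * L ^ 5) / n / ((L ^ k)⁻¹ / 2) ^ 2) := by
          gcongr
      _ = (A * (L ^ (4 * k + 9) / n)) * (L ^ k)⁻¹ := by
          rw [hA]; field_simp; ring
      _ ≤ 1 * (L ^ k)⁻¹ := by gcongr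
      _ = _ := one_mul _
  · field_simp; ring

end

/-! ### Comparison of the empirical rule and of the oracle rule -/

section

variable {n : ℕ}

lemma fHat_pos (hn : 0 < n) {σ : ℝ} (hσ : 0 < σ) (Z : Fin n → ℝ) (z : ℝ) : 0 < fHat σ Z z := by
  have : Nonempty (Fin n) := ⟨⟨0, hn⟩⟩
  exact mul_pos (by positivity)
    (Finset.sum_pos (fun _ _ => scaledKernel_pos hσ _) Finset.univ_nonempty)

lemma abs_empiricalScore_le (hn : 0 < n) {σ : ℝ} (hσ : 0 < σ) (Z : Fin n → ℝ) (z : ℝ) :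
    |fHat' σ Z z / fHat σ Z z| ≤ 2 * σ⁻¹ := by
  have h := fHat_pos hn hσ Z z
  rw [abs_div, abs_of_pos h, div_le_iff₀ h]
  unfold fHat' fHat
  rw [deriv_scaledKernel, abs_mul, abs_of_nonneg (by positivity : 0 ≤ (n : ℝ)⁻¹)]
  calc (n : ℝ)⁻¹ * |∑ j, scaledDeriv σ (z - Z j)|
      ≤ (n : ℝ)⁻¹ * ∑ j, 2 * σ⁻¹ * scaledKernel σ (z - Z j) := by
        gcongr
        exact (Finset.abs_sum_le_sum_abs _ _).trans
          (Finset.sum_le_sum fun j _ => abs_scaledDeriv_le hσ _)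
    _ = _ := by rw [← Finset.mul_sum]; ring

/-- Errors relative to `f` suffice: they keep `g ≥ f/2`, so the error of the quotient involves
`f'/f` and never `1/f`. -/
lemma abs_empiricalScore_sub_le {f f' g g' δ : ℝ} (hf : 0 < f) (hδ : δ ≤ 1 / 4)
    (h : |g - f| ≤ 2 * δ * f) (h' : |g' - f'| ≤ 2 * δ * f) :
    |g' / g - f' / f| ≤ 4 * δ * (1 + |f' / f|) := by
  have h1 := abs_le.1 h
  have hg : f / 2 ≤ g := by nlinarith
  have hg0 : 0 < g := by linarith
  have e : g' / g - f' / f = ((g' - f') - f' / f * (g - f)) / g := by field_simp; ring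
  have hδ0 : 0 ≤ 2 * δ * f := (abs_nonneg _).trans h
  rw [e, abs_div, abs_of_pos hg0, div_le_iff₀ hg0]
  calc |(g' - f') - f' / f * (g - f)| ≤ |g' - f'| + |f' / f| * |g - f| := by
        rw [← abs_mul]; exact abs_sub _ _
    _ ≤ 2 * δ * f + |f' / f| * (2 * δ * f) := by gcongr
    _ = 4 * δ * (1 + |f' / f|) * (f / 2) := by ring
    _ ≤ 4 * δ * (1 + |f' / f|) * g := by
        have : 0 ≤ δ := by
          by_contra hneg
          push Not at hneg
          nlinarith
        gcongr

/-- Cut `[-L, L]` into at most `4 L²` cells of width `1/L`, one bandwidth. Residuals sharing a cell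
with `Z_i` each add at least `L/20` to `n fHat (Z_i)`, so a cell where `fHat ≤ 2η` occurs holds at
most `40 η n / L` of the given points. The count is deterministic because `fHat` is built from the
residuals themselves. -/
lemma card_low_density_le {L η : ℝ} (hL : 1 ≤ L) (hη : 0 < η) (Z : Fin n → ℝ) (hn : 0 < n)
    (A : Finset (Fin n)) (hA : ∀ i ∈ A, |Z i| ≤ L) (hA' : ∀ i ∈ A, fHat (1 / L) Z (Z i) ≤ 2 * η) :
    (A.card : ℝ) ≤ 160 * L * η * n := by
  have hL0 : 0 < L := by linarith
  have hn' : (0 : ℝ) < n := by exact_mod_cast hn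
  set b : Fin n → ℤ := fun i => ⌊Z i * L⌋
  have hfib : ∀ c ∈ A.image b, ((A.filter fun j => b j = c).card : ℝ) ≤ 40 * η * n / L := by
    intro c hc
    obtain ⟨i, hi, rfl⟩ := Finset.mem_image.1 hc
    have h1 := hA' i hi
    have h2 : ((A.filter fun j => b j = b i).card : ℝ) * (L / 20)
        ≤ ∑ j, scaledKernel (1 / L) (Z i - Z j) := by
      calc _ = ∑ j ∈ A.filter fun j => b j = b i, L / 20 := by
            rw [Finset.sum_const, nsmul_eq_mul]
        _ ≤ ∑ j ∈ A.filter fun j => b j = b i, scaledKernel (1 / L) (Z i - Z j) := by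
            refine Finset.sum_le_sum fun j hj => ?_
            have hj' : b j = b i := (Finset.mem_filter.1 hj).2
            have h3 : |Z i * L - Z j * L| < 1 := Int.abs_sub_lt_one_of_floor_eq_floor hj'.symm
            have h4 : |(Z i - Z j) / (1 / L)| ≤ 1 := by
              rw [div_div_eq_mul_div, div_one, sub_mul]; exact h3.le
            have h5 := logisticKernel_lower h4
            unfold scaledKernel
            rw [one_div, inv_inv]
            rw [one_div] at h5
            calc L / 20 = L * (1 / 20) := by ring
              _ ≤ _ := by gcongr; simpa using h5
        _ ≤ _ := Finset.sum_le_sum_of_subset_of_nonneg (Finset.subset_univ _)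
            fun j _ _ => (scaledKernel_pos (by positivity) _).le
    unfold fHat at h1
    rw [inv_mul_le_iff₀ hn'] at h1
    rw [le_div_iff₀ hL0]
    linarith
  have himg : ((A.image b).card : ℝ) ≤ 4 * L ^ 2 := by
    have hsub : A.image b ⊆ Finset.Icc ⌊-L ^ 2⌋ ⌊L ^ 2⌋ := by
      intro c hc
      obtain ⟨i, hi, rfl⟩ := Finset.mem_image.1 hc
      have h1 := abs_le.1 (hA i hi)
      exact Finset.mem_Icc.2 ⟨Int.floor_le_floor (by nlinarith), Int.floor_le_floor (by nlinarith)⟩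
    have h2 := Finset.card_le_card hsub
    rw [Int.card_Icc] at h2
    have h3 : (⌊-L ^ 2⌋ : ℤ) ≤ ⌊L ^ 2⌋ := Int.floor_le_floor (by nlinarith)
    have h4 : ((A.image b).card : ℤ) ≤ ⌊L ^ 2⌋ + 1 - ⌊-L ^ 2⌋ := by omega
    have h5 : ((A.image b).card : ℝ) ≤ ⌊L ^ 2⌋ + 1 - ⌊-L ^ 2⌋ := by exact_mod_cast h4
    have h6 := Int.floor_le (L ^ 2)
    have h7 := Int.lt_floor_add_one (-L ^ 2)
    nlinarith
  have h1 := Finset.card_eq_sum_card_image b A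
  have h2 : (A.card : ℝ) = ∑ c ∈ A.image b, ((A.filter fun j => b j = c).card : ℝ) := by
    exact_mod_cast h1
  rw [h2]
  calc _ ≤ ∑ c ∈ A.image b, 40 * η * n / L := Finset.sum_le_sum hfib
    _ = (A.image b).card * (40 * η * n / L) := by rw [Finset.sum_const, nsmul_eq_mul]
    _ ≤ 4 * L ^ 2 * (40 * η * n / L) := by gcongr
    _ = _ := by field_simp; ring

/-- The kernel estimates are close to the mixture density and its derivative on `[-L, L]`. -/
def KernelClose (L δ η : ℝ) (ν x : Fin n → ℝ) : Prop :=
  ∀ z, |z| ≤ L → |fHat (1 / L) (fun i => ν i + x i) z - fZ ν z| ≤ δ * (fZ ν z + η) ∧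
    |fHat' (1 / L) (fun i => ν i + x i) z - fZderiv ν z| ≤ δ * (fZ ν z + η)

/-- The bound for the difference of the squared errors of the oracle and of the empirical rule. -/
noncomputable def comparisonError (δ l L η : ℝ) (x : Fin n → ℝ) (s N : ℝ) : ℝ :=
  ∑ i, (δ * (1 + x i ^ 2 + 2 * l) + δ ^ 2 + 4 * x i ^ 4 / L ^ 2)
    + 12 * L ^ 2 * (n * s + N + 160 * L * η * n)

lemma sum_sq_le_sum_sq_add {u v c : Fin n → ℝ} {D N : ℝ} (hD : 0 ≤ D)
    (bad : Finset (Fin n)) (hbad : (bad.card : ℝ) ≤ N)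
    (h1 : ∀ i ∉ bad, u i ^ 2 ≤ v i ^ 2 + c i) (h2 : ∀ i ∈ bad, u i ^ 2 ≤ c i + D) :
    ∑ i, u i ^ 2 ≤ ∑ i, v i ^ 2 + (∑ i, c i + D * N) := by
  classical
  calc ∑ i, u i ^ 2 ≤ ∑ i, (v i ^ 2 + c i + if i ∈ bad then D else 0) := by
        refine Finset.sum_le_sum fun i _ => ?_
        by_cases hi : i ∈ bad
        · rw [if_pos hi]
          have := h2 i hi
          have := sq_nonneg (v i)
          linarith
        · rw [if_neg hi]
          have := h1 i hi
          linarith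
    _ = ∑ i, v i ^ 2 + (∑ i, c i + D * bad.card) := by
        rw [Finset.sum_add_distrib, Finset.sum_add_distrib, Finset.sum_ite_mem, Finset.univ_inter,
          Finset.sum_const, nsmul_eq_mul]
        ring
    _ ≤ _ := by gcongr

/-- Large noise at a bad index is charged to the fourth moment, so the cost per bad index may be
taken as the constant `12 L²` although the bad set depends on the noise. -/
lemma sq_le_add_pow_four (x : ℝ) {L : ℝ} (hL : 0 < L) : x ^ 2 ≤ L ^ 2 + x ^ 4 / L ^ 2 := by
  have h : x ^ 4 / L ^ 2 * L ^ 2 = x ^ 4 := div_mul_cancel₀ _ (by positivity)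
  have h2 : 0 < L ^ 2 := by positivity
  have h3 : 0 ≤ x ^ 4 / L ^ 2 := by positivity
  nlinarith [sq_nonneg (x ^ 2 - L ^ 2)]

/-- A deterministic comparison of the empirical, oracle and regularised losses. Off the bad set the
last two rules coincide and the first is within `4 δ (1 + l)` of them. The number `s` will be the
indicator of the event on which the kernel estimates may fail. -/
theorem sum_sq_comparison (hn : 0 < n) {L δ η l s : ℝ} (hL : 1 ≤ L) (hLn : L = Real.log n)
    (hη : 0 < η) (hδ0 : 0 ≤ δ) (hδ : δ ≤ 1 / 4) (hl : 1 ≤ l)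
    (hlη : 2 * Real.log (1 / η) ≤ l ^ 2) (ν x : Fin n → ℝ) (hs : 0 ≤ s)
    (hclose : s < 1 → KernelClose L δ η ν x) :
    let a : Fin n → ℝ := fun i => x i + fHat' (1 / L) (fun i => ν i + x i) (ν i + x i)
      / fHat (1 / L) (fun i => ν i + x i) (ν i + x i)
    let b : Fin n → ℝ := fun i => x i + fZderiv ν (ν i + x i) / fZ ν (ν i + x i)
    let r : Fin n → ℝ := fun i => x i + regScore η ν (ν i + x i)
    let E := comparisonError (4 * δ * (1 + l)) l L η x s
      ((Finset.univ.filter fun i => L < |ν i + x i|).card)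
    ∑ i, a i ^ 2 ≤ ∑ i, r i ^ 2 + E ∧ ∑ i, b i ^ 2 ≤ ∑ i, r i ^ 2 + E ∧
      ∑ i, r i ^ 2 ≤ ∑ i, b i ^ 2 + E := by
  intro a b r E
  have hL0 : 0 < L := by linarith
  have hn' : (0 : ℝ) < n := by exact_mod_cast hn
  set Z : Fin n → ℝ := fun i => ν i + x i with hZ
  set d := 4 * δ * (1 + l) with hd
  have hd0 : 0 ≤ d := by positivity
  set c : Fin n → ℝ := fun i => d * (1 + x i ^ 2 + 2 * l) + d ^ 2 + 4 * x i ^ 4 / L ^ 2 with hc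
  have hc0 : ∀ i, 0 ≤ c i := fun i => by simp only [c]; positivity
  obtain ⟨bad, hbadE, hgood⟩ : ∃ bad : Finset (Fin n),
      (bad.card : ℝ) ≤ n * s + ((Finset.univ.filter fun i => L < |Z i|).card) + 160 * L * η * n ∧
      ∀ i ∉ bad, |Z i| ≤ L ∧ η ≤ fZ ν (Z i) ∧ KernelClose L δ η ν x := by
    by_cases hs1 : s < 1
    · have hcl := hclose hs1
      refine ⟨(Finset.univ.filter fun i => L < |Z i|) ∪
        (Finset.univ.filter fun i => |Z i| ≤ L ∧ fZ ν (Z i) < η), ?_, fun i hi => ?_⟩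
      · have h1 := card_low_density_le hL hη Z hn
          (Finset.univ.filter fun i => |Z i| ≤ L ∧ fZ ν (Z i) < η)
          (fun i hi => (Finset.mem_filter.1 hi).2.1) (fun i hi => by
            obtain ⟨-, h2, h3⟩ := Finset.mem_filter.1 hi
            -- From `f < η` and `δ ≤ 1/4`, closeness yields `fHat ≤ 2η`, the input of the counting
            -- lemma.
            have h4 := (abs_le.1 (hcl (Z i) h2).1).2
            have := fZ_nonneg ν (Z i)
            nlinarith)
        have h2 := Finset.card_union_le (Finset.univ.filter fun i => L < |Z i|)
          (Finset.univ.filter fun i => |Z i| ≤ L ∧ fZ ν (Z i) < η)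
        have h3 : (((Finset.univ.filter fun i => L < |Z i|) ∪
          (Finset.univ.filter fun i => |Z i| ≤ L ∧ fZ ν (Z i) < η)).card : ℝ) ≤
          ((Finset.univ.filter fun i => L < |Z i|).card : ℝ) +
          ((Finset.univ.filter fun i => |Z i| ≤ L ∧ fZ ν (Z i) < η).card : ℝ) := by
          exact_mod_cast h2
        have : 0 ≤ n * s := by positivity
        linarith
      · simp only [Finset.mem_union, Finset.mem_filter, Finset.mem_univ, true_and, not_or,
          not_lt, not_and] at hi
        exact ⟨hi.1, hi.2 hi.1, hcl⟩
    -- When the kernel estimates may fail, every index is declared bad; the term `n s` pays for all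
    -- of them.
    · push Not at hs1
      refine ⟨Finset.univ, ?_, fun i hi => absurd (Finset.mem_univ i) hi⟩
      rw [Finset.card_univ, Fintype.card_fin]
      have h1 : (n : ℝ) ≤ n * s := le_mul_of_one_le_right hn'.le hs1
      have : 0 ≤ 160 * L * η * n := by positivity
      have : (0 : ℝ) ≤ ((Finset.univ.filter fun i => L < |Z i|).card) := by positivity
      linarith
  have hE : E = ∑ i, c i + 12 * L ^ 2 *
      (n * s + ((Finset.univ.filter fun i => L < |Z i|).card) + 160 * L * η * n) := rfl
  have hrb : ∀ i ∉ bad, r i = b i := fun i hi => by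
    simp only [r, b]; rw [regScore_eq (hgood i hi).2.1]
  have hL2 : L ≤ L ^ 2 := by nlinarith
  have hbound : ∀ i, 4 * x i ^ 2 + 8 * L ^ 2 ≤ c i + 12 * L ^ 2 := fun i => by
    have h1 := sq_le_add_pow_four (x i) hL0
    have h2 : 0 ≤ d * (1 + x i ^ 2 + 2 * l) + d ^ 2 := by positivity
    simp only [c]
    rw [mul_div_assoc]
    linarith
  -- All three rules obey the same crude bound: the oracle scores satisfy `s² ≤ 2 log n + x²` with
  -- `log n = L`, and the empirical score is at most `2/σ = 2L`.
  have hb2 : ∀ i, b i ^ 2 ≤ 4 * x i ^ 2 + 8 * L ^ 2 := fun i => by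
    have h1 := sq_score_le hn ν i (x i)
    rw [← hLn] at h1
    simp only [b]
    nlinarith [sq_nonneg (x i - fZderiv ν (ν i + x i) / fZ ν (ν i + x i))]
  have hr2 : ∀ i, r i ^ 2 ≤ 4 * x i ^ 2 + 8 * L ^ 2 := fun i => by
    have h1 := sq_score_le hn ν i (x i)
    have h2 := sq_regScore_le hn η ν (ν i + x i)
    rw [← hLn] at h1
    simp only [r]
    nlinarith [sq_nonneg (x i - regScore η ν (ν i + x i))]
  have ha2 : ∀ i, a i ^ 2 ≤ 4 * x i ^ 2 + 8 * L ^ 2 := fun i => by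
    have h1 := abs_empiricalScore_le hn (σ := 1 / L) (by positivity) Z (Z i)
    rw [one_div, inv_inv] at h1
    have h2 := sq_le_sq' (abs_le.1 h1).1 (abs_le.1 h1).2
    simp only [a]
    rw [one_div]
    nlinarith [sq_nonneg (x i - fHat' L⁻¹ Z (Z i) / fHat L⁻¹ Z (Z i)), sq_nonneg (x i)]
  refine ⟨?_, ?_, ?_⟩
  · rw [hE]
    refine sum_sq_le_sum_sq_add (by positivity) bad hbadE (fun i hi => ?_)
      (fun i _ => (ha2 i).trans (hbound i))
    obtain ⟨h1, h2, h3⟩ := hgood i hi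
    have hf : 0 < fZ ν (Z i) := hη.trans_le h2
    obtain ⟨k1, k2⟩ := h3 (Z i) h1
    have k3 : δ * (fZ ν (Z i) + η) ≤ 2 * δ * fZ ν (Z i) := by nlinarith
    have k4 := abs_empiricalScore_sub_le hf hδ (k1.trans k3) (k2.trans k3)
    have k5 : |fZderiv ν (Z i) / fZ ν (Z i)| ≤ l :=
      abs_le_of_sq_le_sq ((sq_score_le_of_le hn hη h2).trans hlη) (by linarith)
    rw [hrb i hi]
    set q := fZderiv ν (Z i) / fZ ν (Z i)
    set q' := fHat' (1 / L) Z (Z i) / fHat (1 / L) Z (Z i)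
    have k6 : |q' - q| ≤ d := k4.trans (by rw [hd]; gcongr)
    have k7 : |x i + q| ≤ 1 / 2 + x i ^ 2 / 2 + l := by
      refine (abs_add_le _ _).trans ?_
      have : |x i| ≤ 1 / 2 + x i ^ 2 / 2 := by
        rw [← sq_abs]; nlinarith [sq_nonneg (|x i| - 1)]
      linarith
    have k8 : (q' - q) * (x i + q) ≤ d * (1 / 2 + x i ^ 2 / 2 + l) := by
      refine (le_abs_self _).trans ?_
      rw [abs_mul]
      gcongr
    have k9 : (q' - q) ^ 2 ≤ d ^ 2 := by
      rw [← sq_abs]; gcongr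
    have k10 : 0 ≤ 4 * x i ^ 4 / L ^ 2 := by positivity
    show (x i + q') ^ 2 ≤ (x i + q) ^ 2 + (d * (1 + x i ^ 2 + 2 * l) + d ^ 2 + 4 * x i ^ 4 / L ^ 2)
    have e : (x i + q') ^ 2 = (x i + q) ^ 2 + 2 * ((q' - q) * (x i + q)) + (q' - q) ^ 2 := by ring
    rw [e]
    linarith
  · rw [hE]
    refine sum_sq_le_sum_sq_add (by positivity) bad hbadE (fun i hi => ?_)
      (fun i _ => (hb2 i).trans (hbound i))
    rw [hrb i hi]
    linarith [hc0 i]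
  · rw [hE]
    refine sum_sq_le_sum_sq_add (by positivity) bad hbadE (fun i hi => ?_)
      (fun i _ => (hr2 i).trans (hbound i))
    rw [hrb i hi]
    linarith [hc0 i]

end

/-! ### Stochastic error and bias of the kernel estimates. -/

section

variable {n : ℕ}

lemma fHat_sub_eq (σ : ℝ) (ν x : Fin n → ℝ) (z : ℝ) :
    fHat σ (fun i => ν i + x i) z - fZ ν z = deviation (scaledKernel σ) ν x z
      + (n : ℝ)⁻¹ * ∑ i, (smooth σ φ (z - ν i) - φ (z - ν i)) := by
  unfold fHat fZ deviation
  simp_rw [integral_scaledKernel_gauss, Finset.sum_sub_distrib, sub_sub]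
  ring

lemma fHat'_sub_eq {σ : ℝ} (hσ : 0 < σ) (ν x : Fin n → ℝ) (z : ℝ) :
    fHat' σ (fun i => ν i + x i) z - fZderiv ν z = deviation (scaledDeriv σ) ν x z
      + (n : ℝ)⁻¹ * ∑ i, (smooth σ phiDeriv (z - ν i) - phiDeriv (z - ν i)) := by
  unfold fHat' fZderiv deviation
  simp_rw [integral_scaledDeriv_gauss hσ, deriv_scaledKernel, Finset.sum_sub_distrib, sub_sub]
  ring

lemma abs_average_bias_le (hn : 0 < n) {δ c : ℝ} {g h : ℝ → ℝ}
    (hgh : ∀ x, |g x - h x| ≤ δ * φ x + c) (ν : Fin n → ℝ) (z : ℝ) :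
    |(n : ℝ)⁻¹ * ∑ i, (g (z - ν i) - h (z - ν i))| ≤ δ * fZ ν z + c := by
  have hn' : (0 : ℝ) < n := by exact_mod_cast hn
  rw [abs_mul, abs_of_pos (inv_pos.2 hn'), inv_mul_le_iff₀ hn']
  calc _ ≤ ∑ i, (δ * φ (z - ν i) + c) := (Finset.abs_sum_le_sum_abs _ _).trans
        (Finset.sum_le_sum fun i _ => hgh _)
    _ = _ := by
      unfold fZ
      rw [Finset.sum_add_distrib, ← Finset.mul_sum]
      simp
      field_simp

end

section

variable {Ω : ℕ → Type*} [∀ n, MeasurableSpace (Ω n)] {P : ∀ n, Measure (Ω n)}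
  [∀ n, IsProbabilityMeasure (P n)] {μ ε : ∀ n, Ω n → Fin n → ℝ}
  {t : ∀ n, (Fin n → ℝ) → Fin n → ℝ} {ρ : ℕ → ℝ≥0} {R : ℝ}

/-- Deviation and bias each leave an absolute error `L^(-25)`, one power below `η = L^(-24)`; what
remains of the bias is relative to the density. -/
lemma eventually_kernelClose (h : ∀ n, IsModel (P n) (μ n) (ε n))
    (ht : ∀ n, IsFilter (t n) ρ R) :
    ∀ᶠ n : ℕ in atTop, ∃ S : Set (Ω n), MeasurableSet S ∧
      (P n).real S ≤ 2 * (Real.log n ^ 25)⁻¹ ∧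
      ∀ ω ∉ S, KernelClose (Real.log n) (Real.log n ^ (-(1 / 4) : ℝ)) (Real.log n ^ 24)⁻¹
        (nuFun (t n) (μ n ω) (ε n ω)) (ε n ω) := by
  have k1 := eventually_exists_deviation h ht (ψ := fun L => scaledKernel (1 / L))
    (fun L hL x => by
      have hσ : 0 < 1 / L := by positivity
      rw [abs_of_pos (scaledKernel_pos hσ x)]
      refine (scaledKernel_le hσ x).trans ?_
      rw [one_div, inv_inv]; nlinarith)
    (fun L hL x y => by
      have hσ : 0 < 1 / L := by positivity
      refine (scaledKernel_lipschitz hσ x y).trans ?_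
      rw [one_div, inv_inv]
      gcongr
      have : L ^ 2 ≤ L ^ 3 := pow_le_pow_right₀ hL (by norm_num)
      nlinarith [sq_nonneg L]) 25
  have k2 := eventually_exists_deviation h ht (ψ := fun L => scaledDeriv (1 / L))
    (fun L hL x => by
      have hσ : 0 < 1 / L := by positivity
      refine (abs_scaledDeriv_le' hσ x).trans ?_
      rw [one_div, inv_inv])
    (fun L hL x y => by
      have hσ : 0 < 1 / L := by positivity
      refine (scaledDeriv_lipschitz hσ x y).trans ?_
      rw [one_div, inv_inv]) 25
  filter_upwards [k1, k2, eventually_gt_atTop 0,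
    tendsto_log_natCast.eventually (eventually_abs_smooth_phi_sub_le 25),
    tendsto_log_natCast.eventually (eventually_abs_smooth_phiDeriv_sub_le 25),
    tendsto_log_natCast.eventually_ge_atTop 4] with n ⟨S₁, hS₁, p₁, d₁⟩ ⟨S₂, hS₂, p₂, d₂⟩ hn b₁ b₂ hL
  set L := Real.log n
  have hL0 : 0 < L := by linarith
  refine ⟨S₁ ∪ S₂, hS₁.union hS₂, ?_, fun ω hω z hz => ?_⟩
  · have := measureReal_union_le (μ := P n) S₁ S₂
    linarith
  · rw [Set.mem_union, not_or] at hω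
    -- The two absolute errors must fit into `δ η`; already `2/L ≤ L^(-1/2)` holds for `L ≥ 4`.
    have hδ : 2 * (L ^ 25)⁻¹ ≤ L ^ (-(1 / 4) : ℝ) * (L ^ 24)⁻¹ := by
      have h1 : L ^ (-(1 / 2) : ℝ) ≤ L ^ (-(1 / 4) : ℝ) :=
        Real.rpow_le_rpow_of_exponent_le (by linarith) (by norm_num)
      have h2 : L ^ (-(1 / 2) : ℝ) = (√L)⁻¹ := by rw [Real.rpow_neg hL0.le, Real.sqrt_eq_rpow]
      have h3 : 2 ≤ √L := Real.le_sqrt_of_sq_le (by linarith)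
      have h4 : √L * √L = L := Real.mul_self_sqrt hL0.le
      have h5 : 2 * L⁻¹ ≤ (√L)⁻¹ := by
        rw [← div_eq_mul_inv, div_le_iff₀ hL0, le_inv_mul_iff₀ (by linarith)]
        nlinarith
      have h6 : (L ^ 25)⁻¹ = L⁻¹ * (L ^ 24)⁻¹ := by rw [← mul_inv]; ring
      rw [h6, ← mul_assoc]
      gcongr
      linarith
    constructor
    · rw [fHat_sub_eq]
      refine (abs_add_le _ _).trans ?_
      have e1 := d₁ ω hω.1 z hz
      have e2 := abs_average_bias_le hn b₁ (nuFun (t n) (μ n ω) (ε n ω)) z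
      linarith
    · rw [fHat'_sub_eq (by positivity)]
      refine (abs_add_le _ _).trans ?_
      have e1 := d₂ ω hω.2 z hz
      have e2 := abs_average_bias_le hn b₂ (nuFun (t n) (μ n ω) (ε n ω)) z
      linarith

end

/-! ### From pointwise loss bounds to bounds for the risks. -/

section

set_option linter.unusedSectionVars false

variable {n : ℕ} {Ω : Type*} [MeasurableSpace Ω] {P : Measure Ω} [IsProbabilityMeasure P]
  {μ ε : Ω → Fin n → ℝ} {t : (Fin n → ℝ) → Fin n → ℝ} {ρ : ℕ → ℝ≥0} {R : ℝ}

lemma resid_eq (μ ε : Ω → Fin n → ℝ) (t : (Fin n → ℝ) → Fin n → ℝ) (ω : Ω) :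
    resid μ ε t ω = fun i => nuFun t (μ ω) (ε ω) i + ε ω i := by
  ext i
  have e : (fun j => μ ω j + ε ω j) = obs μ ε ω := rfl
  simp only [resid, nuFun, e]
  simp only [obs]
  ring

lemma IsModel.measurable_nu_apply (h : IsModel P μ ε) (ht : IsFilter t ρ R) (i : Fin n) :
    Measurable fun ω => nuFun t (μ ω) (ε ω) i :=
  (measurable_pi_apply i).comp (h.measurable_nu ht)

lemma IsModel.measurable_resid (h : IsModel P μ ε) (ht : IsFilter t ρ R) (i : Fin n) :
    Measurable fun ω => nuFun t (μ ω) (ε ω) i + ε ω i :=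
  (h.measurable_nu_apply ht i).add (h.measurable_eps_apply i)

lemma IsModel.measurableSet_large (h : IsModel P μ ε) (ht : IsFilter t ρ R) (L : ℝ) (i : Fin n) :
    MeasurableSet {ω | L < |nuFun t (μ ω) (ε ω) i + ε ω i|} :=
  measurableSet_lt measurable_const (h.measurable_resid ht i).norm

lemma card_large_eq (L : ℝ) (Z : Ω → Fin n → ℝ) (ω : Ω) :
    ((Finset.univ.filter fun i => L < |Z ω i|).card : ℝ)
      = ∑ i, {ω | L < |Z ω i|}.indicator (fun _ => (1 : ℝ)) ω := by
  rw [Finset.card_filter]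
  push_cast
  refine Finset.sum_congr rfl fun i _ => ?_
  by_cases hi : L < |Z ω i|
  · rw [if_pos hi, Set.indicator_of_mem (by exact hi)]
  · rw [if_neg hi, Set.indicator_of_notMem (by exact hi)]

lemma IsModel.integral_comparisonError (h : IsModel P μ ε) (ht : IsFilter t ρ R)
    {S : Set Ω} (hS : MeasurableSet S) (d l L η : ℝ) :
    Integrable (fun ω => comparisonError d l L η (ε ω) (S.indicator (fun _ => 1) ω)
      ((Finset.univ.filter fun i => L < |nuFun t (μ ω) (ε ω) i + ε ω i|).card)) P ∧
    ∫ ω, comparisonError d l L η (ε ω) (S.indicator (fun _ => 1) ω)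
      ((Finset.univ.filter fun i => L < |nuFun t (μ ω) (ε ω) i + ε ω i|).card) ∂P
      = n * (d * (2 + 2 * l) + d ^ 2 + 4 * fourthMoment / L ^ 2)
        + 12 * L ^ 2 * (n * P.real S
          + ∑ i, P.real {ω | L < |nuFun t (μ ω) (ε ω) i + ε ω i|} + 160 * L * η * n) := by
  have e : ∀ ω, comparisonError d l L η (ε ω) (S.indicator (fun _ => 1) ω)
      ((Finset.univ.filter fun i => L < |nuFun t (μ ω) (ε ω) i + ε ω i|).card)
      = ∑ i, (d * ε ω i ^ 2 + 4 / L ^ 2 * ε ω i ^ 4 + (d * (1 + 2 * l) + d ^ 2))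
        + 12 * L ^ 2 * (n * S.indicator (fun _ => 1) ω
          + ∑ i, {ω | L < |nuFun t (μ ω) (ε ω) i + ε ω i|}.indicator (fun _ => (1 : ℝ)) ω
          + 160 * L * η * n) := fun ω => by
    unfold comparisonError
    rw [card_large_eq L (fun ω i => nuFun t (μ ω) (ε ω) i + ε ω i)]
    congr 1
    exact Finset.sum_congr rfl fun i _ => by ring
  simp_rw [e]
  have i1 : ∀ i, Integrable (fun ω => d * ε ω i ^ 2 + 4 / L ^ 2 * ε ω i ^ 4
      + (d * (1 + 2 * l) + d ^ 2)) P := fun i =>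
    (((h.integrable_eps_pow i 2).const_mul _).add ((h.integrable_eps_pow i 4).const_mul _)).add
      (integrable_const _)
  have i2 : Integrable (fun ω => (n : ℝ) * S.indicator (fun _ => (1 : ℝ)) ω) P :=
    ((integrable_const (1 : ℝ)).indicator hS).const_mul _
  have i3 : ∀ i, Integrable
      (fun ω => {ω | L < |nuFun t (μ ω) (ε ω) i + ε ω i|}.indicator (fun _ => (1 : ℝ)) ω) P :=
    fun i => (integrable_const (1 : ℝ)).indicator (h.measurableSet_large ht L i)
  have i4 : Integrable (fun ω => ∑ i, {ω | L < |nuFun t (μ ω) (ε ω) i + ε ω i|}.indicator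
      (fun _ => (1 : ℝ)) ω) P := integrable_finsetSum _ fun i _ => i3 i
  have i5 : Integrable (fun ω => (n : ℝ) * S.indicator (fun _ => (1 : ℝ)) ω
      + ∑ i, {ω | L < |nuFun t (μ ω) (ε ω) i + ε ω i|}.indicator (fun _ => (1 : ℝ)) ω) P :=
    i2.add i4
  have i6 : Integrable (fun ω => 12 * L ^ 2 * ((n : ℝ) * S.indicator (fun _ => (1 : ℝ)) ω
      + ∑ i, {ω | L < |nuFun t (μ ω) (ε ω) i + ε ω i|}.indicator (fun _ => (1 : ℝ)) ω
      + 160 * L * η * n)) P := (i5.add (integrable_const _)).const_mul _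
  have i7 := integrable_finsetSum Finset.univ fun i _ => i1 i
  refine ⟨i7.add i6, ?_⟩
  rw [integral_add i7 i6, integral_finsetSum _ fun i _ => i1 i, integral_const_mul,
    integral_add i5 (integrable_const _), integral_add i2 i4, integral_finsetSum _ fun i _ => i3 i,
    integral_const_mul, integral_indicator_const _ hS]
  have e1 : ∀ i, ∫ ω, {ω | L < |nuFun t (μ ω) (ε ω) i + ε ω i|}.indicator (fun _ => (1 : ℝ)) ω ∂P
      = P.real {ω | L < |nuFun t (μ ω) (ε ω) i + ε ω i|} := fun i => by
    rw [integral_indicator_const _ (h.measurableSet_large ht L i)]; simp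
  have e2 : ∀ i, ∫ ω, (d * ε ω i ^ 2 + 4 / L ^ 2 * ε ω i ^ 4 + (d * (1 + 2 * l) + d ^ 2)) ∂P
      = d * (2 + 2 * l) + d ^ 2 + 4 * fourthMoment / L ^ 2 := fun i => by
    have j1 := (h.integrable_eps_pow i 2).const_mul d
    have j2 := (h.integrable_eps_pow i 4).const_mul (4 / L ^ 2)
    have j3 : Integrable (fun ω => d * ε ω i ^ 2 + 4 / L ^ 2 * ε ω i ^ 4) P := j1.add j2
    rw [integral_add j3 (integrable_const _), integral_add j1 j2, integral_const_mul,
      integral_const_mul, h.integral_eps_sq, h.integral_eps_four]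
    simp
    ring
  simp_rw [e1, e2]
  simp
  ring

/-- The risk of the regularised oracle. -/
noncomputable def regRisk (P : Measure Ω) (μ ε : Ω → Fin n → ℝ) (t : (Fin n → ℝ) → Fin n → ℝ)
    (η : ℝ) : ℝ :=
  ∫ ω, ∑ i, (ε ω i + regScore η (nuFun t (μ ω) (ε ω)) (nuFun t (μ ω) (ε ω) i + ε ω i)) ^ 2 ∂P

lemma IsModel.measurable_regScore (h : IsModel P μ ε) (ht : IsFilter t ρ R) (η : ℝ) (i : Fin n) :
    Measurable fun ω =>
      regScore η (nuFun t (μ ω) (ε ω)) (nuFun t (μ ω) (ε ω) i + ε ω i) := by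
  have h1 : Measurable fun ω => (nuFun t (μ ω) (ε ω), nuFun t (μ ω) (ε ω) i + ε ω i) :=
    (h.measurable_nu ht).prodMk (h.measurable_resid ht i)
  have h2 := (EBFilter.measurable_regScore (n := n) η).comp h1
  simpa only [Function.comp_def] using h2

lemma IsModel.integrable_sq_regScore (h : IsModel P μ ε) (ht : IsFilter t ρ R) {η : ℝ} (hη : 0 < η)
    (i : Fin n) : Integrable (fun ω =>
      (ε ω i + regScore η (nuFun t (μ ω) (ε ω)) (nuFun t (μ ω) (ε ω) i + ε ω i)) ^ 2) P := by
  have hm := ((h.measurable_eps_apply i).add (h.measurable_regScore ht η i)).pow_const 2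
  refine (((h.integrable_eps_pow i 2).const_mul 2).add
    (integrable_const (2 * η⁻¹ ^ 2))).mono' hm.aestronglyMeasurable (ae_of_all _ fun ω => ?_)
  rw [Real.norm_of_nonneg (sq_nonneg _)]
  have h1 := abs_regScore_le hη (nuFun t (μ ω) (ε ω)) (nuFun t (μ ω) (ε ω) i + ε ω i)
  have h2 := sq_le_sq' (abs_le.1 h1).1 (abs_le.1 h1).2
  simp only [Pi.add_apply]
  nlinarith [sq_nonneg (ε ω i - regScore η (nuFun t (μ ω) (ε ω))
    (nuFun t (μ ω) (ε ω) i + ε ω i))]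

/-- The upper loss `A` enters only through monotonicity, so no measurability or integrability of it
is required; the next lemma is arranged in the same way. -/
lemma lintegral_ofReal_le_of_le_add {A B E : Ω → ℝ} (hB : Integrable B P) (hE : Integrable E P)
    (hB0 : ∀ ω, 0 ≤ B ω) (hE0 : ∀ ω, 0 ≤ E ω) (hle : ∀ ω, A ω ≤ B ω + E ω) {c : ℝ}
    (hc : ∫ ω, E ω ∂P ≤ c) :
    ∫⁻ ω, ENNReal.ofReal (A ω) ∂P ≤ ENNReal.ofReal (∫ ω, B ω ∂P + c) := by
  calc _ ≤ ∫⁻ ω, ENNReal.ofReal (B ω + E ω) ∂P :=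
        lintegral_mono fun ω => ENNReal.ofReal_le_ofReal (hle ω)
    _ = ENNReal.ofReal (∫ ω, (B ω + E ω) ∂P) :=
        (ofReal_integral_eq_lintegral_ofReal (hB.add hE)
          (ae_of_all _ fun ω => add_nonneg (hB0 ω) (hE0 ω))).symm
    _ ≤ _ := by
        rw [integral_add hB hE]
        gcongr

lemma ofReal_integral_le_of_le_add {A B E : Ω → ℝ} (hB : Integrable B P) (hE : Integrable E P)
    (hB0 : ∀ ω, 0 ≤ B ω) (hA0 : ∀ ω, 0 ≤ A ω) (hE0 : ∀ ω, 0 ≤ E ω)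
    (hle : ∀ ω, B ω ≤ A ω + E ω) {c : ℝ} (hc : ∫ ω, E ω ∂P ≤ c) :
    ENNReal.ofReal (∫ ω, B ω ∂P) ≤ ∫⁻ ω, ENNReal.ofReal (A ω) ∂P + ENNReal.ofReal c := by
  calc _ = ∫⁻ ω, ENNReal.ofReal (B ω) ∂P :=
        ofReal_integral_eq_lintegral_ofReal hB (ae_of_all _ hB0)
    _ ≤ ∫⁻ ω, (ENNReal.ofReal (A ω) + ENNReal.ofReal (E ω)) ∂P := lintegral_mono fun ω => by
        rw [← ENNReal.ofReal_add (hA0 ω) (hE0 ω)]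
        exact ENNReal.ofReal_le_ofReal (hle ω)
    _ = ∫⁻ ω, ENNReal.ofReal (A ω) ∂P + ∫⁻ ω, ENNReal.ofReal (E ω) ∂P :=
        lintegral_add_right' _ hE.aemeasurable.ennreal_ofReal
    _ ≤ _ := by
        gcongr
        rw [← ofReal_integral_eq_lintegral_ofReal hE (ae_of_all _ hE0)]
        exact ENNReal.ofReal_le_ofReal hc

end

/-- A bad index costs `12 L²`. The fractions of bad indices are at most `2 L^(-25)` from the
exceptional event, `L^(-8)` from Assumption 3 and `160 L^(-23)` from low density, all far below
`L^(-2)`. -/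
lemma tendsto_comparison_rate : Tendsto (fun L : ℝ =>
    4 * L ^ (-(1 / 4) : ℝ) * (1 + (1 + 48 * Real.log L)) * (2 + 2 * (1 + 48 * Real.log L))
      + (4 * L ^ (-(1 / 4) : ℝ) * (1 + (1 + 48 * Real.log L))) ^ 2 + 4 * fourthMoment / L ^ 2
      + 12 * L ^ 2 * (2 * (L ^ 25)⁻¹ + 1 / L ^ 8 + 160 * L * (L ^ 24)⁻¹)) atTop (𝓝 0) := by
  have t0 := tendsto_log_pow_mul_rpow 0 (r := 1 / 4) (by norm_num)
  have t1 := tendsto_log_pow_mul_rpow 1 (r := 1 / 4) (by norm_num)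
  have t2 := tendsto_log_pow_mul_rpow 2 (r := 1 / 4) (by norm_num)
  simp only [pow_zero, pow_one, one_mul] at t0 t1
  have u : Tendsto (fun L : ℝ => L⁻¹) atTop (𝓝 0) := tendsto_inv_atTop_zero
  have T := (((t0.const_mul 32).add ((t1.const_mul 1536).add (t2.const_mul 18432))).add
    (((t0.const_mul 8).add (t1.const_mul 192)).pow 2)).add
    (((u.pow 2).const_mul (4 * fourthMoment)).add (((u.pow 23).const_mul 24).add
      (((u.pow 6).const_mul 12).add ((u.pow 21).const_mul 1920))))
  simp only [mul_zero, add_zero, ne_eq, OfNat.ofNat_ne_zero, not_false_eq_true, zero_pow] at T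
  refine T.congr' ?_
  filter_upwards [eventually_gt_atTop 0] with L hL
  have e1 : (12 : ℝ) * L ^ 2 * (2 * (L ^ 25)⁻¹ + 1 / L ^ 8 + 160 * L * (L ^ 24)⁻¹)
      = 24 * L⁻¹ ^ 23 + (12 * L⁻¹ ^ 6 + 1920 * L⁻¹ ^ 21) := by
    field_simp
    ring
  have e2 : 4 * fourthMoment / L ^ 2 = 4 * fourthMoment * L⁻¹ ^ 2 := by field_simp
  rw [e1, e2]
  ring

section

variable {Ω : ℕ → Type*} [∀ n, MeasurableSpace (Ω n)] {P : ∀ n, Measure (Ω n)}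
  [∀ n, IsProbabilityMeasure (P n)] {μ ε : ∀ n, Ω n → Fin n → ℝ}
  {t : ∀ n, (Fin n → ℝ) → Fin n → ℝ} {ρ : ℕ → ℝ≥0} {R : ℝ}

/-- `sum_sq_comparison` integrated. The empirical rule needs only an upper bound by the regularised
risk; for the oracle both directions are recorded, since part (i) uses it once as an upper and once
as a lower bound. -/
theorem eventually_risk_comparison (h : ∀ n, IsModel (P n) (μ n) (ε n))
    (ht : ∀ n, IsFilter (t n) ρ R) (h3 : Assumption3 P μ ε t) {θ : ℝ} (hθ : 0 < θ) :
    ∀ᶠ n : ℕ in atTop,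
      risk (P n) (ebEstimator (μ n) (ε n) (t n)) (μ n)
        ≤ ENNReal.ofReal (regRisk (P n) (μ n) (ε n) (t n) (Real.log n ^ 24)⁻¹ + θ * n) ∧
      risk (P n) (oracle (μ n) (ε n) (t n)) (μ n)
        ≤ ENNReal.ofReal (regRisk (P n) (μ n) (ε n) (t n) (Real.log n ^ 24)⁻¹ + θ * n) ∧
      ENNReal.ofReal (regRisk (P n) (μ n) (ε n) (t n) (Real.log n ^ 24)⁻¹)
        ≤ risk (P n) (oracle (μ n) (ε n) (t n)) (μ n) + ENNReal.ofReal (θ * n) := by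
  have t0 := tendsto_log_pow_mul_rpow 0 (r := 1 / 4) (by norm_num)
  simp only [pow_zero, one_mul] at t0
  filter_upwards [eventually_kernelClose h ht, h3, eventually_gt_atTop 0,
    tendsto_log_natCast.eventually ((tendsto_order.1 tendsto_comparison_rate).2 θ hθ),
    tendsto_log_natCast.eventually ((tendsto_order.1 t0).2 (1 / 4) (by norm_num)),
    tendsto_log_natCast.eventually_ge_atTop 1] with n ⟨S, hS, hS1, hS2⟩ h3n hn hrate hδ hL
  have hn' : (0 : ℝ) < n := by exact_mod_cast hn
  obtain ⟨L, hLdef⟩ : ∃ L, L = Real.log n := ⟨_, rfl⟩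
  rw [← hLdef] at hS1 hS2 h3n hrate hδ hL ⊢
  have hL0 : 0 < L := by linarith
  set η := (L ^ 24)⁻¹ with hη
  have hη0 : 0 < η := by positivity
  set δ := L ^ (-(1 / 4) : ℝ) with hδdef
  have hδ0 : 0 ≤ δ := by positivity
  -- Where `f_Z ≥ η = L^(-24)` the squared score is at most `2 log (1/η) = 48 log L`, which is below
  -- `l²`.
  set l := 1 + 48 * Real.log L with hl
  have hlog : 0 ≤ Real.log L := Real.log_nonneg hL
  have hl1 : 1 ≤ l := by linarith
  have hlη : 2 * Real.log (1 / η) ≤ l ^ 2 := by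
    rw [hη, one_div, inv_inv, Real.log_pow]
    push_cast
    nlinarith
  set E : Ω n → ℝ := fun ω => comparisonError (4 * δ * (1 + l)) l L η (ε n ω)
    (S.indicator (fun _ => 1) ω)
    ((Finset.univ.filter fun i => L < |nuFun (t n) (μ n ω) (ε n ω) i + ε n ω i|).card) with hE
  obtain ⟨hEi, hEint⟩ := (h n).integral_comparisonError (ht n) hS (4 * δ * (1 + l)) l L η
  have hE0 : ∀ ω, 0 ≤ E ω := fun ω => by
    have h1 : 0 ≤ S.indicator (fun _ => (1 : ℝ)) ω := Set.indicator_nonneg (by simp) ω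
    simp only [E, comparisonError]
    have h2 : ∀ i, 0 ≤ 4 * δ * (1 + l) * (1 + ε n ω i ^ 2 + 2 * l) + (4 * δ * (1 + l)) ^ 2
      + 4 * ε n ω i ^ 4 / L ^ 2 := fun i => by positivity
    have h3 := Finset.sum_nonneg fun i (_ : i ∈ Finset.univ) => h2 i
    positivity
  have hEle : ∫ ω, E ω ∂(P n) ≤ θ * n := by
    simp only [E]
    rw [hEint]
    have h4 : ∑ i, (P n).real {ω | L < |nuFun (t n) (μ n ω) (ε n ω) i + ε n ω i|}
        ≤ n * (1 / L ^ 8) := by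
      rw [inv_mul_le_iff₀ hn'] at h3n
      simpa only [resid_eq] using h3n
    calc _ ≤ n * (4 * δ * (1 + l) * (2 + 2 * l) + (4 * δ * (1 + l)) ^ 2 + 4 * fourthMoment / L ^ 2)
          + 12 * L ^ 2 * (n * (2 * (L ^ 25)⁻¹) + n * (1 / L ^ 8) + 160 * L * η * n) := by gcongr
      _ = (4 * δ * (1 + l) * (2 + 2 * l) + (4 * δ * (1 + l)) ^ 2 + 4 * fourthMoment / L ^ 2
          + 12 * L ^ 2 * (2 * (L ^ 25)⁻¹ + 1 / L ^ 8 + 160 * L * η)) * n := by ring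
      _ ≤ θ * n := by gcongr
  have hri : Integrable (fun ω => ∑ i, (ε n ω i + regScore η (nuFun (t n) (μ n ω) (ε n ω))
      (nuFun (t n) (μ n ω) (ε n ω) i + ε n ω i)) ^ 2) (P n) :=
    integrable_finsetSum _ fun i _ => (h n).integrable_sq_regScore (ht n) hη0 i
  have hr0 : ∀ ω, 0 ≤ ∑ i, (ε n ω i + regScore η (nuFun (t n) (μ n ω) (ε n ω))
      (nuFun (t n) (μ n ω) (ε n ω) i + ε n ω i)) ^ 2 :=
    fun ω => Finset.sum_nonneg fun _ _ => sq_nonneg _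
  have hcmp := fun ω => sum_sq_comparison hn hL hLdef hη0 hδ0 hδ.le hl1 hlη
    (nuFun (t n) (μ n ω) (ε n ω)) (ε n ω) (s := S.indicator (fun _ => (1 : ℝ)) ω)
    (Set.indicator_nonneg (by simp) ω) (fun hs => hS2 ω fun hω => by
      rw [Set.indicator_of_mem hω] at hs
      exact lt_irrefl _ hs)
  have hor : ∀ ω, ∑ i, (oracle (μ n) (ε n) (t n) ω i - μ n ω i) ^ 2
      = ∑ i, (ε n ω i + fZderiv (nuFun (t n) (μ n ω) (ε n ω))
        (nuFun (t n) (μ n ω) (ε n ω) i + ε n ω i) / fZ (nuFun (t n) (μ n ω) (ε n ω))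
        (nuFun (t n) (μ n ω) (ε n ω) i + ε n ω i)) ^ 2 := fun ω => by
    refine Finset.sum_congr rfl fun i _ => ?_
    have e1 : nu (μ n) (ε n) (t n) ω = nuFun (t n) (μ n ω) (ε n ω) := rfl
    simp only [oracle, oracleRule, resid_eq, e1, deriv_fZ]
    have e2 : nuFun (t n) (μ n ω) (ε n ω) i = μ n ω i - t n (obs (μ n) (ε n) ω) i := rfl
    congr 1
    linear_combination e2
  have heb : ∀ ω, ∑ i, (ebEstimator (μ n) (ε n) (t n) ω i - μ n ω i) ^ 2
      = ∑ i, (ε n ω i + fHat' (1 / L) (fun i => nuFun (t n) (μ n ω) (ε n ω) i + ε n ω i)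
        (nuFun (t n) (μ n ω) (ε n ω) i + ε n ω i)
        / fHat (1 / L) (fun i => nuFun (t n) (μ n ω) (ε n ω) i + ε n ω i)
        (nuFun (t n) (μ n ω) (ε n ω) i + ε n ω i)) ^ 2 := fun ω => by
    refine Finset.sum_congr rfl fun i _ => ?_
    simp only [ebEstimator, ebRule, resid_eq, ← hLdef]
    have e2 : nuFun (t n) (μ n ω) (ε n ω) i = μ n ω i - t n (obs (μ n) (ε n) ω) i := rfl
    congr 1
    linear_combination e2
  refine ⟨?_, ?_, ?_⟩
  · unfold risk
    simp_rw [heb]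
    exact lintegral_ofReal_le_of_le_add hri hEi hr0 hE0 (fun ω => (hcmp ω).1) hEle
  · unfold risk
    simp_rw [hor]
    exact lintegral_ofReal_le_of_le_add hri hEi hr0 hE0 (fun ω => (hcmp ω).2.1) hEle
  · unfold risk
    simp_rw [hor]
    exact ofReal_integral_le_of_le_add hri hEi hr0
      (fun ω => Finset.sum_nonneg fun _ _ => sq_nonneg _) hE0 (fun ω => (hcmp ω).2.2) hEle

end

/-! ### The risk of the regularised oracle -/

section

variable {n : ℕ}

lemma integrable_mul_phi_sub {s : ℝ → ℝ} (hs : Measurable s) {C : ℝ} (hC : ∀ z, |s z| ≤ C) (v : ℝ) :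
    Integrable fun z => s z * φ (z - v) :=
  (integrable_phi_sub v).bdd_mul hs.aestronglyMeasurable (ae_of_all _ hC)

lemma integrable_mul_phiDeriv_sub {s : ℝ → ℝ} (hs : Measurable s) {C : ℝ} (hC : ∀ z, |s z| ≤ C)
    (v : ℝ) : Integrable fun z => s z * phiDeriv (z - v) :=
  (integrable_phiDeriv_sub v).bdd_mul hs.aestronglyMeasurable (ae_of_all _ hC)

/-- Stein's identity with the derivative left on the density, `e φ e = -φ' e`, so that `s` need not
be differentiable. -/
lemma integral_mul_gauss_add (s : ℝ → ℝ) (v : ℝ) :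
    ∫ e, e * s (v + e) ∂γ = -∫ z, s z * phiDeriv (z - v) := by
  have h := integral_gauss_add (fun z => (z - v) * s z) v
  simp only [add_sub_cancel_left] at h
  rw [h, ← integral_neg]
  refine integral_congr_ae (ae_of_all _ fun z => ?_)
  simp only [phiDeriv]
  ring

lemma integrable_mul_gauss_add {s : ℝ → ℝ} (hs : Measurable s) {C : ℝ} (hC : ∀ z, |s z| ≤ C)
    (v : ℝ) : Integrable (fun e => e * s (v + e)) γ :=
  (by simpa using integrable_pow_gauss 1 : Integrable (fun e : ℝ => e) γ).mul_bdd (c := C)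
    (hs.comp (measurable_const_add v)).aestronglyMeasurable (ae_of_all _ fun _ => hC _)

lemma integrable_gauss_add {s : ℝ → ℝ} (hs : Measurable s) {C : ℝ} (hC : ∀ z, |s z| ≤ C)
    (v : ℝ) : Integrable (fun e => s (v + e)) γ :=
  (integrable_const C).mono' (hs.comp (measurable_const_add v)).aestronglyMeasurable
    (ae_of_all _ fun _ => hC _)

lemma abs_sq_le {s : ℝ → ℝ} {C : ℝ} (hC : ∀ z, |s z| ≤ C) (z : ℝ) : |s z ^ 2| ≤ C ^ 2 := by
  rw [abs_pow]
  exact pow_le_pow_left₀ (abs_nonneg _) (hC z) 2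

lemma integral_sq_gauss_add {s : ℝ → ℝ} (hs : Measurable s) {C : ℝ} (hC : ∀ z, |s z| ≤ C)
    (v : ℝ) : ∫ e, (e + s (v + e)) ^ 2 ∂γ
      = 1 + ∫ z, (-2 * (s z * phiDeriv (z - v)) + s z ^ 2 * φ (z - v)) := by
  have i1 := integrable_pow_gauss 2
  have i2 := (integrable_mul_gauss_add hs hC v).const_mul 2
  have i3 := integrable_gauss_add (hs.pow_const 2) (abs_sq_le hC) v
  have i4 : Integrable (fun e => e ^ 2 + 2 * (e * s (v + e))) γ := i1.add i2
  have e : ∀ e, (e + s (v + e)) ^ 2 = e ^ 2 + 2 * (e * s (v + e)) + s (v + e) ^ 2 := fun e => by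
    ring
  simp_rw [e]
  rw [integral_add i4 i3, integral_add i1 i2, integral_sq_gauss, integral_const_mul,
    integral_mul_gauss_add, integral_gauss_add (fun z => s z ^ 2),
    integral_add ((integrable_mul_phiDeriv_sub hs hC v).const_mul _)
      (integrable_mul_phi_sub (hs.pow_const 2) (abs_sq_le hC) v), integral_const_mul]
  ring

/-- The part of the mixture density that comes from the indices in `I`. -/
noncomputable def fPart (I : Finset (Fin n)) (ν : Fin n → ℝ) (z : ℝ) : ℝ :=
  (n : ℝ)⁻¹ * ∑ i ∈ I, φ (z - ν i)

/-- The derivative of the part of the mixture density that comes from the indices in `I`. -/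
noncomputable def fPartDeriv (I : Finset (Fin n)) (ν : Fin n → ℝ) (z : ℝ) : ℝ :=
  (n : ℝ)⁻¹ * ∑ i ∈ I, phiDeriv (z - ν i)

/-- The part from `I` of the excess risk of the rule `z ↦ z + s z` over the rule `z ↦ z`. -/
noncomputable def gain (I : Finset (Fin n)) (ν : Fin n → ℝ) (s : ℝ → ℝ) : ℝ :=
  ∫ z, (-2 * (s z * fPartDeriv I ν z) + s z ^ 2 * fPart I ν z)

lemma integrable_mul_fPart (I : Finset (Fin n)) (ν : Fin n → ℝ) {s : ℝ → ℝ} (hs : Measurable s)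
    {C : ℝ} (hC : ∀ z, |s z| ≤ C) : Integrable fun z => s z * fPart I ν z := by
  have e : ∀ z, s z * fPart I ν z = (n : ℝ)⁻¹ * ∑ i ∈ I, s z * φ (z - ν i) := fun z => by
    rw [fPart, ← Finset.mul_sum]; ring
  simp_rw [e]
  exact (integrable_finsetSum _ fun i _ => integrable_mul_phi_sub hs hC _).const_mul _

lemma integrable_mul_fPartDeriv (I : Finset (Fin n)) (ν : Fin n → ℝ) {s : ℝ → ℝ}
    (hs : Measurable s) {C : ℝ} (hC : ∀ z, |s z| ≤ C) :
    Integrable fun z => s z * fPartDeriv I ν z := by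
  have e : ∀ z, s z * fPartDeriv I ν z = (n : ℝ)⁻¹ * ∑ i ∈ I, s z * phiDeriv (z - ν i) :=
    fun z => by rw [fPartDeriv, ← Finset.mul_sum]; ring
  simp_rw [e]
  exact (integrable_finsetSum _ fun i _ => integrable_mul_phiDeriv_sub hs hC _).const_mul _

lemma integrable_gain (I : Finset (Fin n)) (ν : Fin n → ℝ) {s : ℝ → ℝ} (hs : Measurable s)
    {C : ℝ} (hC : ∀ z, |s z| ≤ C) :
    Integrable fun z => -2 * (s z * fPartDeriv I ν z) + s z ^ 2 * fPart I ν z :=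
  ((integrable_mul_fPartDeriv I ν hs hC).const_mul _).add
    (integrable_mul_fPart I ν (hs.pow_const 2) (abs_sq_le hC))

/-- For fresh noise the total loss depends on `ν` only through the mixture density and its
derivative. This is the common currency in which the score and the linear rules are compared. -/
lemma sum_integral_eq_gain (hn : 0 < n) (I : Finset (Fin n)) (ν : Fin n → ℝ) {s : ℝ → ℝ}
    (hs : Measurable s) {C : ℝ} (hC : ∀ z, |s z| ≤ C) :
    ∑ i ∈ I, ∫ e, (e + s (ν i + e)) ^ 2 ∂γ = I.card + n * gain I ν s := by
  have hn' : (n : ℝ) ≠ 0 := by exact_mod_cast hn.ne'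
  simp_rw [integral_sq_gauss_add hs hC, Finset.sum_add_distrib, Finset.sum_const]
  rw [nsmul_eq_mul, mul_one, gain, ← integral_const_mul, ← integral_finsetSum]
  · congr 1
    refine integral_congr_ae (ae_of_all _ fun z => ?_)
    simp only [fPart, fPartDeriv, Finset.sum_add_distrib, ← Finset.mul_sum]
    field_simp
  · exact fun i _ => ((integrable_mul_phiDeriv_sub hs hC _).const_mul _).add
      (integrable_mul_phi_sub (hs.pow_const 2) (abs_sq_le hC) _)

lemma fPart_univ (ν : Fin n → ℝ) : fPart Finset.univ ν = fZ ν := rfl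

lemma fPartDeriv_univ (ν : Fin n → ℝ) : fPartDeriv Finset.univ ν = fZderiv ν := rfl

lemma measurable_regScore_apply (η : ℝ) (ν : Fin n → ℝ) : Measurable (regScore η ν) := by
  have h1 : Measurable fun z : ℝ => (ν, z) := measurable_prodMk_left
  have h2 := (EBFilter.measurable_regScore (n := n) η).comp h1
  simpa only [Function.comp_def] using h2

end

/-! ### Decoupling the regularised score from the noise. -/

section

variable {n : ℕ} {Ω : Type*} [MeasurableSpace Ω] {P : Measure Ω} [IsProbabilityMeasure P]
  {μ ε : Ω → Fin n → ℝ} {t : (Fin n → ℝ) → Fin n → ℝ} {ρ : ℕ → ℝ≥0} {R : ℝ}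

/-- In the `i`-th term replace `ε_i` by a fresh copy. The residual uses the unchanged `ν_i`, and the
score function moves by `O(η⁻² R / n)`; the loss then moves by `O(η⁻³ R / n)`, and summing over `i`
gives an error without a factor `n`. -/
theorem IsModel.regRisk_le (h : IsModel P μ ε) (ht : IsFilter t ρ R) (hn : 0 < n) {η : ℝ}
    (hη : 0 < η) (hη1 : η ≤ 1) :
    Integrable (fun ω => gain Finset.univ (nuFun t (μ ω) (ε ω))
      (regScore η (nuFun t (μ ω) (ε ω)))) P ∧
    regRisk P μ ε t η ≤ n * (1 + ∫ ω, gain Finset.univ (nuFun t (μ ω) (ε ω))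
      (regScore η (nuFun t (μ ω) (ε ω))) ∂P) + 4 * η⁻¹ ^ 3 * R * covConst := by
  have hμ := h.measurable_mu
  have hε := h.measurable_eps
  have hn' : (0 : ℝ) < n := by exact_mod_cast hn
  have hR := ht.nonneg ⟨0, hn⟩
  have hηi : 1 ≤ η⁻¹ := (one_le_inv₀ hη).2 hη1
  -- the integrand with the noise of index `i` replaced by an independent copy
  set M : Fin n → Ω × ℝ → ℝ := fun i p =>
    (p.2 + regScore η (nuFun t (μ p.1) (ε p.1)) (nuFun t (μ p.1) (ε p.1) i + p.2)) ^ 2 with hM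
  have hMm : ∀ i, Measurable (M i) := fun i => by
    have h1 : Measurable fun p : Ω × ℝ => (nuFun t (μ p.1) (ε p.1),
        nuFun t (μ p.1) (ε p.1) i + p.2) :=
      ((h.measurable_nu ht).comp measurable_fst).prodMk
        (((h.measurable_nu_apply ht i).comp measurable_fst).add measurable_snd)
    have h2 := (EBFilter.measurable_regScore (n := n) η).comp h1
    have h3 : Measurable fun p : Ω × ℝ => regScore η (nuFun t (μ p.1) (ε p.1))
        (nuFun t (μ p.1) (ε p.1) i + p.2) := by simpa only [Function.comp_def] using h2
    exact (measurable_snd.add h3).pow_const 2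
  have hMi : ∀ i, Integrable (M i) (P.prod γ) := fun i => by
    refine ((((integrable_pow_gauss 2).comp_snd P).const_mul 2).add
      (integrable_const (2 * η⁻¹ ^ 2))).mono' (hMm i).aestronglyMeasurable
      (ae_of_all _ fun p => ?_)
    rw [Real.norm_of_nonneg (sq_nonneg _)]
    have h1 := abs_regScore_le hη (nuFun t (μ p.1) (ε p.1)) (nuFun t (μ p.1) (ε p.1) i + p.2)
    have h2 := sq_le_sq' (abs_le.1 h1).1 (abs_le.1 h1).2
    simp only [Pi.add_apply]
    nlinarith [sq_nonneg (p.2 - regScore η (nuFun t (μ p.1) (ε p.1))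
      (nuFun t (μ p.1) (ε p.1) i + p.2))]
  -- Here `ν` is computed from the old noise and is fixed during the inner integration, so the
  -- identity for fresh noise applies for every `ω`.
  have hinner : ∀ ω, ∑ i, ∫ e, M i (ω, e) ∂γ = n * (1 + gain Finset.univ (nuFun t (μ ω) (ε ω))
      (regScore η (nuFun t (μ ω) (ε ω)))) := fun ω => by
    have := sum_integral_eq_gain hn Finset.univ (nuFun t (μ ω) (ε ω))
      (measurable_regScore_apply η (nuFun t (μ ω) (ε ω)))
      (abs_regScore_le hη (nuFun t (μ ω) (ε ω)))
    simp only [M]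
    rw [this]
    simp
    ring
  have hint : Integrable (fun ω => ∑ i, ∫ e, M i (ω, e) ∂γ) P :=
    integrable_finsetSum _ fun i _ => (hMi i).integral_prod_left
  have hgain : Integrable (fun ω => gain Finset.univ (nuFun t (μ ω) (ε ω))
      (regScore η (nuFun t (μ ω) (ε ω)))) P := by
    simp_rw [hinner] at hint
    have := (hint.const_mul (n : ℝ)⁻¹).sub (integrable_const 1)
    refine this.congr (ae_of_all _ fun ω => ?_)
    simp only [Pi.sub_apply]
    field_simp
    ring
  refine ⟨hgain, ?_⟩
  have hsum : ∑ i, ∫ p, M i p ∂(P.prod γ) = n * (1 + ∫ ω, gain Finset.univ (nuFun t (μ ω) (ε ω))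
      (regScore η (nuFun t (μ ω) (ε ω))) ∂P) := by
    have : ∀ i, ∫ p, M i p ∂(P.prod γ) = ∫ ω, ∫ e, M i (ω, e) ∂γ ∂P := fun i =>
      integral_prod _ (hMi i)
    simp_rw [this]
    rw [← integral_finsetSum _ fun i _ => (hMi i).integral_prod_left]
    simp_rw [hinner]
    rw [integral_const_mul, integral_add (integrable_const _) hgain]
    simp
  have key : ∀ i, ∫ ω, (ε ω i + regScore η (nuFun t (μ ω) (ε ω))
      (nuFun t (μ ω) (ε ω) i + ε ω i)) ^ 2 ∂P
      ≤ ∫ p, M i p ∂(P.prod γ) + 4 * η⁻¹ ^ 3 * R * (n : ℝ)⁻¹ * covConst := fun i => by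
    set H : (Fin n → ℝ) × (Fin n → ℝ) → ℝ := fun p =>
      (p.2 i + regScore η (nuFun t p.1 p.2) (nuFun t p.1 p.2 i + p.2 i)) ^ 2 with hH
    have hHm : Measurable H := by
      have h1 : Measurable fun p : (Fin n → ℝ) × (Fin n → ℝ) => (nuFun t p.1 p.2,
          nuFun t p.1 p.2 i + p.2 i) :=
        (measurable_nuFun ht.measurable).prodMk
          ((measurable_nuFun_apply ht.measurable i).add (by fun_prop))
      have h2 := (EBFilter.measurable_regScore (n := n) η).comp h1
      have h3 : Measurable fun p : (Fin n → ℝ) × (Fin n → ℝ) => regScore η (nuFun t p.1 p.2)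
        (nuFun t p.1 p.2 i + p.2 i) := by simpa only [Function.comp_def] using h2
      exact ((by fun_prop : Measurable fun p : (Fin n → ℝ) × (Fin n → ℝ) => p.2 i).add h3).pow_const 2
    have hHi : Integrable (fun ω => H (μ ω, ε ω)) P := h.integrable_sq_regScore ht hη i
    have hHi' := (h.integrable_resample_iff i hHm).2 hHi
    have e1 : ∫ ω, (ε ω i + regScore η (nuFun t (μ ω) (ε ω))
      (nuFun t (μ ω) (ε ω) i + ε ω i)) ^ 2 ∂P = ∫ ω, H (μ ω, ε ω) ∂P := rfl
    rw [e1, h.integral_resample i hHm]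
    have hdom := ((h.integrable_dominant i i).const_mul 48).const_mul (4 * η⁻¹ ^ 3 * R * (n : ℝ)⁻¹)
    calc _ ≤ ∫ p : Ω × ℝ, (M i p + 4 * η⁻¹ ^ 3 * R * (n : ℝ)⁻¹
          * (48 * (1 + ε p.1 i ^ 4 + ε p.1 i ^ 4 + p.2 ^ 4))) ∂(P.prod γ) := by
          refine integral_mono hHi' ((hMi i).add hdom) fun p => ?_
          simp only [H, M]
          rw [ht.nuFun_update_self, Function.update_self]
          set z := nuFun t (μ p.1) (ε p.1) i + p.2
          have a1 := abs_regScore_sub_le hη hη1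
            (nuFun t (μ p.1) (Function.update (ε p.1) i p.2)) (nuFun t (μ p.1) (ε p.1)) z
          have a2 := ht.sum_abs_le (μ p.1) (ε p.1) i p.2
          have a3 := abs_regScore_le hη (nuFun t (μ p.1) (Function.update (ε p.1) i p.2)) z
          have a4 := abs_regScore_le hη (nuFun t (μ p.1) (ε p.1)) z
          set s' := regScore η (nuFun t (μ p.1) (Function.update (ε p.1) i p.2)) z
          set s := regScore η (nuFun t (μ p.1) (ε p.1)) z
          have a5 : |s' - s| ≤ 2 * η⁻¹ ^ 2 * ((n : ℝ)⁻¹ * (R * |p.2 - ε p.1 i|)) := by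
            refine a1.trans ?_
            gcongr
          have a6 : |p.2 - ε p.1 i| ≤ |p.2| + |ε p.1 i| := abs_sub _ _
          have a7 : |2 * p.2 + s' + s| ≤ 2 * η⁻¹ * (1 + |p.2|) := by
            have b1 := abs_add_le (2 * p.2 + s') s
            have b2 := abs_add_le (2 * p.2) s'
            rw [abs_mul, abs_two] at b2
            have := abs_nonneg p.2
            nlinarith
          have a8 := triple_le |p.2| |ε p.1 i| |ε p.1 i| (abs_nonneg _) (abs_nonneg _) (abs_nonneg _)
          simp only [Even.pow_abs (by decide : Even 4)] at a8
          have e2 : (p.2 + s') ^ 2 - (p.2 + s) ^ 2 = (s' - s) * (2 * p.2 + s' + s) := by ring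
          have a9 : (p.2 + s') ^ 2 - (p.2 + s) ^ 2 ≤
              4 * η⁻¹ ^ 3 * R * (n : ℝ)⁻¹ * (48 * (1 + ε p.1 i ^ 4 + ε p.1 i ^ 4 + p.2 ^ 4)) := by
            rw [e2]
            refine (le_abs_self _).trans ?_
            rw [abs_mul]
            calc _ ≤ (2 * η⁻¹ ^ 2 * ((n : ℝ)⁻¹ * (R * (|p.2| + |ε p.1 i|))))
                  * (2 * η⁻¹ * (1 + |p.2|)) := by
                  refine mul_le_mul (a5.trans ?_) a7 (abs_nonneg _) (by positivity)
                  gcongr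
              _ = 4 * η⁻¹ ^ 3 * R * (n : ℝ)⁻¹ * ((1 + |p.2|) * 1 * (|p.2| + |ε p.1 i|)) := by ring
              _ ≤ 4 * η⁻¹ ^ 3 * R * (n : ℝ)⁻¹ *
                  ((1 + |p.2|) * (1 + |ε p.1 i|) * (|p.2| + |ε p.1 i|)) := by
                  gcongr
                  linarith [abs_nonneg (ε p.1 i)]
              _ ≤ _ := by gcongr
          linarith
      _ = _ := by
          rw [integral_add (hMi i) hdom, integral_const_mul, integral_const_mul,
            h.integral_dominant, covConst]
  unfold regRisk
  rw [integral_finsetSum _ fun i _ => h.integrable_sq_regScore ht hη i]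
  calc _ ≤ ∑ i, (∫ p, M i p ∂(P.prod γ) + 4 * η⁻¹ ^ 3 * R * (n : ℝ)⁻¹ * covConst) :=
        Finset.sum_le_sum fun i _ => key i
    _ = _ := by
        rw [Finset.sum_add_distrib, hsum]
        simp
        field_simp

end

section

variable {Ω : ℕ → Type*} [∀ n, MeasurableSpace (Ω n)] {P : ∀ n, Measure (Ω n)}
  [∀ n, IsProbabilityMeasure (P n)] {μ ε : ∀ n, Ω n → Fin n → ℝ}
  {t : ∀ n, (Fin n → ℝ) → Fin n → ℝ} {ρ : ℕ → ℝ≥0} {R : ℝ}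

theorem eventually_regRisk_le (h : ∀ n, IsModel (P n) (μ n) (ε n))
    (ht : ∀ n, IsFilter (t n) ρ R) {θ : ℝ} (hθ : 0 < θ) :
    ∀ᶠ n : ℕ in atTop,
      regRisk (P n) (μ n) (ε n) (t n) (Real.log n ^ 24)⁻¹
        ≤ n * (1 + ∫ ω, gain Finset.univ (nuFun (t n) (μ n ω) (ε n ω))
          (regScore (Real.log n ^ 24)⁻¹ (nuFun (t n) (μ n ω) (ε n ω))) ∂(P n)) + θ * n := by
  -- The exponent is that of `η⁻³ = (log n)^72`.
  have T := (tendsto_log_pow_div 72).const_mul (4 * R * covConst)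
  rw [mul_zero] at T
  filter_upwards [eventually_gt_atTop 0, tendsto_log_natCast.eventually_ge_atTop 1,
    (tendsto_order.1 T).2 θ hθ] with n hn hL hsmall
  have hn' : (0 : ℝ) < n := by exact_mod_cast hn
  have hL0 : 0 < Real.log n := by linarith
  have h1 := ((h n).regRisk_le (ht n) hn (η := (Real.log n ^ 24)⁻¹) (by positivity)
    (inv_le_one_of_one_le₀ (one_le_pow₀ hL))).2
  rw [inv_inv, ← pow_mul] at h1
  have h2 : 4 * Real.log n ^ (24 * 3) * R * covConst ≤ θ * n := by
    have := mul_le_mul_of_nonneg_right hsmall.le hn'.le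
    have e : 4 * R * covConst * (Real.log n ^ 72 / n) * n = 4 * Real.log n ^ (24 * 3) * R * covConst := by
      field_simp
    exact e ▸ this
  exact h1.trans (add_le_add le_rfl h2)

end

/-! ### The gain of the score against that of a linear rule -/

section

variable {n : ℕ}

/-- The part from `I` of the mixture of the functions `x ^ k * φ x`. -/
noncomputable def momentPart (k : ℕ) (I : Finset (Fin n)) (ν : Fin n → ℝ) (z : ℝ) : ℝ :=
  (n : ℝ)⁻¹ * ∑ i ∈ I, (z - ν i) ^ k * φ (z - ν i)

lemma integrable_momentPart (k : ℕ) (I : Finset (Fin n)) (ν : Fin n → ℝ) :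
    Integrable (momentPart k I ν) :=
  (integrable_finsetSum _ fun i _ => integrable_pow_mul_phi_sub k (ν i)).const_mul _

lemma integral_momentPart {k : ℕ} {c : ℝ} (hc : ∀ v, ∫ z, (z - v) ^ k * φ (z - v) = c)
    (I : Finset (Fin n)) (ν : Fin n → ℝ) :
    ∫ z, momentPart k I ν z = (I.card : ℝ) / n * c := by
  unfold momentPart
  rw [integral_const_mul, integral_finsetSum _ fun i _ => integrable_pow_mul_phi_sub k (ν i)]
  simp_rw [hc]
  rw [Finset.sum_const, nsmul_eq_mul]
  ring

lemma momentPart_zero (I : Finset (Fin n)) (ν : Fin n → ℝ) : momentPart 0 I ν = fPart I ν := by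
  funext z
  simp [momentPart, fPart]

lemma fPart_nonneg (I : Finset (Fin n)) (ν : Fin n → ℝ) (z : ℝ) : 0 ≤ fPart I ν z :=
  mul_nonneg (by positivity) (Finset.sum_nonneg fun _ _ => phi_nonneg _)

lemma momentPart_nonneg {k : ℕ} (hk : Even k) (I : Finset (Fin n)) (ν : Fin n → ℝ) (z : ℝ) :
    0 ≤ momentPart k I ν z :=
  mul_nonneg (by positivity)
    (Finset.sum_nonneg fun _ _ => mul_nonneg (hk.pow_nonneg _) (phi_nonneg _))

lemma fPart_add_compl (I : Finset (Fin n)) (ν : Fin n → ℝ) (z : ℝ) :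
    fPart I ν z + fPart Iᶜ ν z = fZ ν z := by
  rw [fPart, fPart, fZ, ← mul_add, Finset.sum_add_sum_compl]

lemma fPartDeriv_add_compl (I : Finset (Fin n)) (ν : Fin n → ℝ) (z : ℝ) :
    fPartDeriv I ν z + fPartDeriv Iᶜ ν z = fZderiv ν z := by
  rw [fPartDeriv, fPartDeriv, fZderiv, ← mul_add, Finset.sum_add_sum_compl]

lemma sq_fPartDeriv_le (I : Finset (Fin n)) (ν : Fin n → ℝ) (z : ℝ) :
    fPartDeriv I ν z ^ 2 ≤ fPart I ν z * momentPart 2 I ν z := sq_sum_phiDeriv_le ν I z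

lemma fPart_le_one (I : Finset (Fin n)) (ν : Fin n → ℝ) (z : ℝ) : fPart I ν z ≤ 1 := by
  linarith [fPart_add_compl I ν z, fZ_le_one ν z, fPart_nonneg Iᶜ ν z]

/-- Young's inequality termwise. Used with `r` the share of the omitted indices, it trades the
second moment of `I` for a small multiple of the fourth moment and a large multiple of the small
density of the omitted part. -/
lemma two_mul_momentPart_le (I : Finset (Fin n)) (ν : Fin n → ℝ) (z : ℝ) (r : ℝ) {lam : ℝ}
    (hlam : 0 < lam) :
    2 * r * momentPart 2 I ν z ≤ lam⁻¹ * r ^ 2 * fPart I ν z + lam * momentPart 4 I ν z := by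
  simp only [momentPart, fPart, Finset.mul_sum, ← Finset.sum_add_distrib]
  refine Finset.sum_le_sum fun i _ => ?_
  have h : 2 * r * (z - ν i) ^ 2 ≤ lam⁻¹ * r ^ 2 + lam * (z - ν i) ^ 4 := by
    have h1 : 0 ≤ lam⁻¹ * (r - lam * (z - ν i) ^ 2) ^ 2 := by positivity
    have h2 : lam⁻¹ * (r - lam * (z - ν i) ^ 2) ^ 2
        = lam⁻¹ * r ^ 2 + lam * (z - ν i) ^ 4 - 2 * r * (z - ν i) ^ 2 := by
      field_simp
      ring
    linarith
  have h3 := mul_le_mul_of_nonneg_right h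
    (mul_nonneg (by positivity : 0 ≤ (n : ℝ)⁻¹) (phi_nonneg (z - ν i)))
  linarith

lemma abs_two_mul_le {w d f X : ℝ} (hf : 0 ≤ f) (hX : 0 ≤ X) (h : d ^ 2 ≤ f * X) :
    |2 * w * d| ≤ 1 / 2 * w ^ 2 * f + 2 * X := by
  refine abs_le_of_sq_le_sq ?_ (by positivity)
  have : 4 * w ^ 2 * d ^ 2 ≤ 4 * w ^ 2 * (f * X) := by gcongr
  nlinarith [sq_nonneg (1 / 2 * w ^ 2 * f - 2 * X)]

/-- The loss in the linear gain when the rule is damped by the share `p` of the indices in `I`. -/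
lemma damped_gain_le {w p f fI fE dI dE XI XE : ℝ} (hp0 : 0 ≤ p) (hp1 : p ≤ 1)
    (hfI : fI = p * f) (hfE : fE = (1 - p) * f) (hf : 0 ≤ f) (hXI : 0 ≤ XI) (hXE : 0 ≤ XE)
    (hI : dI ^ 2 ≤ fI * XI) (hE : dE ^ 2 ≤ fE * XE) :
    2 * (p * w) * (dI + dE) + (p * w) ^ 2 * f
      ≤ 2 * w * dI + w ^ 2 * fI + 2 * (1 - p) * XI + 2 * XE := by
  have hp : 0 ≤ 1 - p := by linarith
  have a1 := neg_le_of_abs_le (abs_two_mul_le (w := w) (hfI ▸ by positivity) hXI hI)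
  have a2 := le_of_abs_le (abs_two_mul_le (w := w) (hfE ▸ by positivity) hXE hE)
  have b1 := mul_le_mul_of_nonneg_left a1 hp
  have b2 := mul_le_mul_of_nonneg_left a2 hp0
  have b3 := mul_le_mul_of_nonneg_right hp1 hXE
  subst hfI hfE
  linarith

lemma exists_share (hn : 0 < n) (I : Finset (Fin n)) (ν : Fin n → ℝ) (z : ℝ) :
    ∃ p : ℝ, 0 ≤ p ∧ p ≤ 1 ∧ fPart I ν z = p * fZ ν z ∧ fPart Iᶜ ν z = (1 - p) * fZ ν z := by
  have hf := fZ_pos hn ν z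
  have h := fPart_add_compl I ν z
  have e : fPart I ν z = fPart I ν z / fZ ν z * fZ ν z := by field_simp
  refine ⟨fPart I ν z / fZ ν z, div_nonneg (fPart_nonneg _ _ _) hf.le, ?_, e, ?_⟩
  · rw [div_le_one hf]
    linarith [fPart_nonneg Iᶜ ν z]
  · rw [sub_mul, ← e]
    linarith

/-- The squared distance of the score to the linear rule `-w`, where the density is not small. -/
noncomputable def scoreGap (η : ℝ) (I : Finset (Fin n)) (ν : Fin n → ℝ) (w : ℝ → ℝ) (z : ℝ) : ℝ :=
  if η ≤ fZ ν z then (fZderiv ν z + w z * fPart I ν z) ^ 2 else 0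

/-- The score serves all indices while the linear rule `-w` is charged for `I` only. The bridge is
the rule `-p w`, with `p` the share of `I` in the density at `z`: the score beats it on the whole
mixture by a completed square, and its own gain exceeds that of `-w` on `I` by little when `Iᶜ` is
small. -/
lemma gain_add_gap_le (hn : 0 < n) (I : Finset (Fin n)) (ν : Fin n → ℝ) {η : ℝ} (hη : 0 < η)
    (w : ℝ → ℝ) (z : ℝ) {lam : ℝ} (hlam : 0 < lam) :
    -2 * (regScore η ν z * fZderiv ν z) + regScore η ν z ^ 2 * fZ ν z + scoreGap η I ν w z
      ≤ 2 * (w z * fPartDeriv I ν z) + w z ^ 2 * fPart I ν z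
        + (lam⁻¹ * fPart Iᶜ ν z + lam * momentPart 4 I ν z + 2 * momentPart 2 Iᶜ ν z)
        + (if fZ ν z < η then 2 * |w z| * |fZderiv ν z| else 0) := by
  obtain ⟨p, hp0, hp1, hI, hE⟩ := exists_share hn I ν z
  have hf := fZ_pos hn ν z
  have hp : 0 ≤ 1 - p := by linarith
  have hd := fPartDeriv_add_compl I ν z
  have h1 := damped_gain_le (w := w z) hp0 hp1 hI hE hf.le
    (momentPart_nonneg (by decide) I ν z) (momentPart_nonneg (by decide) Iᶜ ν z)
    (sq_fPartDeriv_le I ν z) (sq_fPartDeriv_le Iᶜ ν z)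
  have h2 := two_mul_momentPart_le I ν z (1 - p) hlam
  have h3 : lam⁻¹ * (1 - p) ^ 2 * fPart I ν z ≤ lam⁻¹ * fPart Iᶜ ν z := by
    rw [hI, hE, mul_assoc]
    refine mul_le_mul_of_nonneg_left ?_ (by positivity)
    have : (1 - p) * p ≤ 1 := by nlinarith
    calc (1 - p) ^ 2 * (p * fZ ν z) = ((1 - p) * p) * ((1 - p) * fZ ν z) := by ring
      _ ≤ 1 * ((1 - p) * fZ ν z) := by gcongr
      _ = _ := one_mul _
  rw [hd] at h1
  unfold scoreGap
  split_ifs with c1 c2 c2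
  · linarith
  -- Completing the square, with `p f = fPart I`. Dropping the division by `f` from the square is
  -- allowed because `f ≤ 1`.
  · have e : -2 * (regScore η ν z * fZderiv ν z) + regScore η ν z ^ 2 * fZ ν z
        + (fZderiv ν z + w z * fPart I ν z) ^ 2 / fZ ν z
        = 2 * (p * w z) * fZderiv ν z + (p * w z) ^ 2 * fZ ν z := by
      rw [regScore_eq c1, hI]
      field_simp
      ring
    have e2 : (fZderiv ν z + w z * fPart I ν z) ^ 2
        ≤ (fZderiv ν z + w z * fPart I ν z) ^ 2 / fZ ν z :=
      le_div_self (sq_nonneg _) hf (fZ_le_one ν z)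
    linarith
  -- At low density the regularised rule only needs to do no harm; the damped linear rule can gain
  -- at most `2 |w| |f'|` there, which is entered as an error.
  · have e : -2 * (regScore η ν z * fZderiv ν z) + regScore η ν z ^ 2 * fZ ν z ≤ 0 := by
      rw [regScore, max_eq_right c2.le]
      have : fZ ν z / η ≤ 1 := (div_le_one hη).2 c2.le
      have h5 : 0 ≤ fZderiv ν z ^ 2 / η := by positivity
      have e5 : -2 * (fZderiv ν z / η * fZderiv ν z) + (fZderiv ν z / η) ^ 2 * fZ ν z
        = fZderiv ν z ^ 2 / η * (fZ ν z / η - 2) := by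
        field_simp
        ring
      rw [e5]
      nlinarith
    have e3 : -(2 * |w z| * |fZderiv ν z|) ≤ 2 * (p * w z) * fZderiv ν z := by
      refine (neg_le_neg ?_).trans (neg_abs_le _)
      rw [abs_mul, abs_mul, abs_mul, abs_two, abs_of_nonneg hp0]
      have := mul_nonneg (abs_nonneg (w z)) (abs_nonneg (fZderiv ν z))
      nlinarith
    have e4 : 0 ≤ (p * w z) ^ 2 * fZ ν z := by positivity
    linarith
  · exact absurd (not_le.1 c1) c2

lemma measurable_fZ_apply (ν : Fin n → ℝ) : Measurable (fZ ν) :=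
  (continuous_iff_continuousAt.2 fun z => (hasDerivAt_fZ ν z).continuousAt).measurable

lemma measurable_fPart (I : Finset (Fin n)) (ν : Fin n → ℝ) : Measurable (fPart I ν) := by
  unfold fPart
  fun_prop

lemma measurable_fZderiv_apply (ν : Fin n → ℝ) : Measurable (fZderiv ν) := by
  unfold fZderiv
  fun_prop

lemma integrable_fPart (I : Finset (Fin n)) (ν : Fin n → ℝ) : Integrable (fPart I ν) :=
  momentPart_zero I ν ▸ integrable_momentPart 0 I ν

lemma integral_fPart (I : Finset (Fin n)) (ν : Fin n → ℝ) :
    ∫ z, fPart I ν z = (I.card : ℝ) / n := by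
  rw [← momentPart_zero, integral_momentPart (k := 0) (c := 1) (by simpa using integral_phi_sub),
    mul_one]

lemma integrable_fZderiv (ν : Fin n → ℝ) : Integrable (fZderiv ν) :=
  (integrable_finsetSum _ fun i _ => integrable_phiDeriv_sub (ν i)).const_mul _

lemma scoreGap_nonneg (η : ℝ) (I : Finset (Fin n)) (ν : Fin n → ℝ) (w : ℝ → ℝ) (z : ℝ) :
    0 ≤ scoreGap η I ν w z := by
  unfold scoreGap
  split_ifs <;> positivity

lemma scoreGap_le (η : ℝ) (I : Finset (Fin n)) (ν : Fin n → ℝ) {w : ℝ → ℝ} {z T : ℝ}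
    (hw : |w z| ≤ T) : scoreGap η I ν w z ≤ 2 * fZ ν z + 2 * T ^ 2 * fPart I ν z := by
  have h1 := sq_fZderiv_le ν z
  have h0 := fZ_nonneg ν z
  have h2 := fPart_nonneg I ν z
  have h3 := fPart_le_one I ν z
  have h4 : w z ^ 2 ≤ T ^ 2 := sq_le_sq' (abs_le.1 hw).1 (abs_le.1 hw).2
  have h5 : (w z * fPart I ν z) ^ 2 ≤ T ^ 2 * fPart I ν z := by
    rw [mul_pow]
    have : fPart I ν z ^ 2 ≤ fPart I ν z := by nlinarith
    gcongr
  unfold scoreGap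
  split_ifs
  · nlinarith [sq_nonneg (fZderiv ν z - w z * fPart I ν z)]
  · positivity

lemma integrable_scoreGap (η : ℝ) (I : Finset (Fin n)) (ν : Fin n → ℝ) {w : ℝ → ℝ} {T : ℝ}
    (hw : Measurable w) (hT : ∀ z, |w z| ≤ T) : Integrable (scoreGap η I ν w) := by
  refine (((integrable_fPart Finset.univ ν).const_mul 2).add
    ((integrable_fPart I ν).const_mul (2 * T ^ 2))).mono' ?_ (ae_of_all _ fun z => ?_)
  · refine (Measurable.ite ?_ ?_ measurable_const).aestronglyMeasurable
    · exact measurableSet_le measurable_const (measurable_fZ_apply ν)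
    · exact ((measurable_fZderiv_apply ν).add (hw.mul (measurable_fPart I ν))).pow_const 2
  · rw [Real.norm_of_nonneg (scoreGap_nonneg _ _ _ _ _)]
    exact scoreGap_le η I ν (hT z)

lemma integral_abs_fZderiv_le (ν : Fin n → ℝ) : ∫ z, |fZderiv ν z| ≤ 1 := by
  rcases Nat.eq_zero_or_pos n with rfl | hn
  · simp [fZderiv]
  have hn' : (0 : ℝ) < n := by exact_mod_cast hn
  calc ∫ z, |fZderiv ν z| ≤ ∫ z, (n : ℝ)⁻¹ * ∑ i, |phiDeriv (z - ν i)| := by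
        refine integral_mono (integrable_fZderiv ν).abs ((integrable_finsetSum _ fun i _ =>
          (integrable_phiDeriv_sub (ν i)).abs).const_mul _) fun z => ?_
        simp only [fZderiv, abs_mul, abs_of_pos (inv_pos.2 hn')]
        gcongr
        exact Finset.abs_sum_le_sum_abs _ _
    _ = (n : ℝ)⁻¹ * ∑ i, ∫ z, |phiDeriv (z - ν i)| := by
        rw [integral_const_mul, integral_finsetSum _ fun i _ => (integrable_phiDeriv_sub (ν i)).abs]
    _ ≤ (n : ℝ)⁻¹ * ∑ _i : Fin n, 1 := by
        gcongr with i
        exact integral_abs_phiDeriv_sub_le _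
    _ = 1 := by
        simp
        field_simp

/-- The pointwise bound integrated. Where the density is below `κ²`, the derivative is at most `κ`
and this is used on `[-M, M]`; outside, the decay `|w| ≤ T²/M` is used together with `∫ |f'| ≤ 1`.
-/
theorem gain_regScore_add_gap_le (hn : 0 < n) (I : Finset (Fin n)) (ν : Fin n → ℝ) {κ T M : ℝ}
    (hκ : 0 < κ) (hM : 0 < M) {w : ℝ → ℝ} (hw : Measurable w) (hT : ∀ z, |w z| ≤ T)
    (hT2 : ∀ z, |z| * |w z| ≤ T ^ 2) {lam : ℝ} (hlam : 0 < lam) :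
    gain Finset.univ ν (regScore (κ ^ 2) ν) + ∫ z, scoreGap (κ ^ 2) I ν w z
      ≤ gain I ν (fun z => -w z) + ((2 + lam⁻¹) * ((Iᶜ.card : ℝ) / n) + lam * fourthMoment
        + 4 * M * T * κ + 2 * T ^ 2 / M) := by
  have hη : 0 < κ ^ 2 := by positivity
  have hT0 : 0 ≤ T := (abs_nonneg _).trans (hT 0)
  have hn' : (0 : ℝ) < n := by exact_mod_cast hn
  have hW : Measurable fun z => -w z := hw.neg
  have hTW : ∀ z, |(-w z)| ≤ T := fun z => by simpa using hT z
  have i1 := integrable_gain Finset.univ ν (measurable_regScore_apply (κ ^ 2) ν)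
    (abs_regScore_le hη ν)
  have i2 := integrable_scoreGap (κ ^ 2) I ν hw hT
  have i3 := integrable_gain I ν hW hTW
  have i4 := (integrable_fPart Iᶜ ν).const_mul lam⁻¹
  have i5 := (integrable_momentPart 4 I ν).const_mul lam
  have i6 := (integrable_momentPart 2 Iᶜ ν).const_mul 2
  have i7 : Integrable fun z : ℝ => (Set.Icc (-M) M).indicator (fun _ => 2 * T * κ) z :=
    (integrable_indicator_iff measurableSet_Icc).2 (integrableOn_const (by simp))
  have i8 := (integrable_fZderiv ν).abs.const_mul (2 * T ^ 2 / M)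
  have i45 : Integrable fun z => lam⁻¹ * fPart Iᶜ ν z + lam * momentPart 4 I ν z := i4.add i5
  have i456 : Integrable fun z => lam⁻¹ * fPart Iᶜ ν z + lam * momentPart 4 I ν z
    + 2 * momentPart 2 Iᶜ ν z := i45.add i6
  have i78 : Integrable fun z : ℝ => (Set.Icc (-M) M).indicator (fun _ => 2 * T * κ) z
    + 2 * T ^ 2 / M * |fZderiv ν z| := i7.add i8
  have i3456 : Integrable fun z => (-2 * (-w z * fPartDeriv I ν z) + (-w z) ^ 2 * fPart I ν z)
    + (lam⁻¹ * fPart Iᶜ ν z + lam * momentPart 4 I ν z + 2 * momentPart 2 Iᶜ ν z) := i3.add i456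
  have hcard : (I.card : ℝ) / n ≤ 1 := by
    rw [div_le_one hn']
    exact_mod_cast (Finset.card_le_univ I).trans_eq (Fintype.card_fin n)
  unfold gain
  rw [← integral_add i1 i2]
  calc _ ≤ ∫ z, ((-2 * (-w z * fPartDeriv I ν z) + (-w z) ^ 2 * fPart I ν z)
        + (lam⁻¹ * fPart Iᶜ ν z + lam * momentPart 4 I ν z + 2 * momentPart 2 Iᶜ ν z)
        + ((Set.Icc (-M) M).indicator (fun _ => 2 * T * κ) z
          + 2 * T ^ 2 / M * |fZderiv ν z|)) := by
        refine integral_mono (i1.add i2) (i3456.add i78) fun z => ?_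
        have h1 := gain_add_gap_le hn I ν hη w z hlam
        rw [fPart_univ, fPartDeriv_univ]
        have h2 : (if fZ ν z < κ ^ 2 then 2 * |w z| * |fZderiv ν z| else 0)
            ≤ (Set.Icc (-M) M).indicator (fun _ => 2 * T * κ) z
              + 2 * T ^ 2 / M * |fZderiv ν z| := by
          have h3 : 0 ≤ 2 * T ^ 2 / M * |fZderiv ν z| := by positivity
          have h4 : 0 ≤ (Set.Icc (-M) M).indicator (fun _ => 2 * T * κ) z :=
            Set.indicator_nonneg (fun _ _ => by positivity) _
          split_ifs with c
          · by_cases hz : |z| ≤ M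
            · rw [Set.indicator_of_mem (Set.mem_Icc.2 (abs_le.1 hz))]
              have h5 : |fZderiv ν z| ≤ κ :=
                abs_le_of_sq_le_sq ((sq_fZderiv_le ν z).trans c.le) hκ.le
              have h6 : 2 * |w z| * |fZderiv ν z| ≤ 2 * T * κ := by
                gcongr
                exact hT z
              linarith
            · have h5 : |w z| ≤ T ^ 2 / M := by
                rw [le_div_iff₀ hM, mul_comm]
                exact (mul_le_mul_of_nonneg_right (not_le.1 hz).le (abs_nonneg _)).trans (hT2 z)
              have h6 : 2 * |w z| * |fZderiv ν z| ≤ 2 * (T ^ 2 / M) * |fZderiv ν z| := by gcongr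
              have h7 : 2 * (T ^ 2 / M) = 2 * T ^ 2 / M := by ring
              rw [h7] at h6
              linarith
          · linarith
        simp only
        linarith
    _ ≤ _ := by
        rw [integral_add i3456 i78, integral_add i3 i456, integral_add i45 i6,
          integral_add i4 i5, integral_add i7 i8, integral_indicator measurableSet_Icc]
        simp only [integral_const_mul]
        rw [integral_fPart, integral_momentPart (k := 2) integral_sq_phi_sub,
          integral_momentPart (k := 4) integral_four_phi_sub]
        have hvol : 2 * T * ∫ _ in Set.Icc (-M) M, κ = 4 * M * T * κ := by
          rw [setIntegral_const, Real.volume_real_Icc_of_le (by linarith), smul_eq_mul]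
          ring
        rw [hvol]
        have e1 := mul_le_mul_of_nonneg_left (integral_abs_fZderiv_le ν)
          (by positivity : 0 ≤ 2 * T ^ 2 / M)
        have e2 := mul_le_mul_of_nonneg_right hcard fourthMoment_nonneg
        have e3 := mul_le_mul_of_nonneg_left e2 hlam.le
        linarith

end

/-! ### Smooth truncation -/

section

/-- A smooth truncation of the identity at level `T`. -/
noncomputable def trunc (T z : ℝ) : ℝ := T ^ 2 * z / (T ^ 2 + z ^ 2)

/-- The factor by which `trunc` shrinks its argument. -/
noncomputable def truncWeight (T z : ℝ) : ℝ := T ^ 2 / (T ^ 2 + z ^ 2)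

variable {T : ℝ}

lemma trunc_eq (T z : ℝ) : trunc T z = truncWeight T z * z := by
  unfold trunc truncWeight
  ring

lemma truncWeight_nonneg (T z : ℝ) : 0 ≤ truncWeight T z := by
  unfold truncWeight
  positivity

lemma truncWeight_le_one (T z : ℝ) : truncWeight T z ≤ 1 :=
  div_le_one_of_le₀ (by nlinarith [sq_nonneg z]) (by positivity)

lemma one_sub_truncWeight_le (hT : 0 < T) (z : ℝ) : 1 - truncWeight T z ≤ z ^ 2 / T ^ 2 := by
  unfold truncWeight
  rw [sub_le_iff_le_add, ← sub_le_iff_le_add', le_div_iff₀ (by positivity)]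
  have : z ^ 2 / T ^ 2 * T ^ 2 = z ^ 2 := by field_simp
  have h2 : 0 ≤ z ^ 2 / T ^ 2 * z ^ 2 := by positivity
  linarith

lemma abs_trunc_le (hT : 0 < T) (z : ℝ) : |trunc T z| ≤ T := by
  have : 0 < T ^ 2 + z ^ 2 := by positivity
  rw [trunc, abs_div, abs_of_pos this, div_le_iff₀ this, abs_mul, abs_of_pos (by positivity),
    ← sq_abs z]
  nlinarith [mul_nonneg hT.le (sq_nonneg (T - |z|)), abs_nonneg z, hT]

lemma abs_mul_abs_trunc_le (hT : 0 < T) (z : ℝ) : |z| * |trunc T z| ≤ T ^ 2 := by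
  have : 0 < T ^ 2 + z ^ 2 := by positivity
  rw [trunc, abs_div, abs_of_pos this, ← mul_div_assoc, div_le_iff₀ this, abs_mul,
    abs_of_pos (by positivity : 0 < T ^ 2), ← sq_abs z]
  nlinarith [sq_nonneg (T ^ 2)]

lemma measurable_trunc (T : ℝ) : Measurable (trunc T) := by
  unfold trunc
  fun_prop

lemma trunc_sub_eq (hT : 0 < T) (z v : ℝ) : trunc T z - trunc T v
    = (z - v) * (T ^ 2 * (T ^ 2 - z * v) / ((T ^ 2 + z ^ 2) * (T ^ 2 + v ^ 2))) := by
  have h1 : T ^ 2 + z ^ 2 ≠ 0 := by positivity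
  have h2 : T ^ 2 + v ^ 2 ≠ 0 := by positivity
  unfold trunc
  field_simp
  ring

lemma abs_trunc_sub_le (hT : 0 < T) (z v : ℝ) : |trunc T z - trunc T v| ≤ |z - v| := by
  rw [trunc_sub_eq hT, abs_mul]
  refine mul_le_of_le_one_right (abs_nonneg _) ?_
  have h1 : 0 < (T ^ 2 + z ^ 2) * (T ^ 2 + v ^ 2) := by positivity
  rw [abs_div, abs_of_pos h1, div_le_one h1, abs_le]
  constructor <;>
  nlinarith [sq_nonneg (T * (z - v)), sq_nonneg (T * (z + v)), sq_nonneg (z * v), sq_nonneg (T * z),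
    sq_nonneg (T * v), sq_nonneg (T ^ 2)]

/-- The difference quotient of `trunc` is close to `1` as long as both arguments are small compared
with `T`; the defect is of second order and costs fourth powers. -/
lemma le_mul_trunc_sub (hT : 0 < T) (v e : ℝ) :
    e ^ 2 - 8 * (v ^ 2 * e ^ 2 + e ^ 4) / T ^ 2 ≤ e * (trunc T (v + e) - trunc T v) := by
  rw [trunc_sub_eq hT, add_sub_cancel_left, ← mul_assoc, ← sq]
  set z := v + e with hz
  have h1 : 0 < (T ^ 2 + z ^ 2) * (T ^ 2 + v ^ 2) := by positivity
  have key : 1 - 8 * (v ^ 2 + e ^ 2) / T ^ 2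
      ≤ T ^ 2 * (T ^ 2 - z * v) / ((T ^ 2 + z ^ 2) * (T ^ 2 + v ^ 2)) := by
    rw [le_div_iff₀ h1, sub_mul, sub_le_iff_le_add, one_mul]
    have h2 : 5 / 2 * (z ^ 2 + v ^ 2) ≤ 8 * (v ^ 2 + e ^ 2) := by
      rw [hz]
      nlinarith [sq_nonneg (v - e)]
    have h3 : T ^ 2 * (T ^ 2 + v ^ 2) ≤ (T ^ 2 + z ^ 2) * (T ^ 2 + v ^ 2) := by
      gcongr
      nlinarith [sq_nonneg z]
    have h4 : 5 / 2 * (z ^ 2 + v ^ 2) * (T ^ 2 + v ^ 2)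
        ≤ 8 * (v ^ 2 + e ^ 2) / T ^ 2 * ((T ^ 2 + z ^ 2) * (T ^ 2 + v ^ 2)) := by
      calc _ ≤ 8 * (v ^ 2 + e ^ 2) * (T ^ 2 + v ^ 2) := by gcongr
        _ = 8 * (v ^ 2 + e ^ 2) / T ^ 2 * (T ^ 2 * (T ^ 2 + v ^ 2)) := by field_simp
        _ ≤ _ := by gcongr
    nlinarith [sq_nonneg (T * (z - v)), sq_nonneg (v ^ 2), sq_nonneg (z * v), sq_nonneg (T * z),
      sq_nonneg (T * v)]
  calc _ = e ^ 2 * (1 - 8 * (v ^ 2 + e ^ 2) / T ^ 2) := by ring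
    _ ≤ _ := by gcongr

lemma integrable_mul_trunc (hT : 0 < T) (v : ℝ) : Integrable (fun e => e * trunc T (v + e)) γ :=
  integrable_mul_gauss_add (measurable_trunc T) (abs_trunc_le hT) v

lemma integrable_sq_trunc (hT : 0 < T) (v : ℝ) : Integrable (fun e => trunc T (v + e) ^ 2) γ :=
  integrable_gauss_add ((measurable_trunc T).pow_const 2) (abs_sq_le (abs_trunc_le hT)) v

/-- The noise is centred, so a constant may be subtracted and only increments of `trunc` matter. -/
lemma integral_mul_trunc_eq (hT : 0 < T) (v : ℝ) :
    ∫ e, e * trunc T (v + e) ∂γ = ∫ e, e * (trunc T (v + e) - trunc T v) ∂γ := by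
  have i1 : Integrable (fun e : ℝ => e * trunc T v) γ := by
    simpa using (integrable_pow_gauss 1).mul_const (trunc T v)
  have h0 : ∫ e, e ∂γ = 0 := by simp
  simp_rw [mul_sub]
  rw [integral_sub (integrable_mul_trunc hT v) i1, integral_mul_const, h0, zero_mul, sub_zero]

lemma integrable_mul_trunc_sub (hT : 0 < T) (v : ℝ) :
    Integrable (fun e => e * (trunc T (v + e) - trunc T v)) γ := by
  have i1 : Integrable (fun e : ℝ => e * trunc T v) γ := by
    simpa using (integrable_pow_gauss 1).mul_const (trunc T v)
  simp_rw [mul_sub]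
  exact (integrable_mul_trunc hT v).sub i1

lemma le_integral_mul_trunc (hT : 0 < T) (v : ℝ) :
    1 - 8 * (v ^ 2 + fourthMoment) / T ^ 2 ≤ ∫ e, e * trunc T (v + e) ∂γ := by
  rw [integral_mul_trunc_eq hT]
  have i2 := integrable_pow_gauss 2
  have i4 := integrable_pow_gauss 4
  have i24 : Integrable (fun e : ℝ => v ^ 2 * e ^ 2 + e ^ 4) γ := (i2.const_mul _).add i4
  have i5 : Integrable (fun e : ℝ => 8 * (v ^ 2 * e ^ 2 + e ^ 4) / T ^ 2) γ :=
    (i24.const_mul 8).div_const _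
  have e1 : ∫ e, (e ^ 2 - 8 * (v ^ 2 * e ^ 2 + e ^ 4) / T ^ 2) ∂γ
      = 1 - 8 * (v ^ 2 + fourthMoment) / T ^ 2 := by
    rw [integral_sub i2 i5, integral_div, integral_const_mul, integral_add (i2.const_mul _) i4,
      integral_const_mul, integral_sq_gauss, fourthMoment, mul_one]
  rw [← e1]
  exact integral_mono (i2.sub i5) (integrable_mul_trunc_sub hT v) fun e => le_mul_trunc_sub hT v e

lemma neg_one_le_integral_mul_trunc (hT : 0 < T) (v : ℝ) :
    -1 ≤ ∫ e, e * trunc T (v + e) ∂γ := by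
  rw [integral_mul_trunc_eq hT, ← integral_sq_gauss, ← integral_neg]
  refine integral_mono (integrable_pow_gauss 2).neg (integrable_mul_trunc_sub hT v) fun e => ?_
  have h1 := abs_trunc_sub_le hT (v + e) v
  rw [add_sub_cancel_left] at h1
  have h2 : |e * (trunc T (v + e) - trunc T v)| ≤ |e| * |e| := by
    rw [abs_mul]
    gcongr
  rw [abs_mul_abs_self, ← sq] at h2
  exact neg_le_of_abs_le h2

/-- For large `v` the second-order bound is void, but `trunc` is 1-Lipschitz and the integral cannot
fall below `-1`; hence the penalty `2`. -/
lemma one_sub_le_integral_mul_trunc (hT : 0 < T) {L : ℝ} (v : ℝ) :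
    1 - 8 * (4 * L ^ 2 + fourthMoment) / T ^ 2 - 2 * (if 2 * L < |v| then 1 else 0)
      ≤ ∫ e, e * trunc T (v + e) ∂γ := by
  have h4 := fourthMoment_nonneg
  split_ifs with h
  · have : 0 ≤ 8 * (4 * L ^ 2 + fourthMoment) / T ^ 2 := by positivity
    linarith [neg_one_le_integral_mul_trunc hT v]
  · refine le_trans ?_ (le_integral_mul_trunc hT v)
    have h1 : v ^ 2 ≤ 4 * L ^ 2 := by
      rw [← sq_abs]
      nlinarith [abs_nonneg v, not_lt.1 h]
    rw [mul_zero, sub_zero]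
    gcongr

end

/-! ### A lower bound for the loss of a linear combination -/

section

variable {n : ℕ} {T : ℝ}

lemma integral_sq_sub_mul_trunc (hT : 0 < T) (b v : ℝ) :
    ∫ e, (e - b * trunc T (v + e)) ^ 2 ∂γ = 1 - 2 * b * ∫ e, e * trunc T (v + e) ∂γ
      + b ^ 2 * ∫ e, trunc T (v + e) ^ 2 ∂γ := by
  have i1 := integrable_pow_gauss 2
  have i2 := (integrable_mul_trunc hT v).const_mul (2 * b)
  have i3 := (integrable_sq_trunc hT v).const_mul (b ^ 2)
  have i12 : Integrable (fun e => e ^ 2 - 2 * b * (e * trunc T (v + e))) γ := i1.sub i2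
  have e : ∀ e, (e - b * trunc T (v + e)) ^ 2 = e ^ 2 - 2 * b * (e * trunc T (v + e))
      + b ^ 2 * trunc T (v + e) ^ 2 := fun e => by ring
  simp_rw [e]
  rw [integral_add i12 i3, integral_sub i1 i2, integral_const_mul, integral_const_mul,
    integral_sq_gauss]

/-- `∑_{i ∈ I} (F (x i) (ν i) - E F (e, ν i))`. -/
noncomputable def centredSum (F : ℝ → ℝ → ℝ) (I : Finset (Fin n)) (ν x : Fin n → ℝ) : ℝ :=
  ∑ i ∈ I, (F (x i) (ν i) - ∫ e, F e (ν i) ∂γ)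

/-- Both sides are quadratic polynomials in the slope, and the error terms compare their
coefficients. They do not involve `a`, so the slope may be random. The slope is bounded above but
not below; negative slopes are replaced by `0`, which they cannot beat since noise and residual are
positively correlated. -/
lemma weighted_loss_ge (hT : 0 < T) {a L : ℝ} (ha : a < 1) (I : Finset (Fin n)) (ν x : Fin n → ℝ) :
    ∑ i ∈ I, ∫ e, (e - max a 0 * trunc T (ν i + e)) ^ 2 ∂γ
      ≤ ∑ i ∈ I, (x i - a * (ν i + x i)) ^ 2
        + (|centredSum (fun e _ => e * trunc T e) I ν x|
        + 2 * |centredSum (fun e v => e * trunc T (v + e)) I ν x|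
        + |centredSum (fun e v => trunc T (v + e) ^ 2) I ν x|
        + ∑ i ∈ I, (1 - truncWeight T (ν i + x i)) * x i ^ 2
        + I.card * (16 * (4 * L ^ 2 + fourthMoment) / T ^ 2)
        + 2 * ∑ i ∈ I, (if 2 * L < |ν i| then 1 else 0)) := by
  have h4 := fourthMoment_nonneg
  set A := ∑ i ∈ I, truncWeight T (ν i + x i) * x i ^ 2
  set B := ∑ i ∈ I, x i * trunc T (ν i + x i)
  set C := ∑ i ∈ I, truncWeight T (ν i + x i) * (ν i + x i) ^ 2
  set C' := ∑ i ∈ I, trunc T (ν i + x i) ^ 2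
  set W := ∑ i ∈ I, (1 - truncWeight T (ν i + x i)) * x i ^ 2
  set N : ℝ := ∑ i ∈ I, (if 2 * L < |ν i| then 1 else 0)
  set Bb := ∑ i ∈ I, ∫ e, e * trunc T (ν i + e) ∂γ
  set Cb := ∑ i ∈ I, ∫ e, trunc T (ν i + e) ^ 2 ∂γ
  have hW : 0 ≤ W := Finset.sum_nonneg fun i _ => mul_nonneg
    (by linarith [truncWeight_le_one T (ν i + x i)]) (sq_nonneg _)
  have hN : 0 ≤ N := Finset.sum_nonneg fun i _ => by split_ifs <;> norm_num
  have hC' : C' ≤ C := Finset.sum_le_sum fun i _ => by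
    rw [trunc_eq, mul_pow]
    have h1 := truncWeight_le_one T (ν i + x i)
    have h2 := truncWeight_nonneg T (ν i + x i)
    gcongr
    nlinarith
  have hC : 0 ≤ C := (Finset.sum_nonneg fun i _ => sq_nonneg _).trans hC'
  -- Weighting the squares before expanding turns the cross term into `x * trunc T Z`, with a
  -- bounded function of `Z`. The weight is at most `1`, so the loss only decreases, and what the
  -- term `x²` loses is the error `W`.
  have hQ : ∑ i ∈ I, truncWeight T (ν i + x i) * (x i - a * (ν i + x i)) ^ 2
      = A - 2 * a * B + a ^ 2 * C := by
    simp only [A, B, C, Finset.mul_sum, ← Finset.sum_sub_distrib, ← Finset.sum_add_distrib]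
    refine Finset.sum_congr rfl fun i _ => ?_
    rw [trunc_eq]
    ring
  have hQ0 : 0 ≤ ∑ i ∈ I, truncWeight T (ν i + x i) * (x i - a * (ν i + x i)) ^ 2 :=
    Finset.sum_nonneg fun i _ => mul_nonneg (truncWeight_nonneg _ _) (sq_nonneg _)
  have hQ1 : ∑ i ∈ I, truncWeight T (ν i + x i) * (x i - a * (ν i + x i)) ^ 2
      ≤ ∑ i ∈ I, (x i - a * (ν i + x i)) ^ 2 := Finset.sum_le_sum fun i _ =>
    mul_le_of_le_one_left (sq_nonneg _) (truncWeight_le_one _ _)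
  have htarget : ∑ i ∈ I, ∫ e, (e - max a 0 * trunc T (ν i + e)) ^ 2 ∂γ
      = I.card - 2 * max a 0 * Bb + max a 0 ^ 2 * Cb := by
    simp_rw [integral_sq_sub_mul_trunc hT]
    rw [Finset.sum_add_distrib, Finset.sum_sub_distrib, ← Finset.mul_sum, ← Finset.mul_sum,
      Finset.sum_const, nsmul_eq_mul, mul_one]
  have hDB : centredSum (fun e v => e * trunc T (v + e)) I ν x = B - Bb :=
    Finset.sum_sub_distrib _ _
  have hDC : centredSum (fun e v => trunc T (v + e) ^ 2) I ν x = C' - Cb :=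
    Finset.sum_sub_distrib _ _
  set c := 8 * (4 * L ^ 2 + fourthMoment) / T ^ 2 with hc
  have hc0 : 0 ≤ c := by positivity
  have hcc : 16 * (4 * L ^ 2 + fourthMoment) / T ^ 2 = 2 * c := by rw [hc]; ring
  have hA : I.card * (1 - c) - |centredSum (fun e _ => e * trunc T e) I ν x| - W ≤ A := by
    have h1 : ∑ i ∈ I, x i ^ 2 = A + W := by
      simp only [A, W, ← Finset.sum_add_distrib]
      exact Finset.sum_congr rfl fun i _ => by ring
    have h2 : ∑ i ∈ I, x i * trunc T (x i) ≤ ∑ i ∈ I, x i ^ 2 := Finset.sum_le_sum fun i _ => by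
      rw [trunc_eq]
      have := truncWeight_le_one T (x i)
      nlinarith [sq_nonneg (x i)]
    have h3 : (I.card : ℝ) * (1 - c) ≤ ∑ i ∈ I, ∫ e, e * trunc T e ∂γ := by
      rw [Finset.sum_const, nsmul_eq_mul]
      gcongr
      have h5 := le_integral_mul_trunc hT 0
      simp only [zero_add] at h5
      refine le_trans ?_ h5
      rw [hc]
      gcongr
      nlinarith [sq_nonneg L]
    have h4 : centredSum (fun e _ => e * trunc T e) I ν x
        = ∑ i ∈ I, x i * trunc T (x i) - ∑ i ∈ I, ∫ e, e * trunc T e ∂γ :=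
      Finset.sum_sub_distrib _ _
    have h5 := neg_abs_le (centredSum (fun e _ => e * trunc T e) I ν x)
    linarith
  -- The mean of the cross term is nearly the number of indices; this serves the case of a negative
  -- slope.
  have hBb : I.card * (1 - c) - 2 * N ≤ Bb := by
    have h1 : ∑ i ∈ I, ((1 - c) - 2 * (if 2 * L < |ν i| then 1 else 0)) ≤ Bb :=
      Finset.sum_le_sum fun i _ => one_sub_le_integral_mul_trunc hT (ν i)
    rw [Finset.sum_sub_distrib, ← Finset.mul_sum, Finset.sum_const, nsmul_eq_mul] at h1
    exact h1
  rw [htarget, hDB, hDC, hcc]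
  have hI : (0 : ℝ) ≤ I.card := by positivity
  have hIc := mul_nonneg hI hc0
  have d1 := le_abs_self (B - Bb)
  have d2 := neg_abs_le (B - Bb)
  have d3 := neg_abs_le (C' - Cb)
  have d0 := abs_nonneg (centredSum (fun e _ => e * trunc T e) I ν x)
  have d4 := abs_nonneg (C' - Cb)
  have d5 := abs_nonneg (B - Bb)
  rw [hQ] at hQ0 hQ1
  rcases le_or_gt 0 a with h0 | h0
  · rw [max_eq_left h0]
    have a2 : a ^ 2 ≤ 1 := by nlinarith
    have b1 : a * (B - Bb) ≤ |B - Bb| := by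
      calc _ ≤ a * |B - Bb| := by gcongr
        _ ≤ 1 * |B - Bb| := by gcongr
        _ = _ := one_mul _
    have b2 : -|C' - Cb| ≤ a ^ 2 * (C' - Cb) := by nlinarith
    have b3 : a ^ 2 * C' ≤ a ^ 2 * C := by gcongr
    linarith
  · rw [max_eq_right h0.le]
    have a2 : 0 ≤ a ^ 2 * C := by positivity
    rcases le_or_gt 0 B with hB | hB
    · have : 0 ≤ -2 * a * B := mul_nonneg (by linarith) hB
      linarith
    -- A negative `B` forces `Bb ≤ |B - Bb|`, so by `hBb` the number of indices is itself absorbed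
    -- by the errors.
    · linarith

lemma weight_loss_le (hT : 0 < T) {L : ℝ} (hL : 0 < L) (z y : ℝ) :
    (1 - truncWeight T z) * y ^ 2
      ≤ L ^ 2 / T ^ 2 * y ^ 2 + y ^ 4 / L ^ 2 + L ^ 2 * (if L < |z| then 1 else 0) := by
  have h1 := one_sub_truncWeight_le hT z
  have h2 := truncWeight_nonneg T z
  split_ifs with h
  · have h3 := sq_le_add_pow_four y hL
    have h4 : (1 - truncWeight T z) * y ^ 2 ≤ y ^ 2 := by nlinarith [sq_nonneg y]
    have h5 : 0 ≤ L ^ 2 / T ^ 2 * y ^ 2 := by positivity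
    linarith
  · have h3 : z ^ 2 / T ^ 2 ≤ L ^ 2 / T ^ 2 := div_le_div_of_nonneg_right
      (sq_le_sq' (neg_le_of_abs_le (not_lt.1 h)) (le_of_abs_le (not_lt.1 h))) (by positivity)
    have h4 : (1 - truncWeight T z) * y ^ 2 ≤ L ^ 2 / T ^ 2 * y ^ 2 := by
      gcongr
      exact h1.trans h3
    have h5 : 0 ≤ y ^ 4 / L ^ 2 := by positivity
    linarith

/-- Assumption 3 concerns the residuals and not the `ν_i`: if `|ν| > 2L` but `|Z| ≤ L`, the noise is
at least `L`, which is charged to its second moment. -/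
lemma indicator_large_le {L : ℝ} (hL : 0 < L) (v y : ℝ) :
    (if 2 * L < |v| then (1 : ℝ) else 0) ≤ y ^ 2 / L ^ 2 + (if L < |v + y| then 1 else 0) := by
  have h0 : 0 ≤ y ^ 2 / L ^ 2 := by positivity
  split_ifs with h1 h2 h2
  · linarith
  · have h3 : L ≤ |y| := by
      have := abs_sub_abs_le_abs_sub v (v + y)
      rw [sub_add_cancel_left, abs_neg] at this
      linarith
    have : 1 ≤ y ^ 2 / L ^ 2 := by
      rw [le_div_iff₀ (by positivity), ← sq_abs y]
      nlinarith
    linarith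
  · linarith
  · linarith

/-- The error terms of `linear_loss_ge` which come from large values. -/
noncomputable def largeError (T L : ℝ) (x : Fin n → ℝ) (N : ℝ) : ℝ :=
  ∑ i, ((L ^ 2 / T ^ 2 + 2 / L ^ 2) * x i ^ 2 + x i ^ 4 / L ^ 2)
    + n * (16 * (4 * L ^ 2 + fourthMoment) / T ^ 2) + (L ^ 2 + 2) * N

theorem linear_loss_ge (hT : 0 < T) {a L : ℝ} (ha : a < 1) (hL : 0 < L) (I : Finset (Fin n))
    (ν x : Fin n → ℝ) :
    ∑ i ∈ I, ∫ e, (e - max a 0 * trunc T (ν i + e)) ^ 2 ∂γ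
      ≤ ∑ i ∈ I, (x i - a * (ν i + x i)) ^ 2
        + (|centredSum (fun e _ => e * trunc T e) I ν x|
        + 2 * |centredSum (fun e v => e * trunc T (v + e)) I ν x|
        + |centredSum (fun e v => trunc T (v + e) ^ 2) I ν x|
        + largeError T L x ((Finset.univ.filter fun i => L < |ν i + x i|).card)) := by
  have h4 := fourthMoment_nonneg
  refine (weighted_loss_ge hT (L := L) ha I ν x).trans ?_
  have h1 : ∑ i ∈ I, (1 - truncWeight T (ν i + x i)) * x i ^ 2
      + 2 * ∑ i ∈ I, (if 2 * L < |ν i| then (1 : ℝ) else 0)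
      ≤ ∑ i, ((L ^ 2 / T ^ 2 + 2 / L ^ 2) * x i ^ 2 + x i ^ 4 / L ^ 2)
        + (L ^ 2 + 2) * (Finset.univ.filter fun i => L < |ν i + x i|).card := by
    rw [Finset.card_filter]
    push_cast
    rw [Finset.mul_sum, Finset.mul_sum, ← Finset.sum_add_distrib, ← Finset.sum_add_distrib]
    have hnn : ∀ i, 0 ≤ (L ^ 2 / T ^ 2 + 2 / L ^ 2) * x i ^ 2 + x i ^ 4 / L ^ 2
        + (L ^ 2 + 2) * (if L < |ν i + x i| then (1 : ℝ) else 0) := fun i => by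
      split_ifs <;> positivity
    refine le_trans (Finset.sum_le_sum fun i _ => ?_)
      (Finset.sum_le_univ_sum_of_nonneg hnn)
    have a1 := weight_loss_le hT hL (ν i + x i) (x i)
    have a2 := indicator_large_le hL (ν i) (x i)
    have e1 : 2 / L ^ 2 * x i ^ 2 = 2 * (x i ^ 2 / L ^ 2) := by ring
    linarith
  have h2 : I.card * (16 * (4 * L ^ 2 + fourthMoment) / T ^ 2)
      ≤ n * (16 * (4 * L ^ 2 + fourthMoment) / T ^ 2) := by
    gcongr
    exact (Finset.card_le_univ I).trans_eq (Fintype.card_fin n)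
  unfold largeError
  linarith

end

/-! ### Second moments of the error terms. -/

section

variable {n : ℕ} {Ω : Type*} [MeasurableSpace Ω] {P : Measure Ω} [IsProbabilityMeasure P]
  {μ ε : Ω → Fin n → ℝ} {t : (Fin n → ℝ) → Fin n → ℝ} {ρ : ℕ → ℝ≥0} {R : ℝ}

lemma integrable_one_add_abs : Integrable (fun e : ℝ => 1 + |e|) γ := by
  have : Integrable (fun e : ℝ => e) γ := by simpa using integrable_pow_gauss 1
  exact (integrable_const 1).add this.abs

lemma integral_one_add_abs_le : ∫ e : ℝ, (1 + |e|) ∂γ ≤ 2 := by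
  have i2 := ((integrable_const (1 : ℝ)).add (integrable_pow_gauss 2)).const_mul (1 / 2)
  have i3 : Integrable (fun e : ℝ => 1 + 1 / 2 * (1 + e ^ 2)) γ := (integrable_const 1).add i2
  calc ∫ e : ℝ, (1 + |e|) ∂γ ≤ ∫ e : ℝ, (1 + 1 / 2 * (1 + e ^ 2)) ∂γ := by
        refine integral_mono integrable_one_add_abs i3 fun e => ?_
        simp only
        rw [← sq_abs e]
        nlinarith [sq_nonneg (|e| - 1)]
    _ = 2 := by
        have i4 : Integrable (fun e : ℝ => (1 : ℝ) + e ^ 2) γ :=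
          (integrable_const 1).add (integrable_pow_gauss 2)
        rw [integral_add (integrable_const _) (i4.const_mul _), integral_const_mul,
          integral_add (integrable_const _) (integrable_pow_gauss 2), integral_sq_gauss]
        simp
        norm_num

lemma measurable_integral_gauss {F : ℝ → ℝ → ℝ} (hF : Measurable (Function.uncurry F)) :
    Measurable fun v => ∫ e, F e v ∂γ := by
  have h : StronglyMeasurable (fun p : ℝ × ℝ => F p.2 p.1) :=
    (hF.comp measurable_swap).stronglyMeasurable
  exact (h.integral_prod_right (ν := γ)).measurable

/-- The Gaussian mean of `1 + |e|` is at most `2`, so centring at most triples both constants; this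
explains `36 = 4 * 3²` and `9 = 3 * 3`. -/
theorem IsModel.integral_sq_centredSum_le (h : IsModel P μ ε) (ht : IsFilter t ρ R)
    {F : ℝ → ℝ → ℝ} (hF : Measurable (Function.uncurry F)) {b Λ : ℝ} (hb : 0 ≤ b) (hΛ : 0 ≤ Λ)
    (hFb : ∀ e v, |F e v| ≤ b * (1 + |e|))
    (hFΛ : ∀ e v v', |F e v - F e v'| ≤ Λ * (1 + |e|) * |v - v'|) (I : Finset (Fin n)) :
    Integrable (fun ω => centredSum F I (nuFun t (μ ω) (ε ω)) (ε ω) ^ 2) P ∧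
    ∫ ω, centredSum F I (nuFun t (μ ω) (ε ω)) (ε ω) ^ 2 ∂P
      ≤ n * (36 * b ^ 2 + 9 * (b * Λ * covConst * R)) := by
  have hi : ∀ v, Integrable (fun e => F e v) γ := fun v =>
    (integrable_one_add_abs.const_mul b).mono'
      (hF.comp (measurable_id.prodMk measurable_const)).aestronglyMeasurable
      (ae_of_all _ fun e => hFb e v)
  have h1 : ∀ v, |∫ e, F e v ∂γ| ≤ b * 2 := fun v => by
    refine (abs_integral_le_integral_abs).trans ?_
    calc _ ≤ ∫ e, b * (1 + |e|) ∂γ :=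
          integral_mono (hi v).abs (integrable_one_add_abs.const_mul b) fun e => hFb e v
      _ ≤ _ := by
          rw [integral_const_mul]
          exact mul_le_mul_of_nonneg_left integral_one_add_abs_le hb
  have h2 : ∀ v v', |∫ e, F e v ∂γ - ∫ e, F e v' ∂γ| ≤ Λ * 2 * |v - v'| := fun v v' => by
    rw [← integral_sub (hi v) (hi v')]
    refine (abs_integral_le_integral_abs).trans ?_
    calc _ ≤ ∫ e, Λ * |v - v'| * (1 + |e|) ∂γ :=
          integral_mono ((hi v).sub (hi v')).abs (integrable_one_add_abs.const_mul _) fun e =>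
            (hFΛ e v v').trans_eq (by ring)
      _ ≤ Λ * |v - v'| * 2 := by
          rw [integral_const_mul]
          exact mul_le_mul_of_nonneg_left integral_one_add_abs_le (by positivity)
      _ = _ := by ring
  set G : ℝ → ℝ → ℝ := fun e v => F e v - ∫ x, F x v ∂γ with hG
  have hGm : Measurable (Function.uncurry G) :=
    hF.sub ((measurable_integral_gauss hF).comp measurable_snd)
  have hGB : ∀ e v, |G e v| ≤ 3 * b * (1 + |e|) := fun e v => by
    have a1 := abs_sub (F e v) (∫ x, F x v ∂γ)
    have a2 := hFb e v
    have a3 := h1 v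
    have a4 := mul_nonneg hb (abs_nonneg e)
    simp only [G]
    linarith
  have hGΛ : ∀ e v v', |G e v - G e v'| ≤ 3 * Λ * (1 + |e|) * |v - v'| := fun e v v' => by
    have a1 := abs_sub (F e v - F e v') (∫ x, F x v ∂γ - ∫ x, F x v' ∂γ)
    have a2 := hFΛ e v v'
    have a3 := h2 v v'
    have a4 : 0 ≤ Λ * |e| * |v - v'| := by positivity
    have e1 : G e v - G e v' = F e v - F e v' - (∫ x, F x v ∂γ - ∫ x, F x v' ∂γ) := by
      simp only [G]
      ring
    rw [e1]
    linarith
  have h0 : ∀ v, ∫ e, G e v ∂γ = 0 := fun v => by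
    simp only [G]
    rw [integral_sub (hi v) (integrable_const _)]
    simp
  refine ⟨h.integrable_sq_sum ht hGm (by positivity) hGB I, ?_⟩
  refine (h.integral_sq_sum_le ht hGm (by positivity) (by positivity) hGB hGΛ h0 I).trans_eq ?_
  ring

/-- A linear bound in `x²` passes directly to expectations; `s` will be a small multiple of `n`,
while `x²` has mean of order `n` up to logarithms. -/
lemma abs_le_add_sq_div {s : ℝ} (hs : 0 < s) (x : ℝ) : |x| ≤ s + x ^ 2 / (4 * s) := by
  have h : 0 ≤ (|x| - 2 * s) ^ 2 / (4 * s) := by positivity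
  have e : (|x| - 2 * s) ^ 2 / (4 * s) = s + x ^ 2 / (4 * s) - |x| := by
    rw [← sq_abs x]
    field_simp
    ring
  linarith

lemma IsModel.integral_largeError (h : IsModel P μ ε) (ht : IsFilter t ρ R) (T L : ℝ) :
    Integrable (fun ω => largeError T L (ε ω)
      ((Finset.univ.filter fun i => L < |nuFun t (μ ω) (ε ω) i + ε ω i|).card)) P ∧
    ∫ ω, largeError T L (ε ω)
      ((Finset.univ.filter fun i => L < |nuFun t (μ ω) (ε ω) i + ε ω i|).card) ∂P
      = n * (L ^ 2 / T ^ 2 + 2 / L ^ 2 + fourthMoment / L ^ 2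
          + 16 * (4 * L ^ 2 + fourthMoment) / T ^ 2)
        + (L ^ 2 + 2) * ∑ i, P.real {ω | L < |nuFun t (μ ω) (ε ω) i + ε ω i|} := by
  unfold largeError
  simp_rw [card_large_eq L (fun ω i => nuFun t (μ ω) (ε ω) i + ε ω i)]
  have i1 : ∀ i, Integrable (fun ω => (L ^ 2 / T ^ 2 + 2 / L ^ 2) * ε ω i ^ 2
      + ε ω i ^ 4 / L ^ 2) P := fun i =>
    ((h.integrable_eps_pow i 2).const_mul _).add ((h.integrable_eps_pow i 4).div_const _)
  have i3 : ∀ i, Integrable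
      (fun ω => {ω | L < |nuFun t (μ ω) (ε ω) i + ε ω i|}.indicator (fun _ => (1 : ℝ)) ω) P :=
    fun i => (integrable_const (1 : ℝ)).indicator (h.measurableSet_large ht L i)
  have i4 : Integrable (fun ω => ∑ i, {ω | L < |nuFun t (μ ω) (ε ω) i + ε ω i|}.indicator
      (fun _ => (1 : ℝ)) ω) P := integrable_finsetSum _ fun i _ => i3 i
  have i5 := integrable_finsetSum Finset.univ fun i _ => i1 i
  have i6 : Integrable (fun ω => ∑ i, ((L ^ 2 / T ^ 2 + 2 / L ^ 2) * ε ω i ^ 2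
      + ε ω i ^ 4 / L ^ 2) + n * (16 * (4 * L ^ 2 + fourthMoment) / T ^ 2)) P :=
    i5.add (integrable_const _)
  refine ⟨i6.add (i4.const_mul _), ?_⟩
  rw [integral_add i6 (i4.const_mul _), integral_add i5 (integrable_const _),
    integral_finsetSum _ fun i _ => i1 i, integral_const_mul (L ^ 2 + 2),
    integral_finsetSum _ fun i _ => i3 i]
  have e1 : ∀ i, ∫ ω, {ω | L < |nuFun t (μ ω) (ε ω) i + ε ω i|}.indicator (fun _ => (1 : ℝ)) ω ∂P
      = P.real {ω | L < |nuFun t (μ ω) (ε ω) i + ε ω i|} := fun i => by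
    rw [integral_indicator_const _ (h.measurableSet_large ht L i)]; simp
  have e2 : ∀ i, ∫ ω, ((L ^ 2 / T ^ 2 + 2 / L ^ 2) * ε ω i ^ 2 + ε ω i ^ 4 / L ^ 2) ∂P
      = L ^ 2 / T ^ 2 + 2 / L ^ 2 + fourthMoment / L ^ 2 := fun i => by
    rw [integral_add ((h.integrable_eps_pow i 2).const_mul _)
      ((h.integrable_eps_pow i 4).div_const _), integral_const_mul, integral_div,
      h.integral_eps_sq, h.integral_eps_four, mul_one]
  simp_rw [e1, e2]
  simp
  ring

/-- The error terms of `linear_loss_ge`. -/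
noncomputable def lossError (s T L : ℝ) (I : Finset (Fin n)) (ν x : Fin n → ℝ) : ℝ :=
  4 * s + (4 * s)⁻¹ * (centredSum (fun e _ => e * trunc T e) I ν x ^ 2
    + 2 * centredSum (fun e v => e * trunc T (v + e)) I ν x ^ 2
    + centredSum (fun e v => trunc T (v + e) ^ 2) I ν x ^ 2)
    + largeError T L x ((Finset.univ.filter fun i => L < |ν i + x i|).card)

lemma largeError_nonneg (T L : ℝ) (x : Fin n → ℝ) {N : ℝ} (hN : 0 ≤ N) :
    0 ≤ largeError T L x N := by
  have := fourthMoment_nonneg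
  unfold largeError
  have h : ∀ i, 0 ≤ (L ^ 2 / T ^ 2 + 2 / L ^ 2) * x i ^ 2 + x i ^ 4 / L ^ 2 := fun i => by
    positivity
  have := Finset.sum_nonneg fun i (_ : i ∈ Finset.univ) => h i
  positivity

lemma lossError_nonneg {s : ℝ} (hs : 0 < s) (T L : ℝ) (I : Finset (Fin n)) (ν x : Fin n → ℝ) :
    0 ≤ lossError s T L I ν x := by
  have := largeError_nonneg T L x (N := (Finset.univ.filter fun i => L < |ν i + x i|).card)
    (by positivity)
  unfold lossError
  positivity

lemma linear_loss_ge_sub_lossError {s T a L : ℝ} (hs : 0 < s) (hT : 0 < T) (ha : a < 1)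
    (hL : 0 < L) (I : Finset (Fin n)) (ν x : Fin n → ℝ) :
    ∑ i ∈ I, ∫ e, (e - max a 0 * trunc T (ν i + e)) ^ 2 ∂γ
      ≤ ∑ i ∈ I, (x i - a * (ν i + x i)) ^ 2 + lossError s T L I ν x := by
  refine (linear_loss_ge hT ha hL I ν x).trans ?_
  have h1 := abs_le_add_sq_div hs (centredSum (fun e _ => e * trunc T e) I ν x)
  have h2 := abs_le_add_sq_div hs (centredSum (fun e v => e * trunc T (v + e)) I ν x)
  have h3 := abs_le_add_sq_div hs (centredSum (fun e v => trunc T (v + e) ^ 2) I ν x)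
  rw [div_eq_inv_mul] at h1 h2 h3
  unfold lossError
  linarith

lemma IsModel.integral_lossError_le (h : IsModel P μ ε) (ht : IsFilter t ρ R) (hn : 0 < n)
    {s T : ℝ} (L : ℝ) (hs : 0 < s) (hT : 1 ≤ T) (I : Finset (Fin n)) :
    Integrable (fun ω => lossError s T L I (nuFun t (μ ω) (ε ω)) (ε ω)) P ∧
    ∫ ω, lossError s T L I (nuFun t (μ ω) (ε ω)) (ε ω) ∂P
      ≤ 4 * s + s⁻¹ * (n * (36 * T ^ 4 + 18 * T ^ 3 * covConst * R))
        + (n * (L ^ 2 / T ^ 2 + 2 / L ^ 2 + fourthMoment / L ^ 2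
          + 16 * (4 * L ^ 2 + fourthMoment) / T ^ 2)
        + (L ^ 2 + 2) * ∑ i, P.real {ω | L < |nuFun t (μ ω) (ε ω) i + ε ω i|}) := by
  have hT0 : 0 < T := by linarith
  have hR := ht.nonneg ⟨0, hn⟩
  have hC := covConst_nonneg
  have hTT : T ≤ T ^ 2 := by nlinarith
  have hm := measurable_trunc T
  obtain ⟨i1, b1⟩ := h.integral_sq_centredSum_le ht (F := fun e _ => e * trunc T e)
    (b := T ^ 2) (Λ := 2 * T) (by unfold Function.uncurry; fun_prop) (by positivity) (by positivity)
    (fun e _ => by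
      rw [abs_mul, mul_comm]
      have := abs_nonneg e
      gcongr
      · exact (abs_trunc_le hT0 e).trans hTT
      · linarith)
    (fun e v v' => by rw [sub_self, abs_zero]; positivity) I
  obtain ⟨i2, b2⟩ := h.integral_sq_centredSum_le ht (F := fun e v => e * trunc T (v + e))
    (b := T ^ 2) (Λ := 2 * T) (by unfold Function.uncurry; fun_prop) (by positivity) (by positivity)
    (fun e v => by
      rw [abs_mul, mul_comm]
      have := abs_nonneg e
      gcongr
      · exact (abs_trunc_le hT0 (v + e)).trans hTT
      · linarith)
    (fun e v v' => by
      rw [← mul_sub, abs_mul]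
      have := abs_nonneg e
      have h1 := abs_trunc_sub_le hT0 (v + e) (v' + e)
      rw [add_sub_add_right_eq_sub] at h1
      gcongr
      nlinarith) I
  obtain ⟨i3, b3⟩ := h.integral_sq_centredSum_le ht (F := fun e v => trunc T (v + e) ^ 2)
    (b := T ^ 2) (Λ := 2 * T) (by unfold Function.uncurry; fun_prop) (by positivity) (by positivity)
    (fun e v => by
      refine (abs_sq_le (abs_trunc_le hT0) (v + e)).trans ?_
      have : 0 ≤ T ^ 2 * |e| := by positivity
      linarith)
    (fun e v v' => by
      have h1 := abs_trunc_sub_le hT0 (v + e) (v' + e)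
      rw [add_sub_add_right_eq_sub] at h1
      have h2 : |trunc T (v + e) + trunc T (v' + e)| ≤ 2 * T := by
        linarith [abs_add_le (trunc T (v + e)) (trunc T (v' + e)), abs_trunc_le hT0 (v + e),
          abs_trunc_le hT0 (v' + e)]
      rw [sq_sub_sq, abs_mul]
      have h3 : 0 ≤ |v - v'| * (T * |e|) := by positivity
      calc _ ≤ 2 * T * |v - v'| := by gcongr
        _ ≤ _ := by linarith) I
  obtain ⟨i4, b4⟩ := h.integral_largeError ht T L
  have j2 := i2.const_mul 2
  have i12 : Integrable (fun ω => centredSum (fun e _ => e * trunc T e) I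
      (nuFun t (μ ω) (ε ω)) (ε ω) ^ 2
    + 2 * centredSum (fun e v => e * trunc T (v + e)) I (nuFun t (μ ω) (ε ω)) (ε ω) ^ 2) P :=
    i1.add j2
  have i123 := (i12.add i3).const_mul (4 * s)⁻¹
  have i0123 : Integrable (fun ω => 4 * s + (4 * s)⁻¹ *
    (centredSum (fun e _ => e * trunc T e) I (nuFun t (μ ω) (ε ω)) (ε ω) ^ 2
    + 2 * centredSum (fun e v => e * trunc T (v + e)) I (nuFun t (μ ω) (ε ω)) (ε ω) ^ 2
    + centredSum (fun e v => trunc T (v + e) ^ 2) I (nuFun t (μ ω) (ε ω)) (ε ω) ^ 2)) P :=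
    (integrable_const (4 * s)).add i123
  refine ⟨i0123.add i4, ?_⟩
  unfold lossError
  rw [integral_add i0123 i4, b4]
  gcongr
  have i123' : Integrable (fun ω =>
    (centredSum (fun e _ => e * trunc T e) I (nuFun t (μ ω) (ε ω)) (ε ω) ^ 2
    + 2 * centredSum (fun e v => e * trunc T (v + e)) I (nuFun t (μ ω) (ε ω)) (ε ω) ^ 2
    + centredSum (fun e v => trunc T (v + e) ^ 2) I (nuFun t (μ ω) (ε ω)) (ε ω) ^ 2)) P :=
    i12.add i3
  rw [integral_add (integrable_const _) (i123'.const_mul _), integral_const_mul (4 * s)⁻¹,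
    integral_add i12 i3, integral_add i1 j2, integral_const_mul 2, integral_const]
  simp only [probReal_univ, one_smul]
  have e1 : s⁻¹ * (n * (36 * T ^ 4 + 18 * T ^ 3 * covConst * R))
      = (4 * s)⁻¹ * (4 * (n * (36 * (T ^ 2) ^ 2 + 9 * (T ^ 2 * (2 * T) * covConst * R)))) := by
    field_simp
    ring
  rw [e1]
  gcongr
  linarith

end

section

variable {Ω : ℕ → Type*} [∀ n, MeasurableSpace (Ω n)] {P : ∀ n, Measure (Ω n)}
  [∀ n, IsProbabilityMeasure (P n)] {μ ε : ∀ n, Ω n → Fin n → ℝ}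
  {t : ∀ n, (Fin n → ℝ) → Fin n → ℝ} {ρ : ℕ → ℝ≥0} {R : ℝ}

lemma tendsto_lossRate : Tendsto (fun L : ℝ => L ^ 2 / (L ^ 3) ^ 2 + 2 / L ^ 2
    + fourthMoment / L ^ 2 + 16 * (4 * L ^ 2 + fourthMoment) / (L ^ 3) ^ 2
    + (L ^ 2 + 2) * (1 / L ^ 8)) atTop (𝓝 0) := by
  have hinv : ∀ k : ℕ, k ≠ 0 → Tendsto (fun L : ℝ => (L ^ k)⁻¹) atTop (𝓝 0) := fun k hk =>
    (tendsto_pow_atTop hk).inv_tendsto_atTop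
  have h := ((((hinv 4 (by norm_num)).const_mul 65).add
    ((hinv 2 (by norm_num)).const_mul (2 + fourthMoment))).add
    ((hinv 6 (by norm_num)).const_mul (16 * fourthMoment + 1))).add
    ((hinv 8 (by norm_num)).const_mul 2)
  simp only [mul_zero, add_zero] at h
  refine h.congr' ?_
  filter_upwards [eventually_gt_atTop 0] with L hL
  field_simp
  ring

/-- The order of the quantifiers is the point: one error `E` serves all slopes below `1` at once.
With `T = L³` the concentration error is of order `L^12/n` per index, and truncation and large
values vanish as powers of `L`. -/
theorem eventually_exists_lossError (h : ∀ n, IsModel (P n) (μ n) (ε n))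
    (ht : ∀ n, IsFilter (t n) ρ R) (h3 : Assumption3 P μ ε t) {θ : ℝ} (hθ : 0 < θ) :
    ∀ᶠ n : ℕ in atTop, ∀ I : Finset (Fin n), ∃ E : Ω n → ℝ, Integrable E (P n) ∧ (∀ ω, 0 ≤ E ω) ∧
      ∫ ω, E ω ∂(P n) ≤ θ * n ∧ ∀ ω, ∀ a < 1,
        ∑ i ∈ I, ∫ e, (e - max a 0 * trunc (Real.log n ^ 3)
          (nuFun (t n) (μ n ω) (ε n ω) i + e)) ^ 2 ∂γ
        ≤ ∑ i ∈ I, (ε n ω i - a * (nuFun (t n) (μ n ω) (ε n ω) i + ε n ω i)) ^ 2 + E ω := by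
  have hC := covConst_nonneg
  have T12 := (tendsto_log_pow_div 12).const_mul ((θ / 8)⁻¹ * 36)
  have T9 := (tendsto_log_pow_div 9).const_mul ((θ / 8)⁻¹ * (18 * covConst * R))
  have T1 := (T12.add T9).add (tendsto_lossRate.comp tendsto_log_natCast)
  simp only [mul_zero, add_zero] at T1
  filter_upwards [eventually_gt_atTop 0, tendsto_log_natCast.eventually_ge_atTop 1,
    (tendsto_order.1 T1).2 (θ / 2) (by positivity), h3] with n hn hL hsmall h3n I
  have hn' : (0 : ℝ) < n := by exact_mod_cast hn
  simp only [Function.comp_apply] at hsmall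
  set L := Real.log n
  have hL0 : 0 < L := by linarith
  have hs : 0 < θ / 8 * n := by positivity
  have hT : 1 ≤ L ^ 3 := one_le_pow₀ hL
  obtain ⟨hi, hint⟩ := (h n).integral_lossError_le (ht n) hn L hs hT I
  refine ⟨_, hi, fun ω => lossError_nonneg hs _ _ _ _ _, hint.trans ?_, fun ω a ha =>
    linear_loss_ge_sub_lossError hs (by positivity) ha hL0 I _ _⟩
  have h4 : ∑ i, (P n).real {ω | L < |nuFun (t n) (μ n ω) (ε n ω) i + ε n ω i|}
      ≤ n * (1 / L ^ 8) := by
    rw [inv_mul_le_iff₀ hn'] at h3n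
    simpa only [resid_eq] using h3n
  have e1 : (θ / 8 * n)⁻¹ * (n * (36 * (L ^ 3) ^ 4 + 18 * (L ^ 3) ^ 3 * covConst * R))
      = ((θ / 8)⁻¹ * 36 * (L ^ 12 / n) + (θ / 8)⁻¹ * (18 * covConst * R) * (L ^ 9 / n)) * n := by
    field_simp
  rw [e1]
  set r1 := (θ / 8)⁻¹ * 36 * (L ^ 12 / n) + (θ / 8)⁻¹ * (18 * covConst * R) * (L ^ 9 / n)
  set r2 := L ^ 2 / (L ^ 3) ^ 2 + 2 / L ^ 2 + fourthMoment / L ^ 2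
    + 16 * (4 * L ^ 2 + fourthMoment) / (L ^ 3) ^ 2
  calc _ ≤ 4 * (θ / 8 * n) + r1 * n + (n * r2 + (L ^ 2 + 2) * (n * (1 / L ^ 8))) := by gcongr
    _ = θ / 2 * n + (r1 + (r2 + (L ^ 2 + 2) * (1 / L ^ 8))) * n := by ring
    _ ≤ θ / 2 * n + θ / 2 * n := by
        gcongr
    _ = θ * n := by ring

end

/-! ### The risk of estimators which are nearly linear in the residuals -/

section

/-- The indices away from the ends, `κ n ≤ i ≤ (1 - κ) n` when counted from `1`. -/
noncomputable def central (κ : ℝ) (n : ℕ) : Finset (Fin n) :=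
  Finset.univ.filter fun i => κ * n ≤ ((i : ℕ) : ℝ) + 1 ∧ ((i : ℕ) : ℝ) + 1 ≤ (1 - κ) * n

lemma card_le_of_val_lt {n : ℕ} {x : ℝ} (hx : 0 ≤ x) (s : Finset (Fin n))
    (hs : ∀ i ∈ s, ((i : ℕ) : ℝ) < x) : (s.card : ℝ) ≤ x + 1 := by
  have h : s.card ≤ (Finset.range ⌈x⌉₊).card := by
    refine Finset.card_le_card_of_injOn (fun i => (i : ℕ)) (fun i hi => ?_)
      (fun i _ j _ hij => Fin.ext hij)
    simp only [Finset.coe_range, Set.mem_Iio]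
    exact Nat.lt_ceil.2 (hs i hi)
  rw [Finset.card_range] at h
  calc (s.card : ℝ) ≤ ⌈x⌉₊ := by exact_mod_cast h
    _ ≤ x + 1 := (Nat.ceil_lt_add_one hx).le

lemma card_compl_central_le {κ : ℝ} (hκ : 0 ≤ κ) (n : ℕ) :
    (((central κ n)ᶜ).card : ℝ) ≤ 2 * κ * n + 2 := by
  classical
  set s : Finset (Fin n) := Finset.univ.filter fun i => ((i : ℕ) : ℝ) < κ * n
  set s' : Finset (Fin n) := Finset.univ.filter fun i => ((Fin.rev i : ℕ) : ℝ) < κ * n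
  have hsub : (central κ n)ᶜ ⊆ s ∪ s' := fun i hi => by
    simp only [central, Finset.mem_compl, Finset.mem_filter, Finset.mem_univ, true_and, not_and_or,
      not_le] at hi
    simp only [s, s', Finset.mem_union, Finset.mem_filter, Finset.mem_univ, true_and]
    rcases hi with hi | hi
    · left; linarith
    · right
      have h1 : (i : ℕ) + 1 ≤ n := i.2
      rw [Fin.val_rev, Nat.cast_sub h1]
      push_cast
      linarith
  have hx : 0 ≤ κ * n := by positivity
  have h1 := card_le_of_val_lt hx s fun i hi => (Finset.mem_filter.1 hi).2
  have h2 : (s'.card : ℝ) ≤ κ * n + 1 := by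
    have e : s'.card = (s'.map Fin.revPerm.toEmbedding).card := (Finset.card_map _).symm
    rw [e]
    refine card_le_of_val_lt hx _ fun i hi => ?_
    obtain ⟨j, hj, rfl⟩ := Finset.mem_map.1 hi
    exact (Finset.mem_filter.1 hj).2
  have h3 : (((central κ n)ᶜ).card : ℝ) ≤ s.card + s'.card := by
    exact_mod_cast (Finset.card_le_card hsub).trans (Finset.card_union_le _ _)
  linarith

end

section

variable {n : ℕ} {Ω : Type*} [MeasurableSpace Ω] {P : Measure Ω} [IsProbabilityMeasure P]
  {μ ε : Ω → Fin n → ℝ} {t : (Fin n → ℝ) → Fin n → ℝ} {ρ : ℕ → ℝ≥0} {R : ℝ}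

/-- The function may take negative values; it will be a lower bound for a loss, from which error
terms have been subtracted. -/
lemma ofReal_integral_le_lintegral {Ω : Type*} [MeasurableSpace Ω] {P : Measure Ω}
    {f : Ω → ℝ} (hf : Integrable f P) :
    ENNReal.ofReal (∫ ω, f ω ∂P) ≤ ∫⁻ ω, ENNReal.ofReal (f ω) ∂P := by
  rw [integral_eq_lintegral_pos_part_sub_lintegral_neg_part hf]
  exact ENNReal.ofReal_le_of_le_toReal (sub_le_self _ ENNReal.toReal_nonneg)

/-- With `m = max f η` the integrand is `(f'²/m)(f/m - 2)` and `f ≤ m`. It keeps the regularised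
risk below `(1 + o(1)) n`. -/
lemma gain_regScore_nonpos {η : ℝ} (hη : 0 < η) (ν : Fin n → ℝ) :
    gain Finset.univ ν (regScore η ν) ≤ 0 := by
  refine integral_nonpos fun z => ?_
  rw [fPart_univ, fPartDeriv_univ]
  have hm : 0 < max (fZ ν z) η := lt_max_of_lt_right hη
  have h1 : fZ ν z / max (fZ ν z) η ≤ 1 := (div_le_one hm).2 (le_max_left _ _)
  have h2 : 0 ≤ fZderiv ν z ^ 2 / max (fZ ν z) η := by positivity
  have e : -2 * (regScore η ν z * fZderiv ν z) + regScore η ν z ^ 2 * fZ ν z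
      = fZderiv ν z ^ 2 / max (fZ ν z) η * (fZ ν z / max (fZ ν z) η - 2) := by
    unfold regScore
    field_simp
    ring
  simp only [Pi.zero_apply]
  rw [e]
  nlinarith

lemma IsModel.measurable_obs {Ω : Type*} [MeasurableSpace Ω] {P : Measure Ω}
    {μ ε : Ω → Fin n → ℝ} (h : IsModel P μ ε) : Measurable (obs μ ε) :=
  measurable_pi_lambda _ fun i => ((measurable_pi_apply i).comp h.measurable_mu).add
    ((measurable_pi_apply i).comp h.measurable_eps)

lemma measurable_scoreGap (η : ℝ) (I : Finset (Fin n)) {ν : Ω → Fin n → ℝ} (hν : Measurable ν)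
    {w : Ω → ℝ → ℝ} (hw : Measurable (Function.uncurry w)) :
    Measurable fun p : Ω × ℝ => scoreGap η I (ν p.1) (w p.1) p.2 := by
  have h1 : Measurable fun p : Ω × ℝ => (ν p.1, p.2) :=
    (hν.comp measurable_fst).prodMk measurable_snd
  have h2 := (measurable_fZ (n := n)).comp h1
  have h3 := (measurable_fZderiv (n := n)).comp h1
  have h4 : Measurable fun p : Ω × ℝ => fPart I (ν p.1) p.2 := by
    unfold fPart
    refine Measurable.const_mul ?_ _
    refine Finset.measurable_fun_sum _ fun i _ => measurable_phi.comp ?_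
    exact measurable_snd.sub ((measurable_pi_apply i).comp (hν.comp measurable_fst))
  exact Measurable.ite (measurableSet_le measurable_const h2) ((h3.add (hw.mul h4)).pow_const 2)
    measurable_const

lemma integrable_integral_scoreGap (η : ℝ) (I : Finset (Fin n)) {ν : Ω → Fin n → ℝ}
    (hν : Measurable ν) {w : Ω → ℝ → ℝ} (hw : Measurable (Function.uncurry w)) {T : ℝ}
    (hT : ∀ ω z, |w ω z| ≤ T) : Integrable (fun ω => ∫ z, scoreGap η I (ν ω) (w ω) z) P := by
  refine (integrable_const (2 + 2 * T ^ 2)).mono'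
    ((measurable_scoreGap η I hν hw).stronglyMeasurable.integral_prod_right
      (ν := volume)).aestronglyMeasurable (ae_of_all _ fun ω => ?_)
  rw [Real.norm_of_nonneg (integral_nonneg fun z => scoreGap_nonneg _ _ _ _ _)]
  have hcard : ∀ J : Finset (Fin n), (J.card : ℝ) / n ≤ 1 := fun J =>
    div_le_one_of_le₀ (by exact_mod_cast (Finset.card_le_univ J).trans_eq (Fintype.card_fin n))
      (by positivity)
  have i1 := (integrable_fPart Finset.univ (ν ω)).const_mul 2
  have i2 := (integrable_fPart I (ν ω)).const_mul (2 * T ^ 2)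
  calc _ ≤ ∫ z, (2 * fPart Finset.univ (ν ω) z + 2 * T ^ 2 * fPart I (ν ω) z) :=
        integral_mono (integrable_scoreGap η I (ν ω) (hw.comp measurable_prodMk_left) (hT ω))
          (i1.add i2) fun z => scoreGap_le η I (ν ω) (hT ω z)
    _ ≤ _ := by
        rw [integral_add i1 i2, integral_const_mul, integral_const_mul, integral_fPart,
          integral_fPart]
        have a1 := hcard Finset.univ
        have a2 := mul_le_mul_of_nonneg_left (hcard I) (by positivity : 0 ≤ 2 * T ^ 2)
        linarith

end

/-! ### Lower bounds for the risk of the competing estimator. -/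

section

variable {Ω : ℕ → Type*} [∀ n, MeasurableSpace (Ω n)] {P : ∀ n, Measure (Ω n)}
  [∀ n, IsProbabilityMeasure (P n)] {μ ε : ∀ n, Ω n → Fin n → ℝ}
  {t m : ∀ n, (Fin n → ℝ) → Fin n → ℝ} {α : ∀ n, (Fin n → ℝ) → ℝ} {ρ : ℕ → ℝ≥0} {R : ℝ}

/-- The integrated squared distance between the score and the linear rule with slope `α`, over
the indices in `I`. -/
noncomputable def linearGap {n : ℕ} (L a : ℝ) (I : Finset (Fin n)) (ν : Fin n → ℝ) : ℝ :=
  ∫ z, scoreGap (L ^ 24)⁻¹ I ν (fun z => max a 0 * trunc (L ^ 3) z) z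

lemma integral_linear_loss_eq {n : ℕ} (hn : 0 < n) {T b : ℝ} (hT : 0 < T)
    (hb0 : 0 ≤ b) (hb1 : b ≤ 1) (I : Finset (Fin n)) (ν : Fin n → ℝ) :
    ∑ i ∈ I, ∫ e, (e - b * trunc T (ν i + e)) ^ 2 ∂γ
      = I.card + n * gain I ν (fun z => -(b * trunc T z)) := by
  rw [← sum_integral_eq_gain hn I ν (s := fun z => -(b * trunc T z)) (C := T)
    ((measurable_trunc T).const_mul b).neg]
  · simp only [sub_eq_add_neg]
  · intro z
    rw [abs_neg, abs_mul, abs_of_nonneg hb0]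
    exact (mul_le_of_le_one_left (abs_nonneg _) hb1).trans (abs_trunc_le hT z)

lemma gain_add_linearGap_le {n : ℕ} (hn : 0 < n) {L a lam : ℝ} (hL : 0 < L) (ha : a < 1)
    (hlam : 0 < lam) (I : Finset (Fin n)) (ν : Fin n → ℝ) :
    n * (1 + gain Finset.univ ν (regScore (L ^ 24)⁻¹ ν) + linearGap L a I ν)
      ≤ ∑ i ∈ I, ∫ e, (e - max a 0 * trunc (L ^ 3) (ν i + e)) ^ 2 ∂γ
        + ((3 + lam⁻¹) * (Iᶜ.card : ℝ)
          + n * (lam * fourthMoment + 4 / L ^ 2 + 2 / L)) := by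
  have hn' : (0 : ℝ) < n := by exact_mod_cast hn
  have hb0 : 0 ≤ max a 0 := le_max_right _ _
  have hb1 : max a 0 ≤ 1 := max_le ha.le zero_le_one
  have hT : 0 < L ^ 3 := by positivity
  -- The level `κ²` is `η = L^(-24)`. Any `M` between `T² = L^6` and `1/(T κ) = L^9` balances the
  -- two low-density errors; `L^7` leaves `4/L²` and `2/L`.
  have h := gain_regScore_add_gap_le hn I ν (κ := (L ^ 12)⁻¹) (M := L ^ 7) (T := L ^ 3)
    (w := fun z => max a 0 * trunc (L ^ 3) z) (by positivity) (by positivity)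
    ((measurable_trunc _).const_mul _)
    (fun z => by
      rw [abs_mul, abs_of_nonneg hb0]
      exact (mul_le_of_le_one_left (abs_nonneg _) hb1).trans (abs_trunc_le hT z))
    (fun z => by
      rw [abs_mul, abs_of_nonneg hb0]
      refine le_trans ?_ (abs_mul_abs_trunc_le hT z)
      gcongr
      exact mul_le_of_le_one_left (abs_nonneg _) hb1) hlam
  have e1 : ((L ^ 12)⁻¹) ^ 2 = (L ^ 24)⁻¹ := by rw [inv_pow, ← pow_mul]
  have e2 : 4 * L ^ 7 * L ^ 3 * (L ^ 12)⁻¹ = 4 / L ^ 2 := by field_simp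
  have e3 : 2 * (L ^ 3) ^ 2 / L ^ 7 = 2 / L := by field_simp
  rw [e1, e2, e3] at h
  rw [integral_linear_loss_eq hn hT hb0 hb1]
  have hc : (Iᶜ.card : ℝ) + I.card = n := by
    have := Finset.card_compl_add_card I
    rw [Fintype.card_fin] at this
    exact_mod_cast this
  have h' := mul_le_mul_of_nonneg_left h hn'.le
  have e4 : (n : ℝ) * ((2 + lam⁻¹) * ((Iᶜ.card : ℝ) / n)) = (2 + lam⁻¹) * Iᶜ.card := by
    field_simp
  unfold linearGap
  linarith

lemma IsModel.integrable_linearGap {n : ℕ} {Ω : Type*} [MeasurableSpace Ω] {P : Measure Ω}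
    [IsProbabilityMeasure P] {μ ε : Ω → Fin n → ℝ} {t : (Fin n → ℝ) → Fin n → ℝ}
    (h : IsModel P μ ε) (ht : IsFilter t ρ R) {a : Ω → ℝ} (ha : Measurable a) (ha1 : ∀ ω, a ω < 1)
    {L : ℝ} (hL : 0 < L) (I : Finset (Fin n)) :
    Integrable (fun ω => linearGap L (a ω) I (nuFun t (μ ω) (ε ω))) P := by
  have hw : Measurable (Function.uncurry fun ω z => max (a ω) 0 * trunc (L ^ 3) z) :=
    ((ha.max measurable_const).comp measurable_fst).mul
      ((measurable_trunc _).comp measurable_snd)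
  refine integrable_integral_scoreGap (T := L ^ 3) _ I (h.measurable_nu ht) hw fun ω z => ?_
  rw [abs_mul, abs_of_nonneg (le_max_right _ _)]
  exact (mul_le_of_le_one_left (abs_nonneg _) (max_le (ha1 ω).le zero_le_one)).trans
    (abs_trunc_le (by positivity) z)

/-- The error in the linear approximation of `m`. -/
def linearResid {n : ℕ} {Ω : Type*} (μ ε : Ω → Fin n → ℝ) (t m : (Fin n → ℝ) → Fin n → ℝ)
    (α : (Fin n → ℝ) → ℝ) (i : Fin n) (ω : Ω) : ℝ :=
  m (obs μ ε ω) i - (α (obs μ ε ω) * t (obs μ ε ω) i + (1 - α (obs μ ε ω)) * obs μ ε ω i)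

lemma sq_add_ge {τ : ℝ} (hτ : 0 < τ) (x y : ℝ) :
    (1 - τ) * x ^ 2 ≤ (x + y) ^ 2 + τ⁻¹ * y ^ 2 := by
  have h : 0 ≤ τ⁻¹ * (τ * x + y) ^ 2 := by positivity
  have e : τ⁻¹ * (τ * x + y) ^ 2 = τ * x ^ 2 + 2 * x * y + τ⁻¹ * y ^ 2 := by
    field_simp
    ring
  nlinarith [sq_nonneg y]

/-- On `I` the error of `m` is `ε_i - α Z_i` plus the linear residual; Young's inequality separates
them at the price of a factor `1 - τ`. The indices outside `I` are dropped. -/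
lemma linear_loss_le_loss {n : ℕ} {Ω : Type*} (μ ε : Ω → Fin n → ℝ)
    (t m : (Fin n → ℝ) → Fin n → ℝ) (α : (Fin n → ℝ) → ℝ) {τ : ℝ} (hτ : 0 < τ)
    (I : Finset (Fin n)) (ω : Ω) :
    (1 - τ) * ∑ i ∈ I, (ε ω i - α (obs μ ε ω) * (nuFun t (μ ω) (ε ω) i + ε ω i)) ^ 2
      ≤ ∑ i, (m (obs μ ε ω) i - μ ω i) ^ 2 + τ⁻¹ * ∑ i ∈ I, linearResid μ ε t m α i ω ^ 2 := by
  have h1 : ∑ i ∈ I, (m (obs μ ε ω) i - μ ω i) ^ 2 ≤ ∑ i, (m (obs μ ε ω) i - μ ω i) ^ 2 :=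
    Finset.sum_le_univ_sum_of_nonneg fun i => sq_nonneg _
  refine le_trans ?_ (add_le_add_left h1 _)
  rw [Finset.mul_sum, Finset.mul_sum, ← Finset.sum_add_distrib]
  refine Finset.sum_le_sum fun i _ => ?_
  refine (sq_add_ge hτ _ (linearResid μ ε t m α i ω)).trans_eq ?_
  have e1 : nuFun t (μ ω) (ε ω) i = μ ω i - t (obs μ ε ω) i := rfl
  have e2 : obs μ ε ω i = μ ω i + ε ω i := rfl
  rw [e1, linearResid, e2]
  ring

/-- The regularised oracle beats the nearly linear estimator by the expected gap. Taking `c = 0`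
gives the second half of (i); a positive `c` gives (ii). All small `κ` are admitted so that the
bound can be combined with the lower bound for the gap. -/
theorem exists_risk_ge (h : ∀ n, IsModel (P n) (μ n) (ε n))
    (ht : ∀ n, IsFilter (t n) ρ R) (h3 : Assumption3 P μ ε t) (hm : ∀ n, Measurable (m n))
    (h2 : Assumption2 P μ ε t m α) {θ : ℝ} (hθ : 0 < θ) (hθ1 : θ ≤ 1) :
    ∃ κ₀ > 0, ∀ κ > 0, κ ≤ κ₀ → ∀ᶠ n : ℕ in atTop, ∀ c : ℝ, 0 ≤ c → c ≤ 1 →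
      c ≤ ∫ ω, linearGap (Real.log n) (α n (obs (μ n) (ε n) ω)) (central κ n)
        (nuFun (t n) (μ n ω) (ε n ω)) ∂(P n) →
      ENNReal.ofReal (regRisk (P n) (μ n) (ε n) (t n) (Real.log n ^ 24)⁻¹ + (c - θ) * n)
        ≤ risk (P n) (fun ω => m n (obs (μ n) (ε n) ω)) (μ n) + ENNReal.ofReal (θ * n) := by
  obtain ⟨hαm, hα1, hζ⟩ := h2
  have h4 := fourthMoment_nonneg
  -- The order of choice matters: `lam` makes the fourth-moment error small, and only then is `κ₀`
  -- taken small enough to beat the factor `lam⁻¹` on the discarded ends.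
  set lam := θ / (8 * (fourthMoment + 1)) with hlamdef
  have hlam : 0 < lam := by positivity
  have hlam4 : lam * fourthMoment ≤ θ / 8 := by
    rw [hlamdef, div_mul_eq_mul_div, div_le_div_iff₀ (by positivity) (by positivity)]
    nlinarith
  set κ₀ := θ / (24 * (3 + lam⁻¹)) with hκ₀
  refine ⟨κ₀, by positivity, fun κ hκ hκle => ?_⟩
  set τ := θ / 24 with hτdef
  have hτ : 0 < τ := by positivity
  have hτ1 : τ < 1 := by rw [hτdef]; linarith
  have T1 : Tendsto (fun L : ℝ => 4 / L ^ 2 + 2 / L) atTop (𝓝 0) := by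
    have a1 : Tendsto (fun L : ℝ => (L ^ 2)⁻¹) atTop (𝓝 0) :=
      (tendsto_pow_atTop (by norm_num)).inv_tendsto_atTop
    have := (a1.const_mul 4).add (tendsto_inv_atTop_zero.const_mul 2)
    simpa [div_eq_mul_inv] using this
  have T2 := T1.comp tendsto_log_natCast
  filter_upwards [eventually_gt_atTop 0, tendsto_log_natCast.eventually_ge_atTop 1,
    (tendsto_order.1 T2).2 (θ / 8) (by positivity),
    tendsto_natCast_atTop_atTop.eventually_ge_atTop (2 / κ),
    eventually_exists_lossError h ht h3 (θ := θ / 8) (by positivity),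
    eventually_regRisk_le h ht (θ := θ / 8) (by positivity),
    hζ κ hκ (ENNReal.ofReal (τ * θ)) (ENNReal.ofReal_pos.2 (by positivity))]
    with n hn hL hsmall hκn hloss hreg hζn c hc0 hc1 hc
  have hn' : (0 : ℝ) < n := by exact_mod_cast hn
  simp only [Function.comp_apply] at hsmall
  set L := Real.log n
  have hL0 : 0 < L := by linarith
  set I := central κ n with hI
  obtain ⟨E, hEi, -, hEint, hE⟩ := hloss I
  set a : Ω n → ℝ := fun ω => α n (obs (μ n) (ε n) ω) with ha
  have ham : Measurable a := (hαm n).comp (h n).measurable_obs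
  have ha1 : ∀ ω, a ω < 1 := fun ω => hα1 n _
  set ν : Ω n → Fin n → ℝ := fun ω => nuFun (t n) (μ n ω) (ε n ω)
  have hgi : Integrable (fun ω => gain Finset.univ (ν ω) (regScore (L ^ 24)⁻¹ (ν ω))) (P n) :=
    ((h n).regRisk_le (ht n) hn (by positivity) (inv_le_one_of_one_le₀ (one_le_pow₀ hL))).1
  have hli : Integrable (fun ω => linearGap L (a ω) I (ν ω)) (P n) :=
    (h n).integrable_linearGap (ht n) ham ha1 hL0 I
  set g := ∫ ω, gain Finset.univ (ν ω) (regScore (L ^ 24)⁻¹ (ν ω)) ∂(P n)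
  set l := ∫ ω, linearGap L (a ω) I (ν ω) ∂(P n)
  have hg0 : g ≤ 0 := integral_nonpos fun ω => gain_regScore_nonpos (by positivity) (ν ω)
  -- a lower bound for the loss
  set s := (3 + lam⁻¹) * (Iᶜ.card : ℝ) + n * (lam * fourthMoment + 4 / L ^ 2 + 2 / L)
  have hs : s ≤ 3 * (θ / 8) * n := by
    have b1 : (Iᶜ.card : ℝ) ≤ 3 * κ * n := by
      have := card_compl_central_le hκ.le n
      rw [div_le_iff₀ hκ] at hκn
      linarith
    have b2 : (3 + lam⁻¹) * (Iᶜ.card : ℝ) ≤ θ / 8 * n := by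
      calc _ ≤ (3 + lam⁻¹) * (3 * κ₀ * n) := by
            gcongr
            exact b1.trans (by gcongr)
        _ = θ / 8 * n := by
            rw [hκ₀]
            field_simp
            ring
    have b3 : n * (lam * fourthMoment + 4 / L ^ 2 + 2 / L) ≤ n * (θ / 8 + θ / 8) :=
      mul_le_mul_of_nonneg_left (by linarith) hn'.le
    linarith
  set U : Ω n → ℝ := fun ω => (1 - τ) * (n * (1 + gain Finset.univ (ν ω)
    (regScore (L ^ 24)⁻¹ (ν ω)) + linearGap L (a ω) I (ν ω)) - s - E ω) with hU
  have i1 : Integrable (fun ω => 1 + gain Finset.univ (ν ω) (regScore (L ^ 24)⁻¹ (ν ω))) (P n) :=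
    (integrable_const 1).add hgi
  have i2 : Integrable (fun ω => (1 : ℝ) + gain Finset.univ (ν ω) (regScore (L ^ 24)⁻¹ (ν ω))
    + linearGap L (a ω) I (ν ω)) (P n) := i1.add hli
  have i3 : Integrable (fun ω => n * (1 + gain Finset.univ (ν ω)
    (regScore (L ^ 24)⁻¹ (ν ω)) + linearGap L (a ω) I (ν ω)) - s) (P n) :=
    (i2.const_mul (n : ℝ)).sub (integrable_const s)
  have hUi : Integrable U (P n) := (i3.sub hEi).const_mul _
  have hUint : ∫ ω, U ω ∂(P n) = (1 - τ) * (n * (1 + g + l) - s - ∫ ω, E ω ∂(P n)) := by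
    simp only [U]
    rw [integral_const_mul, integral_sub i3 hEi, integral_sub (i2.const_mul _) (integrable_const s),
      integral_const_mul, integral_add i1 hli, integral_add (integrable_const _) hgi]
    simp [g, l]
  have hUle : ∀ ω, U ω ≤ ∑ i, (m n (obs (μ n) (ε n) ω) i - μ n ω i) ^ 2
      + τ⁻¹ * ∑ i ∈ I, linearResid (μ n) (ε n) (t n) (m n) (α n) i ω ^ 2 := fun ω => by
    refine le_trans ?_ (linear_loss_le_loss (μ n) (ε n) (t n) (m n) (α n) hτ I ω)
    simp only [U]
    refine mul_le_mul_of_nonneg_left ?_ (by linarith)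
    have c1 := gain_add_linearGap_le hn hL0 (ha1 ω) hlam I (ν ω)
    have c2 := hE ω (a ω) (ha1 ω)
    linarith
  have hlow : regRisk (P n) (μ n) (ε n) (t n) (L ^ 24)⁻¹ + (c - θ) * n ≤ ∫ ω, U ω ∂(P n) := by
    rw [hUint]
    set r := regRisk (P n) (μ n) (ε n) (t n) (L ^ 24)⁻¹
    -- An upper bound for the main term is needed because the factor `1 - τ` multiplies it: the loss
    -- is at most `3 τ n = θ n / 8`.
    have hr0 : r ≤ (1 + θ / 8) * n := by
      have : n * (1 + g) ≤ n * 1 := by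
        gcongr
        linarith
      linarith
    have hX : r - θ / 8 * n + c * n - 3 * (θ / 8) * n - θ / 8 * n
        ≤ n * (1 + g + l) - s - ∫ ω, E ω ∂(P n) := by
      have : c * n ≤ l * n := mul_le_mul_of_nonneg_right hc hn'.le
      linarith
    have hX2 := mul_le_mul_of_nonneg_left hX (by linarith : 0 ≤ 1 - τ)
    refine le_trans ?_ hX2
    have hX3 : r - θ / 8 * n + c * n - 3 * (θ / 8) * n - θ / 8 * n ≤ 3 * n := by
      have : c * n ≤ 1 * n := by gcongr
      have : 0 ≤ θ * n := by positivity
      linarith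
    have hX4 := mul_le_mul_of_nonneg_left hX3 hτ.le
    have : τ * (3 * n) = θ / 8 * n := by rw [hτdef]; ring
    have : 0 ≤ θ * n := by positivity
    linarith
  have hζm : ∀ i, Measurable fun ω => linearResid (μ n) (ε n) (t n) (m n) (α n) i ω := fun i => by
    have ho := (h n).measurable_obs
    have hap : ∀ f : (Fin n → ℝ) → Fin n → ℝ, Measurable f →
        Measurable fun ω => f (obs (μ n) (ε n) ω) i := fun f hf =>
      (measurable_pi_apply i).comp (hf.comp ho)
    exact (hap _ (hm n)).sub ((ham.mul (hap _ (ht n).measurable)).add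
      ((measurable_const.sub ham).mul ((measurable_pi_apply i).comp ho)))
  calc _ ≤ ENNReal.ofReal (∫ ω, U ω ∂(P n)) := ENNReal.ofReal_le_ofReal hlow
    _ ≤ ∫⁻ ω, ENNReal.ofReal (U ω) ∂(P n) := ofReal_integral_le_lintegral hUi
    _ ≤ ∫⁻ ω, (ENNReal.ofReal (∑ i, (m n (obs (μ n) (ε n) ω) i - μ n ω i) ^ 2)
        + ENNReal.ofReal τ⁻¹ * ∑ i ∈ I,
          ENNReal.ofReal (linearResid (μ n) (ε n) (t n) (m n) (α n) i ω ^ 2)) ∂(P n) := by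
        refine lintegral_mono fun ω => ?_
        rw [← ENNReal.ofReal_sum_of_nonneg fun i _ => sq_nonneg _,
          ← ENNReal.ofReal_mul (by positivity),
          ← ENNReal.ofReal_add (Finset.sum_nonneg fun i _ => sq_nonneg _)
            (mul_nonneg (by positivity) (Finset.sum_nonneg fun i _ => sq_nonneg _))]
        exact ENNReal.ofReal_le_ofReal (hUle ω)
    _ = risk (P n) (fun ω => m n (obs (μ n) (ε n) ω)) (μ n) + ENNReal.ofReal τ⁻¹ * ∑ i ∈ I,
          ∫⁻ ω, ENNReal.ofReal (linearResid (μ n) (ε n) (t n) (m n) (α n) i ω ^ 2) ∂(P n) := by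
        have hmi : ∀ i, Measurable fun ω =>
            ENNReal.ofReal (linearResid (μ n) (ε n) (t n) (m n) (α n) i ω ^ 2) := fun i =>
          ((hζm i).pow_const 2).ennreal_ofReal
        have hms := Finset.measurable_fun_sum I fun i _ => hmi i
        rw [lintegral_add_right _ (hms.const_mul _), lintegral_const_mul _ hms,
          lintegral_finsetSum _ fun i _ => hmi i]
        rfl
    _ ≤ _ := by
        gcongr
        calc _ ≤ ENNReal.ofReal τ⁻¹ * ∑ i ∈ I, ENNReal.ofReal (τ * θ) := by
              gcongr with i hi
              obtain ⟨-, d1, d2⟩ := Finset.mem_filter.1 hi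
              exact hζn i d1 d2
          _ ≤ ENNReal.ofReal τ⁻¹ * (n * ENNReal.ofReal (τ * θ)) := by
              rw [Finset.sum_const, nsmul_eq_mul]
              gcongr
              exact (Finset.card_le_univ I).trans_eq (Fintype.card_fin n)
          _ = ENNReal.ofReal (θ * n) := by
              rw [← ENNReal.ofReal_natCast, ← ENNReal.ofReal_mul (by positivity),
                ← ENNReal.ofReal_mul (by positivity)]
              congr 1
              field_simp

end

/-! ### Normal mixtures with a linear score -/

section

variable {G : Measure ℝ} [IsProbabilityMeasure G]

/-- The density of the convolution of `G` with the standard normal distribution. -/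
noncomputable def mixDensity (G : Measure ℝ) (z : ℝ) : ℝ := ∫ v, φ (z - v) ∂G

/-- The derivative of `mixDensity`. -/
noncomputable def mixDeriv (G : Measure ℝ) (z : ℝ) : ℝ := ∫ v, phiDeriv (z - v) ∂G

lemma abs_phi_le_one (x : ℝ) : |φ x| ≤ 1 := by
  rw [abs_of_nonneg (phi_nonneg x)]
  exact phi_le_one x

lemma integrable_phi_mix (G : Measure ℝ) [IsProbabilityMeasure G] (z : ℝ) :
    Integrable (fun v => φ (z - v)) G :=
  (integrable_const (1 : ℝ)).mono' (by fun_prop : Measurable fun v => φ (z - v)).aestronglyMeasurable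
    (ae_of_all _ fun v => abs_phi_le_one _)

lemma hasDerivAt_mixDensity (z : ℝ) : HasDerivAt (mixDensity G) (mixDeriv G z) z := by
  have h := hasDerivAt_integral_of_dominated_loc_of_deriv_le (μ := G) (𝕜 := ℝ)
    (F := fun z v => φ (z - v)) (F' := fun z v => phiDeriv (z - v)) (x₀ := z) (s := Set.univ)
    (bound := fun _ => 1) Filter.univ_mem
    (Eventually.of_forall fun x => (integrable_phi_mix G x).aestronglyMeasurable)
    (integrable_phi_mix G z)
    (by fun_prop : Measurable fun v => phiDeriv (z - v)).aestronglyMeasurable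
    (ae_of_all _ fun v x _ => abs_phiDeriv_le _) (integrable_const _)
    (ae_of_all _ fun v x _ => (hasDerivAt_phi (x - v)).comp_sub_const x v)
  exact h.2

lemma mixDensity_pos (z : ℝ) : 0 < mixDensity G z := by
  refine (integral_pos_iff_support_of_nonneg (fun v => phi_nonneg _) (integrable_phi_mix G z)).2 ?_
  have : Function.support (fun v => φ (z - v)) = Set.univ :=
    Set.eq_univ_of_forall fun v => (phi_pos _).ne'
  rw [this]
  simp

/-- Fubini; translating the inner integral splits off the factor `exp (i s v)`, so the mixture acts
as a convolution. -/
lemma integral_exp_mul_mixDensity (s : ℝ) :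
    ∫ z : ℝ, Complex.exp (s * z * Complex.I) * (mixDensity G z : ℂ)
      = charFun G s * charFun γ s := by
  set F : ℝ → ℝ → ℂ := fun v z => Complex.exp (s * z * Complex.I) * (φ (z - v) : ℂ) with hF
  have hnorm : ∀ z : ℝ, ‖Complex.exp (s * z * Complex.I)‖ = 1 := fun z => by
    rw [← Complex.ofReal_mul]
    exact Complex.norm_exp_ofReal_mul_I _
  have hFn : ∀ v z, ‖F v z‖ = φ (z - v) := fun v z => by
    rw [norm_mul, hnorm, one_mul, Complex.norm_real, Real.norm_of_nonneg (phi_nonneg _)]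
  have hFm : Measurable (Function.uncurry F) := by
    unfold Function.uncurry
    fun_prop
  have hFi : Integrable (Function.uncurry F) (G.prod volume) := by
    refine (integrable_prod_iff hFm.aestronglyMeasurable).2 ⟨ae_of_all _ fun v => ?_, ?_⟩
    · exact (integrable_phi_sub v).mono' (hFm.comp measurable_prodMk_left).aestronglyMeasurable
        (ae_of_all _ fun z => (hFn v z).le)
    · simp only [Function.uncurry, hFn, integral_phi_sub]
      exact integrable_const _
  have hγ : ∀ v : ℝ, ∫ z, F v z = Complex.exp (s * v * Complex.I) * charFun γ s := fun v => by
    rw [charFun_apply_real, integral_gaussianReal_eq_integral_smul one_ne_zero,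
      ← integral_const_mul, ← integral_sub_right_eq_self
        (fun z : ℝ => Complex.exp (s * v * Complex.I) * (φ z • Complex.exp (s * z * Complex.I))) v]
    refine integral_congr_ae (ae_of_all _ fun z => ?_)
    simp only [F, Complex.real_smul]
    have : Complex.exp (s * z * Complex.I) = Complex.exp (s * v * Complex.I)
        * Complex.exp (s * (z - v : ℝ) * Complex.I) := by
      rw [← Complex.exp_add]
      congr 1
      push_cast
      ring
    rw [this]
    ring
  calc _ = ∫ z, ∫ v, F v z ∂G := by
        refine integral_congr_ae (ae_of_all _ fun z => ?_)
        simp only [F, mixDensity]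
        rw [integral_const_mul, integral_complex_ofReal]
    _ = ∫ v, (∫ z, F v z) ∂G := (integral_integral_swap hFi).symm
    _ = _ := by
        simp_rw [hγ]
        rw [integral_mul_const, charFun_apply_real (μ := G)]

/-- The equation `f' = -a z f` integrates to a multiple of the normal density with variance `1/a`.
Since `f` is the convolution of `G` with a standard normal, dividing by the nonvanishing normal
characteristic function leaves a normal law of variance `1/a - 1`. -/
lemma eq_gaussianReal_of_linear_score {a : ℝ} (ha0 : 0 < a) (ha1 : a < 1)
    (h : ∀ z, mixDeriv G z + a * z * mixDensity G z = 0) :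
    G = gaussianReal 0 (Real.toNNReal ((1 - a) / a)) := by
  set C := mixDensity G 0
  have hconst : ∀ z, mixDensity G z * Real.exp (a * z ^ 2 / 2) = C := fun z => by
    have hd : ∀ z, HasDerivAt (fun z => mixDensity G z * Real.exp (a * z ^ 2 / 2)) 0 z := fun z => by
      have h1 : HasDerivAt (fun z : ℝ => a * z ^ 2 / 2) (a * z) z := by
        have := ((hasDerivAt_pow 2 z).const_mul a).div_const 2
        refine this.congr_deriv ?_
        push_cast
        ring
      refine ((hasDerivAt_mixDensity z).mul h1.exp).congr_deriv ?_
      linear_combination Real.exp (a * z ^ 2 / 2) * h z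
    have := is_const_of_deriv_eq_zero (fun z => (hd z).differentiableAt) (fun z => (hd z).deriv) z 0
    simpa using this
  set v : ℝ≥0 := Real.toNNReal a⁻¹ with hv
  have hva : (v : ℝ) = a⁻¹ := Real.coe_toNNReal _ (by positivity)
  have hv0 : v ≠ 0 := by
    rw [hv, Ne, Real.toNNReal_eq_zero, not_le]
    positivity
  set D := C * √(2 * Real.pi * v)
  have hpdf : ∀ z, mixDensity G z = D * gaussianPDFReal 0 v z := fun z => by
    have h1 : √(2 * Real.pi * v) ≠ 0 := by
      have : (0 : ℝ) < v := by rw [hva]; positivity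
      positivity
    have h2 : -(z - 0) ^ 2 / (2 * (v : ℝ)) = -(a * z ^ 2 / 2) := by
      rw [hva]
      field_simp
      ring
    have h3 := hconst z
    rw [gaussianPDFReal, h2, Real.exp_neg]
    simp only [D]
    rw [← h3]
    field_simp
  have hchar : ∀ s : ℝ, charFun G s * charFun γ s = D * charFun (gaussianReal 0 v) s := fun s => by
    rw [← integral_exp_mul_mixDensity, charFun_apply_real (μ := gaussianReal 0 v),
      integral_gaussianReal_eq_integral_smul hv0, ← integral_const_mul]
    refine integral_congr_ae (ae_of_all _ fun z => ?_)
    simp only [hpdf, Complex.real_smul]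
    push_cast
    ring
  -- At `s = 0` all characteristic functions equal `1`, which fixes the normalisation.
  have hD : (D : ℂ) = 1 := by
    have := hchar 0
    simpa using this.symm
  refine Measure.ext_of_charFun (funext fun s => ?_)
  have h1 := hchar s
  rw [hD, one_mul, charFun_gaussianReal, charFun_gaussianReal] at h1
  rw [charFun_gaussianReal]
  have h2 : (Real.toNNReal ((1 - a) / a) : ℝ) = v - 1 := by
    rw [hva, Real.coe_toNNReal _ (div_nonneg (by linarith) ha0.le)]
    field_simp
  have h3 : ((Real.toNNReal ((1 - a) / a) : ℝ) : ℂ) = v - 1 := by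
    rw [h2]
    push_cast
    rfl
  refine mul_right_cancel₀ (Complex.exp_ne_zero _) (h1.trans ?_)
  rw [← Complex.exp_add]
  congr 1
  rw [h3]
  push_cast
  ring

end

/-! ### Convergence in probability of the mixture densities -/

section

lemma integral_empiricalMeasure {n : ℕ} (ν : Fin n → ℝ) (f : ℝ → ℝ) :
    ∫ x, f x ∂(empiricalMeasure ν) = (n : ℝ)⁻¹ * ∑ i, f (ν i) := by
  unfold empiricalMeasure
  rw [integral_smul_measure, integral_finsetSum_measure fun i _ => integrable_dirac (by simp)]
  simp

variable {n : ℕ}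

lemma integral_empirical_phi (ν : Fin n → ℝ) (z : ℝ) :
    ∫ x, φ (z - x) ∂(empiricalMeasure ν) = fZ ν z := integral_empiricalMeasure ν _

lemma integral_empirical_phiDeriv (ν : Fin n → ℝ) (z : ℝ) :
    ∫ x, phiDeriv (z - x) ∂(empiricalMeasure ν) = fZderiv ν z := integral_empiricalMeasure ν _

lemma abs_fPart_sub_fZ_le (I : Finset (Fin n)) (ν : Fin n → ℝ) (z : ℝ) :
    |fPart I ν z - fZ ν z| ≤ (Iᶜ.card : ℝ) / n := by
  have h := fPart_add_compl I ν z
  have e : fPart I ν z - fZ ν z = -fPart Iᶜ ν z := by linarith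
  rw [e, abs_neg, abs_of_nonneg (fPart_nonneg _ _ _), fPart, div_eq_inv_mul]
  gcongr
  calc _ ≤ ∑ _i ∈ Iᶜ, (1 : ℝ) := Finset.sum_le_sum fun i _ => phi_le_one _
    _ = _ := by simp

lemma abs_trunc_sub_self_le {T : ℝ} (hT : 0 < T) (z : ℝ) : |trunc T z - z| ≤ |z| ^ 3 / T ^ 2 := by
  have h1 := one_sub_truncWeight_le hT z
  have h2 := truncWeight_le_one T z
  have e : trunc T z - z = -((1 - truncWeight T z) * z) := by
    rw [trunc_eq]
    ring
  rw [e, abs_neg, abs_mul, abs_of_nonneg (by linarith)]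
  calc _ ≤ z ^ 2 / T ^ 2 * |z| := by gcongr
    _ = _ := by
      rw [← sq_abs z]
      ring

/-- A lower bound for the distance of the score to a linear rule near a point at which the limits
of the density and of its derivative are not matched by that rule. -/
lemma linear_score_gap_le {ν : Fin n → ℝ} {I : Finset (Fin n)} {a b z₀ z f₀ d₀ δ K g : ℝ}
    (ha0 : 0 ≤ a) (ha1 : a ≤ 1) (hK : 1 + |z₀| ≤ K) (hδ1 : δ ≤ 1) (hf : |fZ ν z₀ - f₀| ≤ δ)
    (hd : |fZderiv ν z₀ - d₀| ≤ δ) (hb : |b - a| ≤ δ) (hg : |g - z| ≤ δ) (hgz : |g| ≤ |z|)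
    (hz : |z - z₀| ≤ δ) (hI : (Iᶜ.card : ℝ) / n ≤ δ) :
    |d₀ + a * z₀ * f₀| ≤ |fZderiv ν z + b * g * fPart I ν z| + 8 * K * δ := by
  have hδ : 0 ≤ δ := (abs_nonneg _).trans hf
  have a1 := (abs_fZderiv_sub_le' ν z z₀).trans hz
  have a2 := (abs_fZ_sub_le' ν z z₀).trans hz
  have a3 := (abs_fPart_sub_fZ_le I ν z).trans hI
  have hfI0 := fPart_nonneg I ν z
  have hfI1 := fPart_le_one I ν z
  have hK1 : 1 ≤ K := by linarith [abs_nonneg z₀]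
  have hgK : |g| ≤ K := by
    have := abs_sub_abs_le_abs_sub z z₀
    linarith
  have b1 : |fPart I ν z - f₀| ≤ 3 * δ := by
    rw [abs_le] at *
    constructor <;> linarith
  have b2 : |fZderiv ν z - d₀| ≤ 2 * δ := by
    rw [abs_le] at *
    constructor <;> linarith
  have b3 : |g - z₀| ≤ 2 * δ := by
    rw [abs_le] at *
    constructor <;> linarith
  have c1 : |(b - a) * g * fPart I ν z| ≤ δ * K * 1 := by
    rw [abs_mul, abs_mul, abs_of_nonneg hfI0]
    gcongr
  have c2 : |a * (g - z₀) * fPart I ν z| ≤ 1 * (2 * δ) * 1 := by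
    rw [abs_mul, abs_mul, abs_of_nonneg hfI0, abs_of_nonneg ha0]
    gcongr
  have c3 : |a * z₀ * (fPart I ν z - f₀)| ≤ 1 * K * (3 * δ) := by
    rw [abs_mul, abs_mul, abs_of_nonneg ha0]
    gcongr
    linarith
  have e : d₀ + a * z₀ * f₀ = (fZderiv ν z + b * g * fPart I ν z) - ((fZderiv ν z - d₀)
      + (b - a) * g * fPart I ν z + a * (g - z₀) * fPart I ν z
      + a * z₀ * (fPart I ν z - f₀)) := by ring
  rw [e]
  refine (abs_sub _ _).trans ?_
  have d1 := abs_add_le ((fZderiv ν z - d₀) + (b - a) * g * fPart I ν z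
    + a * (g - z₀) * fPart I ν z) (a * z₀ * (fPart I ν z - f₀))
  have d2 := abs_add_le ((fZderiv ν z - d₀) + (b - a) * g * fPart I ν z)
    (a * (g - z₀) * fPart I ν z)
  have d3 := abs_add_le (fZderiv ν z - d₀) ((b - a) * g * fPart I ν z)
  nlinarith

lemma le_integral_scoreGap {η δ D z₀ T : ℝ} (hδ : 0 ≤ δ) (hD : 0 ≤ D) (I : Finset (Fin n))
    (ν : Fin n → ℝ) {w : ℝ → ℝ} (hw : Measurable w) (hT : ∀ z, |w z| ≤ T)
    (h : ∀ z, |z - z₀| ≤ δ → η ≤ fZ ν z ∧ D ≤ |fZderiv ν z + w z * fPart I ν z|) :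
    2 * δ * D ^ 2 ≤ ∫ z, scoreGap η I ν w z := by
  have hi := integrable_scoreGap η I ν hw hT
  calc 2 * δ * D ^ 2 = ∫ z in Set.Icc (z₀ - δ) (z₀ + δ), D ^ 2 := by
        rw [setIntegral_const, Real.volume_real_Icc_of_le (by linarith), smul_eq_mul]
        ring
    _ ≤ ∫ z in Set.Icc (z₀ - δ) (z₀ + δ), scoreGap η I ν w z := by
        refine setIntegral_mono_on (integrableOn_const (by simp)) hi.integrableOn
          measurableSet_Icc fun z hz => ?_
        have hz' : |z - z₀| ≤ δ := by
          rw [abs_le]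
          constructor <;> linarith [hz.1, hz.2]
        obtain ⟨h1, h2⟩ := h z hz'
        rw [scoreGap, if_pos h1, ← sq_abs (fZderiv ν z + w z * fPart I ν z)]
        gcongr
    _ ≤ _ := setIntegral_le_integral hi (ae_of_all _ fun z => scoreGap_nonneg _ _ _ _ _)

end

section

variable {Ω : ℕ → Type*} [∀ n, MeasurableSpace (Ω n)] {P : ∀ n, Measure (Ω n)}
  [∀ n, IsProbabilityMeasure (P n)] {μ ε : ∀ n, Ω n → Fin n → ℝ}
  {t m : ∀ n, (Fin n → ℝ) → Fin n → ℝ} {α : ∀ n, (Fin n → ℝ) → ℝ} {ρ : ℕ → ℝ≥0} {R : ℝ}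

lemma TendstoInProb.eventually_real_le {Ω : ℕ → Type*} [∀ n, MeasurableSpace (Ω n)]
    {P : ∀ n, Measure (Ω n)} {X : ∀ n, Ω n → ℝ} {a : ℝ} (hX : TendstoInProb P X a)
    {δ : ℝ} (hδ : 0 < δ) {p : ℝ} (hp : 0 < p) :
    ∀ᶠ n in atTop, (P n).real {ω | δ ≤ |X n ω - a|} ≤ p := by
  filter_upwards [(tendsto_order.1 (hX δ hδ)).2 (ENNReal.ofReal p) (ENNReal.ofReal_pos.2 hp)]
    with n hn
  exact ENNReal.toReal_le_of_le_ofReal hp.le hn.le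

lemma linearGap_nonneg {n : ℕ} (L a : ℝ) (I : Finset (Fin n)) (ν : Fin n → ℝ) :
    0 ≤ linearGap L a I ν :=
  integral_nonneg fun _ => scoreGap_nonneg _ _ _ _ _

/-- All data within `δ` of their limits at one point `z₀` suffice: by Lipschitz bounds the mismatch
stays above half its limit, and the density above `2δ ≥ η`, on an interval of length `2δ` around it.
-/
lemma le_linearGap {n : ℕ} {ν : Fin n → ℝ} {I : Finset (Fin n)} {L a b z₀ f₀ d₀ δ : ℝ}
    (hL : 0 < L) (hb : b < 1) (ha0 : 0 ≤ a) (ha1 : a ≤ 1) (hδ : 0 < δ) (hδ1 : δ ≤ 1)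
    (hδf : 4 * δ ≤ f₀) (hδD : 16 * (1 + |z₀|) * δ ≤ |d₀ + a * z₀ * f₀|)
    (hf : |fZ ν z₀ - f₀| ≤ δ) (hd : |fZderiv ν z₀ - d₀| ≤ δ) (hba : |b - a| ≤ δ)
    (hI : (Iᶜ.card : ℝ) / n ≤ δ) (hη : (L ^ 24)⁻¹ ≤ δ)
    (hT : (1 + |z₀|) ^ 3 / (L ^ 3) ^ 2 ≤ δ) :
    2 * δ * (|d₀ + a * z₀ * f₀| / 2) ^ 2 ≤ linearGap L b I ν := by
  have hT0 : 0 < L ^ 3 := by positivity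
  have hb0 : 0 ≤ max b 0 := le_max_right _ _
  have hb1 : max b 0 ≤ 1 := max_le hb.le zero_le_one
  refine le_integral_scoreGap (T := L ^ 3) (z₀ := z₀) hδ.le (by positivity) I ν
    ((measurable_trunc _).const_mul _) (fun z => ?_) fun z hz => ⟨?_, ?_⟩
  · rw [abs_mul, abs_of_nonneg hb0]
    exact (mul_le_of_le_one_left (abs_nonneg _) hb1).trans (abs_trunc_le hT0 z)
  · have h1 := abs_le.1 ((abs_fZ_sub_le' ν z z₀).trans hz)
    have h2 := abs_le.1 hf
    linarith [h1.1, h2.1]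
  · have hzK : |z| ≤ 1 + |z₀| := by
      have := abs_sub_abs_le_abs_sub z z₀
      linarith
    have hg : |trunc (L ^ 3) z - z| ≤ δ := (abs_trunc_sub_self_le hT0 z).trans
      (le_trans (by gcongr) hT)
    have hgz : |trunc (L ^ 3) z| ≤ |z| := by
      rw [trunc_eq, abs_mul, abs_of_nonneg (truncWeight_nonneg _ _)]
      exact mul_le_of_le_one_left (abs_nonneg _) (truncWeight_le_one _ _)
    have hb' : |max b 0 - a| ≤ δ := by
      have := abs_max_sub_max_le_abs b a 0
      rw [max_eq_left ha0] at this
      exact this.trans hba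
    have := linear_score_gap_le (I := I) ha0 ha1 le_rfl hδ1 hf hd hb' hg hgz hz hI
    linarith

/-- A limit other than the exceptional normal law violates the linear score equation at some `z₀`.
There `f_Z` and `f_Z'` converge in probability, so the gap is bounded below on an event of
probability at least `1/2`, and it is nonnegative elsewhere. -/
theorem exists_linearGap_ge (h : ∀ n, IsModel (P n) (μ n) (ε n)) (ht : ∀ n, IsFilter (t n) ρ R)
    (hαm : ∀ n, Measurable (α n)) (hα1 : ∀ n y, α n y < 1) {a : ℝ} {G : Measure ℝ}
    [IsProbabilityMeasure G] (ha0 : 0 < a) (ha1 : a < 1)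
    (hα : TendstoInProb P (fun n ω => α n (obs (μ n) (ε n) ω)) a)
    (hF : TendstoWeaklyInProb P (fun n ω => empiricalMeasure (nu (μ n) (ε n) (t n) ω)) G)
    (hG : G ≠ gaussianReal 0 (Real.toNNReal ((1 - a) / a))) :
    ∃ c > 0, c ≤ 1 ∧ ∃ κ₁ > 0, ∀ κ > 0, κ ≤ κ₁ → ∀ᶠ n : ℕ in atTop,
      c ≤ ∫ ω, linearGap (Real.log n) (α n (obs (μ n) (ε n) ω)) (central κ n)
        (nuFun (t n) (μ n ω) (ε n ω)) ∂(P n) := by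
  obtain ⟨z₀, hz₀⟩ : ∃ z₀, mixDeriv G z₀ + a * z₀ * mixDensity G z₀ ≠ 0 := by
    by_contra! hcon
    exact hG (eq_gaussianReal_of_linear_score ha0 ha1 hcon)
  set f₀ := mixDensity G z₀
  set d₀ := mixDeriv G z₀
  set D := |d₀ + a * z₀ * f₀|
  have hD : 0 < D := abs_pos.2 hz₀
  have hf₀ : 0 < f₀ := mixDensity_pos z₀
  obtain ⟨δ, hδ, hδ1, hδf, hδD⟩ : ∃ δ > 0, δ ≤ 1 ∧ 4 * δ ≤ f₀ ∧ 16 * (1 + |z₀|) * δ ≤ D := by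
    refine ⟨min 1 (min (f₀ / 4) (D / (16 * (1 + |z₀|)))), by positivity, min_le_left _ _, ?_, ?_⟩
    · have := (min_le_right 1 (min (f₀ / 4) (D / (16 * (1 + |z₀|))))).trans (min_le_left _ _)
      linarith
    · rw [mul_comm, ← le_div_iff₀ (by positivity)]
      exact (min_le_right _ _).trans (min_le_right _ _)
  set c₁ := 2 * δ * (D / 2) ^ 2
  have hc₁ : 0 < c₁ := by positivity
  refine ⟨min (c₁ / 2) 1, by positivity, min_le_right _ _, δ / 3, by positivity,
    fun κ hκ hκδ => ?_⟩
  -- Weak convergence is tested on only two functions, the translates of `φ` and `phiDeriv` to `z₀`.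
  have hφ := hF (BoundedContinuousFunction.ofNormedAddCommGroup (fun v => φ (z₀ - v))
    (continuous_phi.comp (continuous_const.sub continuous_id)) 1 fun v => abs_phi_le_one _)
  have hφ' := hF (BoundedContinuousFunction.ofNormedAddCommGroup (fun v => phiDeriv (z₀ - v))
    (continuous_phiDeriv.comp (continuous_const.sub continuous_id)) 1 fun v => abs_phiDeriv_le _)
  simp only [BoundedContinuousFunction.coe_ofNormedAddCommGroup, integral_empirical_phi,
    integral_empirical_phiDeriv] at hφ hφ'
  have Tη : Tendsto (fun L : ℝ => (L ^ 24)⁻¹) atTop (𝓝 0) :=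
    (tendsto_pow_atTop (by norm_num)).inv_tendsto_atTop
  have TT : Tendsto (fun L : ℝ => (1 + |z₀|) ^ 3 / (L ^ 3) ^ 2) atTop (𝓝 0) :=
    tendsto_const_nhds.div_atTop
      ((tendsto_pow_atTop (by norm_num)).comp (tendsto_pow_atTop (by norm_num)))
  filter_upwards [eventually_gt_atTop 0, tendsto_log_natCast.eventually_ge_atTop 1,
    tendsto_natCast_atTop_atTop.eventually_ge_atTop (2 / κ),
    (tendsto_order.1 (Tη.comp tendsto_log_natCast)).2 δ hδ,
    (tendsto_order.1 (TT.comp tendsto_log_natCast)).2 δ hδ,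
    hα.eventually_real_le hδ (p := 1 / 8) (by norm_num),
    hφ.eventually_real_le hδ (p := 1 / 8) (by norm_num),
    hφ'.eventually_real_le hδ (p := 1 / 8) (by norm_num)] with n hn hL hκn hη hT p1 p2 p3
  have hn' : (0 : ℝ) < n := by exact_mod_cast hn
  simp only [Function.comp_apply] at hη hT
  set L := Real.log n
  have hL0 : 0 < L := by linarith
  have hI : (((central κ n)ᶜ).card : ℝ) / n ≤ δ := by
    have h1 := card_compl_central_le hκ.le n
    rw [div_le_iff₀ hκ] at hκn
    rw [div_le_iff₀ hn']
    have h2 : κ * n ≤ δ / 3 * n := by gcongr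
    linarith
  have ham : Measurable fun ω => α n (obs (μ n) (ε n) ω) := (hαm n).comp (h n).measurable_obs
  have hνm := (h n).measurable_nu (ht n)
  set ν : Ω n → Fin n → ℝ := fun ω => nuFun (t n) (μ n ω) (ε n ω)
  have hνz : Measurable fun ω => (ν ω, z₀) := hνm.prodMk measurable_const
  have hfm : Measurable fun ω => fZ (ν ω) z₀ := by
    simpa only [Function.comp_def] using (measurable_fZ (n := n)).comp hνz
  have hdm : Measurable fun ω => fZderiv (ν ω) z₀ := by
    simpa only [Function.comp_def] using (measurable_fZderiv (n := n)).comp hνz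
  set S₁ : Set (Ω n) := {ω | δ ≤ |α n (obs (μ n) (ε n) ω) - a|}
  set S₂ : Set (Ω n) := {ω | δ ≤ |fZ (ν ω) z₀ - f₀|}
  set S₃ : Set (Ω n) := {ω | δ ≤ |fZderiv (ν ω) z₀ - d₀|}
  have hS : MeasurableSet (S₁ ∪ S₂ ∪ S₃) :=
    ((measurableSet_le measurable_const (ham.sub_const a).norm).union
      (measurableSet_le measurable_const (hfm.sub_const f₀).norm)).union
      (measurableSet_le measurable_const (hdm.sub_const d₀).norm)
  have hp : 1 / 2 ≤ (P n).real (S₁ ∪ S₂ ∪ S₃)ᶜ := by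
    have q2 : (P n).real S₂ ≤ 1 / 8 := p2
    have q3 : (P n).real S₃ ≤ 1 / 8 := p3
    rw [probReal_compl_eq_one_sub hS]
    have u1 := measureReal_union_le (μ := P n) (S₁ ∪ S₂) S₃
    have u2 := measureReal_union_le (μ := P n) S₁ S₂
    linarith
  have hgap : ∀ ω, (S₁ ∪ S₂ ∪ S₃)ᶜ.indicator (fun _ => c₁) ω
      ≤ linearGap L (α n (obs (μ n) (ε n) ω)) (central κ n) (ν ω) := fun ω => by
    by_cases hω : ω ∈ (S₁ ∪ S₂ ∪ S₃)ᶜ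
    · rw [Set.indicator_of_mem hω]
      simp only [Set.mem_compl_iff, Set.mem_union, not_or, S₁, S₂, S₃, Set.mem_ofPred_eq,
        not_le] at hω
      exact le_linearGap hL0 (hα1 n _) ha0.le ha1.le hδ hδ1 hδf hδD hω.1.2.le hω.2.le hω.1.1.le
        hI hη.le hT.le
    · rw [Set.indicator_of_notMem hω]
      exact linearGap_nonneg _ _ _ _
  calc min (c₁ / 2) 1 ≤ c₁ / 2 := min_le_left _ _
    _ ≤ (P n).real (S₁ ∪ S₂ ∪ S₃)ᶜ * c₁ := by nlinarith
    _ = ∫ ω, (S₁ ∪ S₂ ∪ S₃)ᶜ.indicator (fun _ => c₁) ω ∂(P n) := by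
        rw [integral_indicator_const _ hS.compl, smul_eq_mul]
    _ ≤ _ := integral_mono ((integrable_const c₁).indicator hS.compl)
        ((h n).integrable_linearGap (ht n) ham (fun ω => hα1 n _) hL0 _) hgap

/-! ### The filters of Assumption 1 -/

/-- On either side of `i` the distances `|i - j|` are distinct, so each side contributes at most one
copy of the series. -/
lemma sum_natAbs_sub_le {f : ℕ → ℝ} (hf : Summable f) (hf0 : ∀ k, 0 ≤ f k) {n : ℕ} (i : Fin n) :
    ∑ j : Fin n, f ((i : ℤ) - (j : ℤ)).natAbs ≤ 2 * ∑' k, f k := by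
  have key : ∀ s : Finset (Fin n), Set.InjOn (fun j : Fin n => ((i : ℤ) - (j : ℤ)).natAbs) s →
      ∑ j ∈ s, f ((i : ℤ) - (j : ℤ)).natAbs ≤ ∑' k, f k := fun s hs => by
    rw [← Finset.sum_image (f := f) hs]
    exact hf.sum_le_tsum _ fun k _ => hf0 k
  rw [← Finset.sum_filter_add_sum_filter_not Finset.univ (fun j : Fin n => j ≤ i), two_mul]
  refine add_le_add (key _ fun j hj k hk hjk => ?_) (key _ fun j hj k hk hjk => ?_)
  · simp only [Finset.coe_filter, Finset.mem_univ, true_and, Set.mem_ofPred_eq, Fin.le_def] at hj hk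
    simp only at hjk
    ext
    omega
  · simp only [Finset.coe_filter, Finset.mem_univ, true_and, Set.mem_ofPred_eq, Fin.le_def] at hj hk
    simp only at hjk
    ext
    omega

lemma summable_of_limsup_lt {ρ : ℕ → ℝ≥0}
    (h : limsup (fun M : ℕ => (M : ℝ≥0∞) ^ 2 * (ρ M : ℝ≥0∞)) atTop < 1) :
    Summable fun k => (ρ k : ℝ) := by
  refine Summable.of_norm_bounded_eventually_nat (Real.summable_one_div_nat_pow.2 one_lt_two) ?_
  filter_upwards [eventually_lt_of_limsup_lt h, eventually_gt_atTop 0] with M hM hM0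
  have h1 : (M : ℝ≥0) ^ 2 * ρ M < 1 := by exact_mod_cast hM
  have h2 : (M : ℝ) ^ 2 * ρ M < 1 := by exact_mod_cast h1
  have hM' : (0 : ℝ) < M := by exact_mod_cast hM0
  rw [Real.norm_of_nonneg (ρ M).coe_nonneg, le_div_iff₀ (by positivity), mul_comm]
  exact h2.le

lemma Assumption1.exists_isFilter (h : Assumption1 t) :
    ∃ (ρ : ℕ → ℝ≥0) (R : ℝ), ∀ n, IsFilter (t n) ρ R := by
  obtain ⟨hm, hs, ρ, hρ, hl⟩ := h
  exact ⟨ρ, 2 * ∑' k, (ρ k : ℝ), fun n => ⟨hm n, hs n, hl n,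
    sum_natAbs_sub_le (summable_of_limsup_lt hρ) fun k => (ρ k).coe_nonneg⟩⟩

/-! ### From bounds up to small multiples of `n` to bounds up to `o(n)` -/

/-- The truncated difference `A - B` itself serves as the remainder. It is eventually finite even
where both risks are infinite, by the case `θ = 1`. -/
lemma exists_isLittleO_of_eventually_le {A B : ℕ → ℝ≥0∞}
    (h : ∀ θ > (0 : ℝ), ∀ᶠ n : ℕ in atTop, A n ≤ B n + ENNReal.ofReal (θ * n)) :
    ∃ r : ℕ → ℝ, r =o[atTop] (fun n : ℕ => (n : ℝ)) ∧
      ∀ᶠ n : ℕ in atTop, A n ≤ B n + ENNReal.ofReal (r n) := by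
  refine ⟨fun n => (A n - B n).toReal, isLittleO_iff.2 fun θ hθ => ?_, ?_⟩
  · filter_upwards [h θ hθ] with n hn
    rw [Real.norm_of_nonneg ENNReal.toReal_nonneg, Real.norm_of_nonneg (by positivity)]
    exact ENNReal.toReal_le_of_le_ofReal (by positivity) (tsub_le_iff_left.2 hn)
  · filter_upwards [h 1 one_pos] with n hn
    have : A n - B n ≠ ⊤ := ((tsub_le_iff_left.2 hn).trans_lt ENNReal.ofReal_lt_top).ne
    rw [ENNReal.ofReal_toReal this]
    exact le_add_tsub

/-- As `x ≤ 2N`, the additive margin `5 θ N` exceeds `θ x` and becomes a multiplicative one; an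
infinite `B` is harmless. -/
lemma ofReal_le_mul_of_le {x θ N : ℝ} {B : ℝ≥0∞} (hθ : 0 < θ) (hN : 0 ≤ N) (hx : x ≤ 2 * N)
    (h : ENNReal.ofReal (x + 6 * θ * N) ≤ B + ENNReal.ofReal (θ * N)) :
    ENNReal.ofReal x ≤ (Real.toNNReal (1 + θ)⁻¹ : ℝ≥0) * B := by
  have hc : 0 < (1 + θ)⁻¹ := by positivity
  have hcn : Real.toNNReal (1 + θ)⁻¹ ≠ 0 := by
    rw [Ne, Real.toNNReal_eq_zero, not_le]
    exact hc
  induction B with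
  | top =>
    rw [ENNReal.mul_top (by exact_mod_cast hcn)]
    exact le_top
  | coe b =>
    have h1 : x + 6 * θ * N ≤ b + θ * N := by
      rw [← ENNReal.ofReal_coe_nnreal, ← ENNReal.ofReal_add b.coe_nonneg (by positivity)] at h
      exact (ENNReal.ofReal_le_ofReal_iff (add_nonneg b.coe_nonneg (by positivity))).1 h
    have h2 : x ≤ (1 + θ)⁻¹ * b := by
      rw [inv_mul_eq_div, le_div_iff₀ (by positivity)]
      have := mul_le_mul_of_nonneg_left hx hθ.le
      have := mul_nonneg hθ.le hN
      nlinarith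
    calc ENNReal.ofReal x ≤ ENNReal.ofReal ((1 + θ)⁻¹ * b) := ENNReal.ofReal_le_ofReal h2
      _ = _ := by
        rw [ENNReal.ofReal_mul hc.le, ENNReal.ofReal_coe_nnreal]
        rfl

end

end EBFilter
theorem theorem1 {Ω : ℕ → Type*} [∀ n, MeasurableSpace (Ω n)]
    (P : ∀ n, Measure (Ω n)) [∀ n, IsProbabilityMeasure (P n)]
    (μ ε : ∀ n, Ω n → Fin n → ℝ) (hmodel : ∀ n, IsModel (P n) (μ n) (ε n))
    (t m : ∀ n, (Fin n → ℝ) → Fin n → ℝ) (hm : ∀ n, Measurable (m n))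
    (h1 : Assumption1 t) (h3 : Assumption3 P μ ε t) :
    (∃ r : ℕ → ℝ, r =o[atTop] (fun n : ℕ => (n : ℝ)) ∧ ∀ᶠ n : ℕ in atTop,
      risk (P n) (ebEstimator (μ n) (ε n) (t n)) (μ n)
        ≤ risk (P n) (oracle (μ n) (ε n) (t n)) (μ n) + ENNReal.ofReal (r n)) ∧
    ∀ α : ∀ n, (Fin n → ℝ) → ℝ, Assumption2 P μ ε t m α →
      (∃ r : ℕ → ℝ, r =o[atTop] (fun n : ℕ => (n : ℝ)) ∧ ∀ᶠ n : ℕ in atTop,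
        risk (P n) (oracle (μ n) (ε n) (t n)) (μ n)
          ≤ risk (P n) (fun ω => m n (obs (μ n) (ε n) ω)) (μ n) + ENNReal.ofReal (r n)) ∧
      ∀ (a : ℝ) (G : Measure ℝ) [IsProbabilityMeasure G], 0 < a → a < 1 →
        TendstoInProb P (fun n ω => α n (obs (μ n) (ε n) ω)) a →
        TendstoWeaklyInProb P (fun n ω => empiricalMeasure (nu (μ n) (ε n) (t n) ω)) G →
        G ≠ gaussianReal 0 (Real.toNNReal ((1 - a) / a)) →
        ∃ c : ℝ≥0, c < 1 ∧ ∀ᶠ n : ℕ in atTop,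
          risk (P n) (ebEstimator (μ n) (ε n) (t n)) (μ n)
            ≤ c * risk (P n) (fun ω => m n (obs (μ n) (ε n) ω)) (μ n) := by
  obtain ⟨ρ, R, ht⟩ := h1.exists_isFilter
  refine ⟨exists_isLittleO_of_eventually_le fun θ hθ => ?_, fun α h2 =>
    ⟨exists_isLittleO_of_eventually_le fun θ hθ => ?_, fun a G _ ha0 ha1 hα hF hG => ?_⟩⟩
  · filter_upwards [eventually_risk_comparison hmodel ht h3 (half_pos hθ)] with n hn
    obtain ⟨f1, -, f3⟩ := hn
    calc _ ≤ _ := f1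
      _ ≤ ENNReal.ofReal (regRisk (P n) (μ n) (ε n) (t n) (Real.log n ^ 24)⁻¹)
          + ENNReal.ofReal (θ / 2 * n) := ENNReal.ofReal_add_le
      _ ≤ (_ + ENNReal.ofReal (θ / 2 * n)) + ENNReal.ofReal (θ / 2 * n) := by gcongr
      _ = _ := by
        rw [add_assoc, ← ENNReal.ofReal_add (by positivity) (by positivity)]
        congr 2
        ring
  -- One `θ'` is spent in comparing the oracle with the regularised rule and two in the lower bound
  -- with `c = 0`.
  · set θ' := min (θ / 3) 1
    have hθ' : 0 < θ' := by positivity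
    have hθ3 : 3 * θ' ≤ θ := by linarith [min_le_left (θ / 3) 1]
    obtain ⟨κ, hκ, hlow⟩ := exists_risk_ge hmodel ht h3 hm h2 hθ' (min_le_right _ _)
    filter_upwards [eventually_risk_comparison hmodel ht h3 hθ', hlow κ hκ le_rfl] with n hn hlow
    have h0 := hlow 0 le_rfl zero_le_one (integral_nonneg fun ω => linearGap_nonneg _ _ _ _)
    set r := regRisk (P n) (μ n) (ε n) (t n) (Real.log n ^ 24)⁻¹
    calc _ ≤ ENNReal.ofReal (r + θ' * n) := hn.2.1
      _ = ENNReal.ofReal ((r + (0 - θ') * n) + 2 * θ' * n) := by congr 1; ring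
      _ ≤ ENNReal.ofReal (r + (0 - θ') * n) + ENNReal.ofReal (2 * θ' * n) :=
          ENNReal.ofReal_add_le
      _ ≤ (_ + ENNReal.ofReal (θ' * n)) + ENNReal.ofReal (2 * θ' * n) := by gcongr
      _ ≤ _ := by
        rw [add_assoc, ← ENNReal.ofReal_add (by positivity) (by positivity)]
        gcongr
        calc θ' * n + 2 * θ' * n = 3 * θ' * n := by ring
          _ ≤ θ * n := by gcongr
  · obtain ⟨c, hc0, hc1, κ₁, hκ₁, hgap⟩ :=
      exists_linearGap_ge hmodel ht h2.1 h2.2.1 ha0 ha1 hα hF hG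
    -- Then `c - θ = θ + 6 θ`: one `θ` for the empirical rule, and a margin of `6 θ` for the
    -- multiplicative bound.
    set θ := c / 8
    have hθ : 0 < θ := by positivity
    have hθ1 : θ ≤ 1 / 8 := by simp only [θ]; linarith
    obtain ⟨κ₀, hκ₀, hlow⟩ := exists_risk_ge hmodel ht h3 hm h2 hθ (by linarith)
    refine ⟨Real.toNNReal (1 + θ)⁻¹, ?_, ?_⟩
    · rw [Real.toNNReal_lt_one]
      exact inv_lt_one_of_one_lt₀ (by linarith)
    filter_upwards [eventually_risk_comparison hmodel ht h3 hθ,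
      eventually_regRisk_le hmodel ht hθ,
      hlow (min κ₀ κ₁) (lt_min hκ₀ hκ₁) (min_le_left _ _),
      hgap (min κ₀ κ₁) (lt_min hκ₀ hκ₁) (min_le_right _ _),
      tendsto_log_natCast.eventually_gt_atTop 0] with n hn hreg hlow hgap hL
    have h0 := hlow c hc0.le hc1 hgap
    have hg : ∫ ω, gain Finset.univ (nuFun (t n) (μ n ω) (ε n ω))
        (regScore (Real.log n ^ 24)⁻¹ (nuFun (t n) (μ n ω) (ε n ω))) ∂(P n) ≤ 0 :=
      integral_nonpos fun ω => gain_regScore_nonpos (by positivity) _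
    set r := regRisk (P n) (μ n) (ε n) (t n) (Real.log n ^ 24)⁻¹
    have hn0 : (0 : ℝ) ≤ n := by positivity
    refine hn.1.trans (ofReal_le_mul_of_le hθ hn0 ?_ ?_)
    · have a1 := mul_nonpos_of_nonneg_of_nonpos hn0 hg
      have a2 := mul_le_mul_of_nonneg_right hθ1 hn0
      linarith
    · have e : r + θ * n + 6 * θ * n = r + (c - θ) * n := by
        simp only [θ]
        ring
      rw [e]
      exact h0
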